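/- **Theorem (Uniqueness of Lagrangian coisotropic embedding to first order, non-autonomous case).** All manifolds are smooth, finite-dimensional, Hausdorff and second countable. Let $\pi\colon \mathbf Q\to\mathbb R$ be a smooth (locally trivial) fibre bundle with $\mathbf Q\neq\emptyset$, let $J^1\pi=\{v\in T\mathbf Q : d\pi(v)=\partial_t\}$ be its first jet bundle, with the $1$-form $dt$ and the vertical endomorphism $S=(dq^i-\dot q^i\,dt)\otimes\partial/\partial\dot q^i$. For a smooth Lagrangian $L\colon J^1\pi\to\mathbb R$ put $\theta_L=L\,dt+i_S\,dL$ (that is, $\theta_L = L\,dt + dL\circ S$) and $\omega_L=-d\theta_L$. A *cosymplectic manifold* $(\widetilde M,\widetilde\omega,\widetilde\tau)$ is a manifold of dimension $2n+1$ with a closed $2$-form $\widetilde\omega$ and a closed $1$-form $\widetilde\tau$ such that $\widetilde\tau\wedge\widetilde\omega^n$ vanishes nowhere; its *Reeb vector field* $\widetilde R$ is determined by $i_{\widetilde R}\widetilde\omega=0$ and $\widetilde\tau(\widetilde R)=1$. A *cosymplectic regularization* of $(J^1\pi,\omega_L,dt)$ is a cosymplectic manifold $(\widetilde M,\widetilde\omega,\widetilde\tau)$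 with a smooth embedding $\mathfrak i\colon J^1\pi\hookrightarrow\widetilde M$ such that $\mathfrak i^*\widetilde\omega=\omega_L$, $\mathfrak i^*\widetilde\tau=dt$, and which is coisotropic: for every $m \in J^1\pi$, every $v\in T_{\mathfrak i(m)}\widetilde M$ with $\widetilde\tau(v)=0$ and $\widetilde\omega(v,d\mathfrak i(u))=0$ for all $u\in T_mJ^1\pi$ lies in $d\mathfrak i(T_mJ^1\pi)$. A *jet structure* on a $(2d+1)$-dimensional manifold is a pair $(\widetilde S,\xi)$ of a smooth $(1,1)$-tensor field and a nowhere zero closed $1$-form with $\widetilde S^2=0$, $\operatorname{rank}\widetilde S=d$, $\xi(\operatorname{Im}\widetilde S)=0$, $\operatorname{Im}\widetilde S$ integrable, and Frölicher–Nijenhuis bracket $[\widetilde S,\widetilde S]=2\,\xi\wedge\widetilde S$. For $i=1,2$ let $(\widetilde M_i,\widetilde\omega_i,\widetilde\tau_i)$, with embedding $\mathfrak i_i$, be a cosymplectic regularization of $(J^1\pi,\omega_L,dt)$, and let $\widetilde S_i$ be a $(1,1)$-tensor field on $\widetilde M_i$ such that $(\widetilde S_i,\widetilde\tau_i)$ is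 a jet structure, $i_{\widetilde S_i}\widetilde\omega_i=0$ (that is, $\widetilde\omega_i(\widetilde S_iX,Y)+\widetilde\omega_i(X,\widetilde S_iY)=0$ for all $X,Y$), and $\widetilde S_i\circ d\mathfrak i_i=d\mathfrak i_i\circ S$. Suppose that the Reeb vector fields of both regularizations are tangent to $J^1\pi$ and induce the same vector field on $J^1\pi$. Then there are open neighbourhoods $U_i$ of $\mathfrak i_i(J^1\pi)$ in $\widetilde M_i$ and a diffeomorphism $\psi\colon U_1\to U_2$ with $\psi\circ\mathfrak i_1=\mathfrak i_2$ (that is, $\psi$ is the identity on $J^1\pi$) such that, at every point of $J^1\pi$, the differential $\psi_*\colon T\widetilde M_1|_{J^1\pi}\to T\widetilde M_2|_{J^1\pi}$ carries $(\widetilde\omega_1,\widetilde\tau_1,\widetilde S_1)$ to $(\widetilde\omega_2,\widetilde\tau_2,\widetilde S_2)$. -/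

import Mathlib

open scoped Manifold ContDiff Topology
open Set

noncomputable section

namespace LagReg

/-! ### Differential forms and tensor fields on a manifold -/

section Tensors

variable (E : Type*) [NormedAddCommGroup E] [NormedSpace ℝ E]
  (M : Type*) [TopologicalSpace M] [ChartedSpace E M]

/-- (Not necessarily smooth) differential `k`-forms on `M`. -/
abbrev DiffForm (k : ℕ) := ∀ p : M, (TangentSpace 𝓘(ℝ, E) p) [⋀^Fin k]→L[ℝ] ℝ

/-- (Not necessarily smooth) differential `1`-forms, as fields of linear functionals. -/
abbrev OneForm := ∀ p : M, TangentSpace 𝓘(ℝ, E) p →L[ℝ] ℝ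

/-- (Not necessarily smooth) `(1,1)`-tensor fields, as fields of endomorphisms. -/
abbrev EndField := ∀ p : M, TangentSpace 𝓘(ℝ, E) p →L[ℝ] TangentSpace 𝓘(ℝ, E) p

/-- (Not necessarily smooth) vector fields. -/
abbrev VecField := ∀ p : M, TangentSpace 𝓘(ℝ, E) p

variable {E M}

/-- The differential `df` of a function. -/
def OneForm.ofFun (f : M → ℝ) : OneForm E M := fun p => mfderiv 𝓘(ℝ, E) 𝓘(ℝ, ℝ) f p

/-- A field of linear functionals regarded as an alternating `1`-form. -/
def OneForm.toForm (α : OneForm E M) : DiffForm E M 1 := fun p =>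
  ContinuousAlternatingMap.ofSubsingleton ℝ (TangentSpace 𝓘(ℝ, E) p) ℝ (0 : Fin 1) (α p)

/-- The expression of a form in the chart at `p`: its pullback by the inverse of that chart. -/
def DiffForm.inChart {k : ℕ} (α : DiffForm E M k) (p : M) : E → E [⋀^Fin k]→L[ℝ] ℝ := fun y =>
  (α ((chartAt E p).symm y)).compContinuousLinearMap
    (mfderiv 𝓘(ℝ, E) 𝓘(ℝ, E) (chartAt E p).symm y)

/-- Smoothness of a form: its expressions in charts are smooth. -/
def DiffForm.Smooth {k : ℕ} (α : DiffForm E M k) : Prop :=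
  ∀ p : M, ContDiffOn ℝ ∞ (α.inChart p) (chartAt E p).target

/-- The exterior derivative of a form, computed in a chart around each point. -/
def DiffForm.d {k : ℕ} (α : DiffForm E M k) : DiffForm E M (k + 1) := fun p =>
  (extDeriv (α.inChart p) (chartAt E p p)).compContinuousLinearMap
    (mfderiv 𝓘(ℝ, E) 𝓘(ℝ, E) (chartAt E p) p)

/-- The expression of a `(1,1)`-tensor field in the chart at `p`. -/
def EndField.inChart (S : EndField E M) (p : M) : E → E →L[ℝ] E := fun y =>
  (mfderiv 𝓘(ℝ, E) 𝓘(ℝ, E) (chartAt E p) ((chartAt E p).symm y)).comp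
    ((S ((chartAt E p).symm y)).comp (mfderiv 𝓘(ℝ, E) 𝓘(ℝ, E) (chartAt E p).symm y))

/-- Smoothness of a `(1,1)`-tensor field: its expressions in charts are smooth. -/
def EndField.Smooth (S : EndField E M) : Prop :=
  ∀ p : M, ContDiffOn ℝ ∞ (S.inChart p) (chartAt E p).target

/-- Smoothness of a vector field. -/
def VecField.Smooth [IsManifold 𝓘(ℝ, E) ∞ M] (X : VecField E M) : Prop :=
  ContMDiff 𝓘(ℝ, E) 𝓘(ℝ, E).tangent ∞ (fun p => (⟨p, X p⟩ : TangentBundle 𝓘(ℝ, E) M))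

/-- The image of a vector field under a `(1,1)`-tensor field. -/
def EndField.app (S : EndField E M) (X : VecField E M) : VecField E M := fun p => S p (X p)

/-- The Frölicher–Nijenhuis bracket `[S, S]` of a `(1,1)`-tensor field with itself, evaluated on two
vector fields:
`[S, S](X, Y) = 2 ([SX, SY] + S²[X, Y] - S[SX, Y] - S[X, SY])`. -/
def EndField.fnBracketSelf (S : EndField E M) (X Y : VecField E M) : VecField E M := fun p =>
  (2 : ℝ) • (VectorField.mlieBracket 𝓘(ℝ, E) (S.app X) (S.app Y) p
    + S p (S p (VectorField.mlieBracket 𝓘(ℝ, E) X Y p))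
    - S p (VectorField.mlieBracket 𝓘(ℝ, E) (S.app X) Y p)
    - S p (VectorField.mlieBracket 𝓘(ℝ, E) X (S.app Y) p))

/-- The exterior product `τ ∧ Ω ∧ ⋯ ∧ Ω` (with `n` factors `Ω`) at the point `p`, evaluated on
`2 n + 1` tangent vectors. -/
def wedgeTop (n : ℕ) (τ : OneForm E M) (Ω : DiffForm E M 2) (p : M)
    (v : Fin (2 * n + 1) → TangentSpace 𝓘(ℝ, E) p) : ℝ :=
  ((2 : ℝ) ^ n)⁻¹ * ∑ σ : Equiv.Perm (Fin (2 * n + 1)),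
    ((Equiv.Perm.sign σ : ℤ) : ℝ) * (τ p (v (σ 0)) *
      ∏ i : Fin n, Ω p ![v (σ ⟨2 * (i : ℕ) + 1, by omega⟩), v (σ ⟨2 * (i : ℕ) + 2, by omega⟩)])

/-- The image distribution of the `(1,1)`-tensor field `S`, of rank `d`, is integrable: through
every point passes an integral submanifold (parametrized here by an immersion of a
neighbourhood of the origin of `ℝ^d`). -/
def EndField.ImageIntegrable (S : EndField E M) (d : ℕ) : Prop :=
  ∀ p : M, ∃ f : EuclideanSpace ℝ (Fin d) → M, f 0 = p ∧
    ∀ᶠ y in 𝓝 (0 : EuclideanSpace ℝ (Fin d)),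
      ContMDiffAt 𝓘(ℝ, EuclideanSpace ℝ (Fin d)) 𝓘(ℝ, E) ∞ f y ∧
      Function.Injective (mfderiv 𝓘(ℝ, EuclideanSpace ℝ (Fin d)) 𝓘(ℝ, E) f y) ∧
      Set.range (mfderiv 𝓘(ℝ, EuclideanSpace ℝ (Fin d)) 𝓘(ℝ, E) f y) = Set.range (S (f y))

/-- `(Ω, τ)` is a cosymplectic structure on the manifold `M`: closed smooth forms on a manifold of
dimension `2 n + 1` such that `τ ∧ Ω^n` vanishes nowhere. -/
structure IsCosymplectic (Ω : DiffForm E M 2) (τ : OneForm E M) : Prop where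
  smooth_two : Ω.Smooth
  smooth_one : τ.toForm.Smooth
  closed_two : ∀ p, Ω.d p = 0
  closed_one : ∀ p, τ.toForm.d p = 0
  nondegenerate : ∃ n : ℕ, Module.finrank ℝ E = 2 * n + 1 ∧
    ∀ p : M, ∃ v : Fin (2 * n + 1) → TangentSpace 𝓘(ℝ, E) p, wedgeTop n τ Ω p v ≠ 0

/-- `v` is the value at `p` of the Reeb vector field of `(Ω, τ)`, i.e. `i_v Ω = 0`, `τ(v) = 1`. -/
def IsReebVector (Ω : DiffForm E M 2) (τ : OneForm E M) (p : M) (v : TangentSpace 𝓘(ℝ, E) p) :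
    Prop :=
  (∀ w : TangentSpace 𝓘(ℝ, E) p, Ω p ![v, w] = 0) ∧ τ p v = 1

/-- `(S, ξ)` is a jet structure on the `(2 d + 1)`-dimensional manifold `M`. -/
structure IsJetStructure [IsManifold 𝓘(ℝ, E) ∞ M] (S : EndField E M) (ξ : OneForm E M) : Prop where
  smooth_tensor : S.Smooth
  smooth_form : ξ.toForm.Smooth
  form_ne_zero : ∀ p, ξ p ≠ 0
  sq_zero : ∀ p v, S p (S p v) = 0
  form_image : ∀ p v, ξ p (S p v) = 0
  rank_integrable : ∃ d : ℕ, Module.finrank ℝ E = 2 * d + 1 ∧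
    (∀ p, Module.finrank ℝ (LinearMap.range (S p).toLinearMap) = d) ∧ S.ImageIntegrable d
  form_closed : ∀ p, ξ.toForm.d p = 0
  bracket : ∀ X Y : VecField E M, X.Smooth → Y.Smooth → ∀ p,
    S.fnBracketSelf X Y p = (2 : ℝ) • (ξ p (X p) • S p (Y p) - ξ p (Y p) • S p (X p))

/-- The condition `i_S Ω = 0`. -/
def IsLagrangianFor (S : EndField E M) (Ω : DiffForm E M 2) : Prop :=
  ∀ (p : M) (u v : TangentSpace 𝓘(ℝ, E) p), Ω p ![S p u, v] + Ω p ![u, S p v] = 0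

end Tensors

section Regularization

variable {E : Type*} [NormedAddCommGroup E] [NormedSpace ℝ E]
  {M : Type*} [TopologicalSpace M] [ChartedSpace E M]
  {E' : Type*} [NormedAddCommGroup E'] [NormedSpace ℝ E']
  {M' : Type*} [TopologicalSpace M'] [ChartedSpace E' M']

/-- `i : M → M'` is a coisotropic embedding of `(M, Ω, τ)` into the cosymplectic manifold
`(M', Ω', τ')`. Coisotropy says that every `v` with `τ'(v) = 0` and `Ω'(v, TM) = 0` is tangent
to `M`. -/
structure IsCosymplecticRegularization (Ω : DiffForm E M 2) (τ : OneForm E M)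
    (Ω' : DiffForm E' M' 2) (τ' : OneForm E' M') (i : M → M') : Prop where
  cosymplectic : IsCosymplectic Ω' τ'
  embedding : Manifold.IsSmoothEmbedding 𝓘(ℝ, E) 𝓘(ℝ, E') ∞ i
  pullback_two : ∀ (m : M) (u v : TangentSpace 𝓘(ℝ, E) m),
    Ω' (i m) ![mfderiv 𝓘(ℝ, E) 𝓘(ℝ, E') i m u, mfderiv 𝓘(ℝ, E) 𝓘(ℝ, E') i m v] = Ω m ![u, v]
  pullback_one : ∀ (m : M) (u : TangentSpace 𝓘(ℝ, E) m),
    τ' (i m) (mfderiv 𝓘(ℝ, E) 𝓘(ℝ, E') i m u) = τ m u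
  coisotropic : ∀ (m : M) (v : TangentSpace 𝓘(ℝ, E') (i m)), τ' (i m) v = 0 →
    (∀ u : TangentSpace 𝓘(ℝ, E) m, Ω' (i m) ![v, mfderiv 𝓘(ℝ, E) 𝓘(ℝ, E') i m u] = 0) →
    ∃ u : TangentSpace 𝓘(ℝ, E) m, mfderiv 𝓘(ℝ, E) 𝓘(ℝ, E') i m u = v

/-- The map `i : M → M'` intertwines the `(1,1)`-tensor fields `S` and `S'`. -/
def PreservesTensor (S : EndField E M) (S' : EndField E' M') (i : M → M') : Prop :=
  ∀ (m : M) (u : TangentSpace 𝓘(ℝ, E) m),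
    S' (i m) (mfderiv 𝓘(ℝ, E) 𝓘(ℝ, E') i m u) = mfderiv 𝓘(ℝ, E) 𝓘(ℝ, E') i m (S m u)

end Regularization

/-! ### Fibre bundles over the line and their first jet bundles -/

section Jets

/-- A smooth fibre bundle `Q → ℝ` with standard fibre `N` (modelled on `F`). -/
structure ConfigBundle (EQ : Type*) [NormedAddCommGroup EQ] [NormedSpace ℝ EQ]
    (Q : Type*) [TopologicalSpace Q] [ChartedSpace EQ Q]
    (F : Type*) [NormedAddCommGroup F] [NormedSpace ℝ F]
    (N : Type*) [TopologicalSpace N] [ChartedSpace F N] where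
  /-- the projection onto the time axis -/
  proj : Q → ℝ
  locallyTrivial : ∀ t : ℝ, ∃ e : Bundle.Trivialization N proj, t ∈ e.baseSet ∧
    ContMDiffOn 𝓘(ℝ, EQ) (𝓘(ℝ, ℝ).prod 𝓘(ℝ, F)) ∞ e e.source ∧
    ContMDiffOn (𝓘(ℝ, ℝ).prod 𝓘(ℝ, F)) 𝓘(ℝ, EQ) ∞ e.toOpenPartialHomeomorph.symm e.target

variable {EQ : Type*} [NormedAddCommGroup EQ] [NormedSpace ℝ EQ]
  {Q : Type*} [TopologicalSpace Q] [ChartedSpace EQ Q]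
  {F : Type*} [NormedAddCommGroup F] [NormedSpace ℝ F]
  {N : Type*} [TopologicalSpace N] [ChartedSpace F N]

/-- Fibred coordinates `(t, q)` on `Q`, with `t` the projection to `ℝ`. -/
structure FibredChart (π : ConfigBundle EQ Q F N) where
  chart : OpenPartialHomeomorph Q (ℝ × F)
  smooth : ContMDiffOn 𝓘(ℝ, EQ) 𝓘(ℝ, ℝ × F) ∞ chart chart.source
  smooth_symm : ContMDiffOn 𝓘(ℝ, ℝ × F) 𝓘(ℝ, EQ) ∞ chart.symm chart.target
  fst_eq : ∀ q ∈ chart.source, (chart q).1 = π.proj q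

theorem exists_fibredChart [IsManifold 𝓘(ℝ, F) ∞ N] (π : ConfigBundle EQ Q F N) (q : Q) :
    ∃ A : FibredChart π, q ∈ A.chart.source := by
  obtain ⟨e, he, h1, h2⟩ := π.locallyTrivial (π.proj q)
  have hq : q ∈ e.source := by rw [e.source_eq]; exact he
  let c : OpenPartialHomeomorph (ℝ × N) (ℝ × F) :=
    (OpenPartialHomeomorph.refl ℝ).prod (chartAt F (e q).2)
  have hc : ContMDiffOn (𝓘(ℝ, ℝ).prod 𝓘(ℝ, F)) 𝓘(ℝ, ℝ × F) ∞ c c.source := by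
    refine ContMDiffOn.prodMk_space contMDiffOn_fst ?_
    refine (contMDiffOn_chart (I := 𝓘(ℝ, F)) (n := ∞) (x := (e q).2)).comp contMDiffOn_snd ?_
    intro x hx
    exact hx.2
  have hc' : ContMDiffOn 𝓘(ℝ, ℝ × F) (𝓘(ℝ, ℝ).prod 𝓘(ℝ, F)) ∞ c.symm c.target := by
    refine ContMDiffOn.prodMk contDiff_fst.contMDiff.contMDiffOn ?_
    refine (contMDiffOn_chart_symm (I := 𝓘(ℝ, F)) (n := ∞) (x := (e q).2)).comp
      contDiff_snd.contMDiff.contMDiffOn ?_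
    intro x hx
    exact hx.2
  refine ⟨⟨e.toOpenPartialHomeomorph.trans c, ?_, ?_, ?_⟩, ?_⟩
  · exact hc.comp (h1.mono (by intro x hx; exact hx.1)) (by intro x hx; exact hx.2)
  · refine h2.comp (hc'.mono (by intro x hx; exact hx.1)) (by intro x hx; exact hx.2)
  · intro x hx
    exact e.proj_toFun x hx.1
  · refine ⟨hq, ?_⟩
    exact ⟨mem_univ _, mem_chart_source F _⟩

theorem FibredChart.mdifferentiable {π : ConfigBundle EQ Q F N} (A : FibredChart π) :
    A.chart.MDifferentiable 𝓘(ℝ, EQ) 𝓘(ℝ, ℝ × F) :=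
  ⟨A.smooth.mdifferentiableOn (by simp), A.smooth_symm.mdifferentiableOn (by simp)⟩

/-- The differential `dπ` of the projection to the time axis. -/
def ConfigBundle.dproj (π : ConfigBundle EQ Q F N) (q : Q) : TangentSpace 𝓘(ℝ, EQ) q →L[ℝ] ℝ :=
  mfderiv 𝓘(ℝ, EQ) 𝓘(ℝ, ℝ) π.proj q

/-- The differential of a fibred chart. -/
def FibredChart.dchart {π : ConfigBundle EQ Q F N} (A : FibredChart π) (q : Q) :
    TangentSpace 𝓘(ℝ, EQ) q →L[ℝ] ℝ × F :=
  mfderiv 𝓘(ℝ, EQ) 𝓘(ℝ, ℝ × F) A.chart q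

/-- The differential of the inverse of a fibred chart. -/
def FibredChart.dsymm {π : ConfigBundle EQ Q F N} (A : FibredChart π) (y : ℝ × F) :
    ℝ × F →L[ℝ] TangentSpace 𝓘(ℝ, EQ) (A.chart.symm y) :=
  mfderiv 𝓘(ℝ, ℝ × F) 𝓘(ℝ, EQ) A.chart.symm y

theorem FibredChart.dchart_dsymm {π : ConfigBundle EQ Q F N} (A : FibredChart π) {y : ℝ × F}
    (hy : y ∈ A.chart.target) (w : ℝ × F) : A.dchart (A.chart.symm y) (A.dsymm y w) = w :=
  DFunLike.congr_fun (A.mdifferentiable.comp_symm_deriv hy) w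

theorem FibredChart.dsymm_dchart {π : ConfigBundle EQ Q F N} (A : FibredChart π) {q : Q}
    (hq : q ∈ A.chart.source) (w : EQ) :
    (A.dsymm (A.chart q) (A.dchart q w) : EQ) = w :=
  DFunLike.congr_fun (A.mdifferentiable.symm_comp_deriv hq) w

theorem FibredChart.dchart_fst {π : ConfigBundle EQ Q F N} (A : FibredChart π) {q : Q}
    (hq : q ∈ A.chart.source) (v : TangentSpace 𝓘(ℝ, EQ) q) :
    (A.dchart q v).1 = π.dproj q v := by
  have h1 : π.proj =ᶠ[𝓝 q] (Prod.fst : ℝ × F → ℝ) ∘ A.chart := by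
    filter_upwards [A.chart.open_source.mem_nhds hq] with x hx
    exact (A.fst_eq x hx).symm
  have h2 : MDifferentiableAt 𝓘(ℝ, ℝ × F) 𝓘(ℝ, ℝ) (Prod.fst : ℝ × F → ℝ) (A.chart q) :=
    differentiableAt_fst.mdifferentiableAt
  have h3 : mfderiv 𝓘(ℝ, ℝ × F) 𝓘(ℝ, ℝ) (Prod.fst : ℝ × F → ℝ) (A.chart q)
      = ContinuousLinearMap.fst ℝ ℝ F := by
    rw [mfderiv_eq_fderiv]
    exact fderiv_fst
  unfold ConfigBundle.dproj
  rw [h1.mfderiv_eq, mfderiv_comp q h2 (A.mdifferentiable.mdifferentiableAt hq), h3]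
  rfl

/-- The first jet bundle of `π : Q → ℝ`, as the affine subbundle of `TQ` of the vectors `v` with
`dπ(v) = ∂/∂t`; the `1`-jet at `t` of a section `γ` is identified with its velocity `γ'(t)`. -/
def JetBundle (π : ConfigBundle EQ Q F N) :=
  {v : TangentBundle 𝓘(ℝ, EQ) Q // π.dproj v.proj v.2 = 1}

namespace JetBundle

variable {π : ConfigBundle EQ Q F N}

/-- The projection `J¹π → Q`. -/
def toQ (j : JetBundle π) : Q := j.1.proj

/-- The velocity of a jet, a tangent vector of `Q`. -/
def vel (j : JetBundle π) : TangentSpace 𝓘(ℝ, EQ) j.toQ := j.1.2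

theorem dproj_vel (j : JetBundle π) : π.dproj j.toQ j.vel = 1 := j.2

variable (π) in
/-- The vertical tangent space `ker dπ_q` of `Q`. -/
def vertSpace (q : Q) : Submodule ℝ EQ := LinearMap.ker (π.dproj q).toLinearMap

/-- The inclusion of `ker dπ_q` into the tangent space of `Q`. -/
def vertIncl (q : Q) : vertSpace π q →L[ℝ] TangentSpace 𝓘(ℝ, EQ) q := (vertSpace π q).subtypeL

/-- The affine structure of `J¹π → Q`: translation of a jet by vertical tangent vectors. -/
def translate (j : JetBundle π) (ξ : vertSpace π j.toQ) : JetBundle π :=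
  ⟨⟨j.toQ, j.vel + vertIncl j.toQ ξ⟩, by
    have h : π.dproj j.toQ (vertIncl j.toQ ξ) = 0 := ξ.2
    rw [map_add, h, dproj_vel, add_zero]⟩

theorem translate_zero (j : JetBundle π) : translate j 0 = j := by
  have h : j.vel + vertIncl (π := π) j.toQ 0 = j.vel := by rw [map_zero, add_zero]
  exact Subtype.ext (Bundle.TotalSpace.ext rfl (heq_of_eq h))

/-- The natural coordinates `(t, q, q̇)` on `J¹π` induced by fibred coordinates on `Q`. -/
def coord (A : FibredChart π) (j : JetBundle π) : ℝ × F × F :=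
  ((A.chart j.toQ).1, (A.chart j.toQ).2, (A.dchart j.toQ j.vel).2)

open Classical in
/-- The inverse of `coord A`; the jet `j₀` is only used as a value outside the range of `coord A`. -/
def ofCoord (A : FibredChart π) (j₀ : JetBundle π) (p : ℝ × F × F) : JetBundle π :=
  if h : π.dproj (A.chart.symm (p.1, p.2.1)) (A.dsymm (p.1, p.2.1) (1, p.2.2)) = 1
  then ⟨⟨A.chart.symm (p.1, p.2.1), A.dsymm (p.1, p.2.1) (1, p.2.2)⟩, h⟩
  else j₀

theorem ofCoord_cond (A : FibredChart π) {p : ℝ × F × F} (hp : (p.1, p.2.1) ∈ A.chart.target) :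
    π.dproj (A.chart.symm (p.1, p.2.1)) (A.dsymm (p.1, p.2.1) (1, p.2.2)) = 1 := by
  rw [← A.dchart_fst (A.chart.map_target hp), A.dchart_dsymm hp]

theorem ofCoord_eq (A : FibredChart π) (j₀ : JetBundle π) {p : ℝ × F × F}
    (hp : (p.1, p.2.1) ∈ A.chart.target) :
    ofCoord A j₀ p = ⟨⟨A.chart.symm (p.1, p.2.1), A.dsymm (p.1, p.2.1) (1, p.2.2)⟩,
      ofCoord_cond A hp⟩ :=
  dif_pos (ofCoord_cond A hp)

theorem ofCoord_val (A : FibredChart π) (j₀ : JetBundle π) {p : ℝ × F × F}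
    (hp : (p.1, p.2.1) ∈ A.chart.target) :
    (ofCoord A j₀ p).1 = ⟨A.chart.symm (p.1, p.2.1), A.dsymm (p.1, p.2.1) (1, p.2.2)⟩ := by
  rw [ofCoord_eq A j₀ hp]

theorem coord_ofCoord (A : FibredChart π) (j₀ : JetBundle π) {p : ℝ × F × F}
    (hp : (p.1, p.2.1) ∈ A.chart.target) : coord A (ofCoord A j₀ p) = p := by
  rw [ofCoord_eq A j₀ hp]
  have h1 : A.chart (A.chart.symm (p.1, p.2.1)) = (p.1, p.2.1) := A.chart.right_inv hp
  have h2 := A.dchart_dsymm hp (1, p.2.2)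
  have h3 : (A.chart (A.chart.symm (p.1, p.2.1))).1 = p.1 := congrArg Prod.fst h1
  have h4 : (A.chart (A.chart.symm (p.1, p.2.1))).2 = p.2.1 := congrArg Prod.snd h1
  have h5 := congrArg Prod.snd h2
  exact Prod.ext h3 (Prod.ext h4 h5)

theorem dchart_vel (A : FibredChart π) {j : JetBundle π} (hj : j.toQ ∈ A.chart.source) :
    A.dchart j.toQ j.vel = (1, (coord A j).2.2) := by
  refine Prod.ext ?_ rfl
  rw [A.dchart_fst hj]
  exact j.2

theorem ofCoord_coord (A : FibredChart π) (j₀ : JetBundle π) {j : JetBundle π}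
    (hj : j.toQ ∈ A.chart.source) : ofCoord A j₀ (coord A j) = j := by
  have hp : A.chart j.toQ ∈ A.chart.target := A.chart.map_source hj
  apply Subtype.ext
  rw [ofCoord_val A j₀ (p := coord A j) hp, ← dchart_vel A hj]
  refine Bundle.TotalSpace.ext (A.chart.left_inv hj) ?_
  exact heq_of_eq (A.dsymm_dchart hj j.vel)

/-- The change of fibred coordinates. -/
theorem contDiffOn_transition (A B : FibredChart π) :
    ContDiffOn ℝ ∞ (B.chart ∘ A.chart.symm) (A.chart.symm.trans B.chart).source := by
  rw [← contMDiffOn_iff_contDiffOn]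
  exact B.smooth.comp (A.smooth_symm.mono fun y hy => hy.1) (fun y hy => hy.2)

theorem coord_ofCoord_transition (A B : FibredChart π) (j₀ : JetBundle π) {p : ℝ × F × F}
    (hp : (p.1, p.2.1) ∈ (A.chart.symm.trans B.chart).source) :
    coord B (ofCoord A j₀ p) = (((B.chart ∘ A.chart.symm) (p.1, p.2.1)).1,
      ((B.chart ∘ A.chart.symm) (p.1, p.2.1)).2,
      (fderiv ℝ (B.chart ∘ A.chart.symm) (p.1, p.2.1) (1, p.2.2)).2) := by
  rw [ofCoord_eq A j₀ hp.1]
  have h1 : mfderiv 𝓘(ℝ, ℝ × F) 𝓘(ℝ, ℝ × F) (B.chart ∘ A.chart.symm) (p.1, p.2.1)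
      = (mfderiv 𝓘(ℝ, EQ) 𝓘(ℝ, ℝ × F) B.chart (A.chart.symm (p.1, p.2.1))).comp
        (mfderiv 𝓘(ℝ, ℝ × F) 𝓘(ℝ, EQ) A.chart.symm (p.1, p.2.1)) :=
    mfderiv_comp (p.1, p.2.1) (B.mdifferentiable.mdifferentiableAt hp.2)
      (A.mdifferentiable.symm.mdifferentiableAt hp.1)
  rw [mfderiv_eq_fderiv] at h1
  have h2 := DFunLike.congr_fun h1 ((1, p.2.2) : ℝ × F)
  have h3 := congrArg Prod.snd h2
  exact Prod.ext rfl (Prod.ext rfl h3.symm)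

variable [IsManifold 𝓘(ℝ, EQ) ∞ Q]

instance : TopologicalSpace (JetBundle π) := instTopologicalSpaceSubtype

theorem continuous_toQ : Continuous (toQ : JetBundle π → Q) :=
  (FiberBundle.continuous_proj EQ (TangentSpace 𝓘(ℝ, EQ))).comp continuous_subtype_val

theorem continuousOn_coord (A : FibredChart π) :
    ContinuousOn (coord A) (toQ ⁻¹' A.chart.source) := by
  have h1 := (A.smooth.continuousOn_tangentMapWithin (by simp) A.chart.open_source.uniqueMDiffOn)
  have h2 : ContinuousOn (fun j : JetBundle π =>
      (tangentBundleModelSpaceHomeomorph 𝓘(ℝ, ℝ × F)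
        (tangentMapWithin 𝓘(ℝ, EQ) 𝓘(ℝ, ℝ × F) A.chart A.chart.source j.1)))
      (toQ ⁻¹' A.chart.source) :=
    (tangentBundleModelSpaceHomeomorph 𝓘(ℝ, ℝ × F)).continuous.comp_continuousOn
      (h1.comp continuous_subtype_val.continuousOn (fun _ hj => hj))
  have h4 : ContinuousOn (fun j : JetBundle π =>
      (((A.chart j.toQ, A.dchart j.toQ j.vel)) : (ℝ × F) × (ℝ × F))) (toQ ⁻¹' A.chart.source) := by
    refine h2.congr fun j hj => ?_
    have h5 := mfderivWithin_of_isOpen (I := 𝓘(ℝ, EQ)) (I' := 𝓘(ℝ, ℝ × F)) (f := A.chart)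
      A.chart.open_source hj
    exact Prod.ext rfl (DFunLike.congr_fun h5 j.vel).symm
  exact (continuous_fst.comp continuous_fst).comp_continuousOn h4 |>.prodMk
    (((continuous_snd.comp continuous_fst).comp_continuousOn h4).prodMk
      ((continuous_snd.comp continuous_snd).comp_continuousOn h4))

theorem continuousOn_ofCoord (A : FibredChart π) (j₀ : JetBundle π) :
    ContinuousOn (ofCoord A j₀) {p | (p.1, p.2.1) ∈ A.chart.target} := by
  have h1 := (A.smooth_symm.continuousOn_tangentMapWithin (by simp)
    A.chart.open_target.uniqueMDiffOn)
  have h0 : Continuous (fun p : ℝ × F × F =>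
      (tangentBundleModelSpaceHomeomorph 𝓘(ℝ, ℝ × F)).symm
        (((p.1, p.2.1), (1, p.2.2)) : (ℝ × F) × (ℝ × F))) := by
    refine (tangentBundleModelSpaceHomeomorph 𝓘(ℝ, ℝ × F)).symm.continuous.comp ?_
    exact Continuous.prodMk (by fun_prop) (by fun_prop)
  have h2 := h1.comp (s := {p : ℝ × F × F | (p.1, p.2.1) ∈ A.chart.target})
    h0.continuousOn (fun p hp => hp)
  refine Topology.IsInducing.subtypeVal.continuousOn_iff.2 (h2.congr fun p hp => ?_)
  refine (ofCoord_val A j₀ hp).trans ?_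
  have h5 := mfderivWithin_of_isOpen (I := 𝓘(ℝ, ℝ × F)) (I' := 𝓘(ℝ, EQ)) (f := A.chart.symm)
    A.chart.open_target hp
  refine Bundle.TotalSpace.ext rfl (heq_of_eq ?_)
  exact (DFunLike.congr_fun h5 ((1, p.2.2) : ℝ × F)).symm

/-- The chart of `J¹π` with the natural coordinates `(t, q, q̇)`. -/
def jetChart (A : FibredChart π) (j₀ : JetBundle π) :
    OpenPartialHomeomorph (JetBundle π) (ℝ × F × F) where
  toFun := coord A
  invFun := ofCoord A j₀
  source := toQ ⁻¹' A.chart.source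
  target := {p | (p.1, p.2.1) ∈ A.chart.target}
  map_source' _ hj := A.chart.map_source hj
  map_target' p hp := by
    have := congrArg Bundle.TotalSpace.proj (ofCoord_val A j₀ hp)
    change (ofCoord A j₀ p).1.proj ∈ A.chart.source
    rw [this]
    exact A.chart.map_target hp
  left_inv' _ hj := ofCoord_coord A j₀ hj
  right_inv' p hp := coord_ofCoord A j₀ hp
  open_source := A.chart.open_source.preimage continuous_toQ
  open_target := A.chart.open_target.preimage (by fun_prop)
  continuousOn_toFun := continuousOn_coord A
  continuousOn_invFun := continuousOn_ofCoord A j₀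

variable [IsManifold 𝓘(ℝ, F) ∞ N]

instance : ChartedSpace (ℝ × F × F) (JetBundle π) where
  atlas := {c | ∃ (A : FibredChart π) (j₀ : JetBundle π), c = jetChart A j₀}
  chartAt j := jetChart (Classical.choose (exists_fibredChart π j.toQ)) j
  mem_chart_source j := Classical.choose_spec (exists_fibredChart π j.toQ)
  chart_mem_atlas _ := ⟨_, _, rfl⟩

theorem chartAt_eq (j : JetBundle π) : ∃ A : FibredChart π,
    j.toQ ∈ A.chart.source ∧ chartAt (ℝ × F × F) j = jetChart A j :=
  ⟨_, Classical.choose_spec (exists_fibredChart π j.toQ), rfl⟩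

instance : IsManifold 𝓘(ℝ, ℝ × F × F) ∞ (JetBundle π) := by
  apply isManifold_of_contDiffOn
  rintro _ _ ⟨A, j₀, rfl⟩ ⟨B, j₁, rfl⟩
  have hT := contDiffOn_transition A B
  have hO := (A.chart.symm.trans B.chart).open_source
  have hD : ContDiffOn ℝ ∞ (fderiv ℝ (B.chart ∘ A.chart.symm))
      (A.chart.symm.trans B.chart).source := hT.fderiv_of_isOpen hO (by simp)
  have hl : ContDiff ℝ ∞ (fun p : ℝ × F × F => (p.1, p.2.1)) := by fun_prop
  have hm : ContDiff ℝ ∞ (fun p : ℝ × F × F => ((1 : ℝ), p.2.2)) := by fun_prop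
  have hs : {p : ℝ × F × F | (p.1, p.2.1) ∈ (A.chart.symm.trans B.chart).source}
      ⊆ (fun p : ℝ × F × F => (p.1, p.2.1)) ⁻¹' (A.chart.symm.trans B.chart).source :=
    fun p hp => hp
  have h1 := hT.comp hl.contDiffOn hs
  have h2 := (hD.comp hl.contDiffOn hs).clm_apply hm.contDiffOn
  have h3 := h1.fst.prodMk (h1.snd.prodMk h2.snd)
  have key : ∀ p ∈ ((jetChart A j₀).symm.trans (jetChart B j₁)).source,
      (p.1, p.2.1) ∈ (A.chart.symm.trans B.chart).source := by
    intro p hp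
    have hp1 : (p.1, p.2.1) ∈ A.chart.target := hp.1
    refine ⟨hp1, ?_⟩
    have h4 : (ofCoord A j₀ p).toQ ∈ B.chart.source := hp.2
    rw [ofCoord_eq A j₀ hp1] at h4
    exact h4
  have h4 : ContDiffOn ℝ ∞ ((jetChart A j₀).symm.trans (jetChart B j₁))
      ((jetChart A j₀).symm.trans (jetChart B j₁)).source :=
    (h3.mono key).congr fun p hp => coord_ofCoord_transition A B j₀ (key p hp)
  exact h4.mono fun p hp => hp.1

theorem jetChart_mem_maximalAtlas (A : FibredChart π) (j₀ : JetBundle π) :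
    jetChart A j₀ ∈ IsManifold.maximalAtlas 𝓘(ℝ, ℝ × F × F) ∞ (JetBundle π) :=
  IsManifold.subset_maximalAtlas ⟨A, j₀, rfl⟩

theorem contMDiff_toQ :
    ContMDiff 𝓘(ℝ, ℝ × F × F) 𝓘(ℝ, EQ) ∞ (toQ : JetBundle π → Q) := by
  intro j
  obtain ⟨A, hj⟩ := exists_fibredChart π j.toQ
  have h1 : ContMDiffOn 𝓘(ℝ, ℝ × F × F) 𝓘(ℝ, ℝ × F × F) ∞ (coord A) (toQ ⁻¹' A.chart.source) :=
    contMDiffOn_of_mem_maximalAtlas (jetChart_mem_maximalAtlas A j)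
  have hl : ContDiff ℝ ∞ (fun p : ℝ × F × F => (p.1, p.2.1)) := by fun_prop
  have h2 := A.smooth_symm.comp (hl.contMDiff.comp_contMDiffOn h1)
    (fun k hk => A.chart.map_source hk)
  refine (h2.congr fun k hk => (A.chart.left_inv hk).symm).contMDiffAt ?_
  exact (A.chart.open_source.preimage continuous_toQ).mem_nhds hj

/-! ### The geometry of the jet bundle -/

/-- The time function `t` on `J¹π`. -/
def time (j : JetBundle π) : ℝ := π.proj j.toQ

variable (π) in
/-- The `1`-form `dt` on `J¹π`. -/
def dt : OneForm (ℝ × F × F) (JetBundle π) :=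
  OneForm.ofFun (time : JetBundle π → ℝ)

/-- The differential of the projection `J¹π → Q`. -/
def dtoQ (j : JetBundle π) :
    TangentSpace 𝓘(ℝ, ℝ × F × F) j →L[ℝ] TangentSpace 𝓘(ℝ, EQ) j.toQ :=
  mfderiv 𝓘(ℝ, ℝ × F × F) 𝓘(ℝ, EQ) (toQ : JetBundle π → Q) j

theorem dproj_dtoQ (j : JetBundle π) (w : TangentSpace 𝓘(ℝ, ℝ × F × F) j) :
    π.dproj j.toQ (dtoQ j w) = dt π j w := by
  obtain ⟨A, hj⟩ := exists_fibredChart π j.toQ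
  have h1 : MDifferentiableAt 𝓘(ℝ, EQ) 𝓘(ℝ, ℝ) π.proj j.toQ := by
    have h2 : MDifferentiableAt 𝓘(ℝ, EQ) 𝓘(ℝ, ℝ) ((Prod.fst : ℝ × F → ℝ) ∘ A.chart) j.toQ :=
      MDifferentiableAt.comp j.toQ
        (differentiableAt_fst.mdifferentiableAt :
          MDifferentiableAt 𝓘(ℝ, ℝ × F) 𝓘(ℝ, ℝ) (Prod.fst : ℝ × F → ℝ) (A.chart j.toQ))
        (A.mdifferentiable.mdifferentiableAt hj)
    refine h2.congr_of_eventuallyEq ?_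
    filter_upwards [A.chart.open_source.mem_nhds hj] with x hx
    exact (A.fst_eq x hx).symm
  have h3 := mfderiv_comp j h1 ((contMDiff_toQ (π := π)).mdifferentiableAt (x := j) (by simp))
  exact (DFunLike.congr_fun h3 w).symm

/-- The vertical lift at `j` of a vertical tangent vector of `Q`: the velocity at `0` of the curve
`s ↦ j + s ξ`. -/
def vlift (j : JetBundle π) : vertSpace π j.toQ →L[ℝ] TangentSpace 𝓘(ℝ, ℝ × F × F) j :=
  mfderiv 𝓘(ℝ, vertSpace π j.toQ) 𝓘(ℝ, ℝ × F × F) (translate j) 0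

/-- The linear map `w ↦ d(toQ)(w) - dt(w) · vel(j)`, in coordinates `dq^i - q̇^i dt`. -/
def contactAux (j : JetBundle π) : TangentSpace 𝓘(ℝ, ℝ × F × F) j →L[ℝ] EQ :=
  dtoQ j - (dt π j).smulRight j.vel

theorem contactAux_mem (j : JetBundle π) (w : TangentSpace 𝓘(ℝ, ℝ × F × F) j) :
    contactAux j w ∈ vertSpace π j.toQ := by
  have h1 : π.dproj j.toQ (dtoQ j w - dt π j w • j.vel) = 0 := by
    rw [map_sub, map_smul, dproj_vel, dproj_dtoQ, smul_eq_mul, mul_one, sub_self]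
  exact h1

/-- The map `contactAux j`, as a map with values in the vertical vectors of `Q`. -/
def contact (j : JetBundle π) : TangentSpace 𝓘(ℝ, ℝ × F × F) j →L[ℝ] vertSpace π j.toQ :=
  (contactAux j).codRestrict (vertSpace π j.toQ) (contactAux_mem j)

variable (π) in
/-- The vertical endomorphism `S = (dq^i - q̇^i dt) ⊗ ∂/∂q̇^i` of `J¹π`. -/
def vertEnd : EndField (ℝ × F × F) (JetBundle π) := fun j => (vlift j).comp (contact j)

theorem mdifferentiableAt_coord (A : FibredChart π) {j : JetBundle π}
    (hj : j.toQ ∈ A.chart.source) :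
    MDifferentiableAt 𝓘(ℝ, ℝ × F × F) 𝓘(ℝ, ℝ × F × F) (coord A) j := by
  have h1 : ContMDiffOn 𝓘(ℝ, ℝ × F × F) 𝓘(ℝ, ℝ × F × F) ∞ (coord A) (toQ ⁻¹' A.chart.source) :=
    contMDiffOn_of_mem_maximalAtlas (jetChart_mem_maximalAtlas A j)
  exact (h1.contMDiffAt ((A.chart.open_source.preimage continuous_toQ).mem_nhds hj)).mdifferentiableAt
    (by simp)

/-- The differential of the natural coordinates on `J¹π`. -/
def dcoord (A : FibredChart π) (j : JetBundle π) :
    TangentSpace 𝓘(ℝ, ℝ × F × F) j →L[ℝ] ℝ × F × F :=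
  mfderiv 𝓘(ℝ, ℝ × F × F) 𝓘(ℝ, ℝ × F × F) (coord A) j

theorem dchart_dtoQ (A : FibredChart π) {j : JetBundle π} (hj : j.toQ ∈ A.chart.source)
    (w : TangentSpace 𝓘(ℝ, ℝ × F × F) j) :
    A.dchart j.toQ (dtoQ j w) = ((dcoord A j w).1, (dcoord A j w).2.1) := by
  have h1 := mfderiv_comp j (A.mdifferentiable.mdifferentiableAt hj)
    ((contMDiff_toQ (π := π)).mdifferentiableAt (x := j) (by simp))
  let l : ℝ × F × F →L[ℝ] ℝ × F := (ContinuousLinearMap.fst ℝ ℝ (F × F)).prod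
    ((ContinuousLinearMap.fst ℝ F F).comp (ContinuousLinearMap.snd ℝ ℝ (F × F)))
  have h2 := mfderiv_comp j (l.differentiableAt.mdifferentiableAt :
    MDifferentiableAt 𝓘(ℝ, ℝ × F × F) 𝓘(ℝ, ℝ × F) l (coord A j)) (mdifferentiableAt_coord A hj)
  have h3 : mfderiv 𝓘(ℝ, ℝ × F × F) 𝓘(ℝ, ℝ × F) l (coord A j) = l := by
    rw [mfderiv_eq_fderiv]
    exact l.fderiv
  rw [h3] at h2
  have h4 : (A.chart ∘ toQ : JetBundle π → ℝ × F) = l ∘ coord A := rfl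
  rw [← h4] at h2
  exact DFunLike.congr_fun (h1.symm.trans h2) w

theorem dcoord_vlift (A : FibredChart π) {j : JetBundle π} (hj : j.toQ ∈ A.chart.source)
    (ξ : vertSpace π j.toQ) :
    dcoord A j (vlift j ξ) = (0, 0, (A.dchart j.toQ (vertIncl j.toQ ξ)).2) := by
  let l : vertSpace π j.toQ →L[ℝ] ℝ × F × F := (0 : vertSpace π j.toQ →L[ℝ] ℝ).prod
    ((0 : vertSpace π j.toQ →L[ℝ] F).prod ((ContinuousLinearMap.snd ℝ ℝ F).comp
      ((A.dchart j.toQ).comp (vertIncl j.toQ))))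
  have hc : coord A ∘ translate j = fun ξ => coord A j + l ξ := by
    funext η
    have h1 : (A.dchart j.toQ (j.vel + vertIncl j.toQ η)).2
      = (A.dchart j.toQ j.vel).2 + (A.dchart j.toQ (vertIncl j.toQ η)).2 := by
      rw [map_add]; rfl
    exact Prod.ext (add_zero _).symm (Prod.ext (add_zero _).symm h1)
  have hp : ∀ η, (((coord A j + l η).1, (coord A j + l η).2.1) : ℝ × F) = A.chart j.toQ := by
    intro η
    exact Prod.ext (add_zero _) (add_zero _)
  have ht : translate j = ofCoord A j ∘ fun ξ => coord A j + l ξ := by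
    rw [← hc]
    funext η
    exact (ofCoord_coord A j (j := translate j η) hj).symm
  have hs : ContMDiffOn 𝓘(ℝ, ℝ × F × F) 𝓘(ℝ, ℝ × F × F) ∞ (ofCoord A j)
      {p | (p.1, p.2.1) ∈ A.chart.target} :=
    contMDiffOn_symm_of_mem_maximalAtlas (jetChart_mem_maximalAtlas A j)
  have hd : MDifferentiableAt 𝓘(ℝ, vertSpace π j.toQ) 𝓘(ℝ, ℝ × F × F) (translate j) 0 := by
    rw [ht]
    refine MDifferentiableAt.comp (0 : vertSpace π j.toQ)
      (g := ofCoord A j) (f := fun ξ => coord A j + l ξ) (I' := 𝓘(ℝ, ℝ × F × F)) ?_ ?_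
    · refine (hs.contMDiffAt ((jetChart A j).open_target.mem_nhds ?_)).mdifferentiableAt (by simp)
      change (((coord A j + l 0).1, (coord A j + l 0).2.1) : ℝ × F) ∈ A.chart.target
      rw [hp]
      exact A.chart.map_source hj
    · exact (l.differentiableAt.const_add _).mdifferentiableAt
  have h1 := mfderiv_comp (0 : vertSpace π j.toQ) (mdifferentiableAt_coord A (j := translate j 0) hj) hd
  rw [hc, mfderiv_eq_fderiv, fderiv_const_add] at h1
  have h2 : fderiv ℝ (fun η => l η) 0 = l := l.fderiv
  rw [h2] at h1
  have h3 := DFunLike.congr_fun h1 ξ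
  let g : JetBundle π → (ℝ × F × F →L[ℝ] ℝ × F × F) := fun k => dcoord A k
  have h4 : g (translate j 0) = g j := congrArg g (translate_zero j)
  have h5 := DFunLike.congr_fun h4 (vlift j ξ)
  exact h5.symm.trans h3.symm

/-- The vertical endomorphism in natural coordinates: it maps the tangent vector
`(t', q', q̇')` at a point with velocity `q̇` to `(0, 0, q' - t' q̇)`. -/
theorem dcoord_vertEnd (A : FibredChart π) {j : JetBundle π} (hj : j.toQ ∈ A.chart.source)
    (w : TangentSpace 𝓘(ℝ, ℝ × F × F) j) :
    dcoord A j (vertEnd π j w)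
      = (0, 0, (dcoord A j w).2.1 - (dcoord A j w).1 • (coord A j).2.2) := by
  refine (dcoord_vlift A hj (contact j w)).trans ?_
  have h1 : A.dchart j.toQ (dtoQ j w - dt π j w • j.vel)
      = A.dchart j.toQ (dtoQ j w) - dt π j w • A.dchart j.toQ j.vel := by
    rw [map_sub, map_smul]
  have h2 : dt π j w = (dcoord A j w).1 := by
    rw [← dproj_dtoQ, ← A.dchart_fst hj, dchart_dtoQ A hj]
  rw [dchart_dtoQ A hj, dchart_vel A hj] at h1
  have h3 := congrArg Prod.snd h1
  rw [← h2]
  exact Prod.ext rfl (Prod.ext rfl h3)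

/-- The Poincaré–Cartan `1`-form `θ_L = L dt + i_S dL`. -/
def poincareCartan (L : JetBundle π → ℝ) : OneForm (ℝ × F × F) (JetBundle π) := fun j =>
  L j • dt π j + (OneForm.ofFun L j).comp (vertEnd π j)

/-- The Lagrangian `2`-form `ω_L = -dθ_L`. -/
def lagrangianForm (L : JetBundle π → ℝ) : DiffForm (ℝ × F × F) (JetBundle π) 2 := fun j =>
  -((poincareCartan L).toForm.d j)

end JetBundle

end Jets
end LagReg
end

open LagReg LagReg.JetBundle

/-! The conclusion only involves first derivatives along J = J¹π, so it reduces to linear algebra at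
each point of J, carried out smoothly in the point, and to gluing maps whose differentials are
prescribed along a submanifold.

Linear algebra. At a point of J write X for the tangent space of J and E₁, E₂ for the ambient
tangent spaces. A linear map Φ : E₁ → E₂ is admissible if it is the identity on X, preserves τ and
S, and preserves the pairing of every vector with vectors of X. These conditions are affine in Φ, so
the admissible maps form a convex set, and coisotropy makes each of them injective. They exist: if C
is a complement of X + im S₁, then E₁ = X ⊕ C ⊕ S₁C, and it suffices to send each a in C to a vector
with the same τ and the same pairings with X (`isAdmissible_of_frame`); the Reeb vector common to
both sides makes these two requirements compatible. The construction depends smoothly on parameters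
(`exists_contDiffAt_isAdmissible`).

Preserving the whole two-form is a quadratic condition. Let N be defined by ω₁(Nu, v) = ω₂(Φu, Φv) -
ω₁(u, v) and τ₁(Nu) = 0. Then N kills X and takes values in X, so N² = 0, and Φ(1 - N/2) is again
admissible and carries ω₁ to ω₂ exactly (`IsAdmissible.corrected_spec`). The correction is
canonical, hence smooth and independent of charts.

Gluing. Suppose local maps M₁ → M₂ agree with the identity of J and their differentials along J lie
in convex sets of isomorphisms. In charts of M₂ each of them gives a displacement vector at y, for
pairs (x, y). A partition of unity on an open subset of M₁ × M₂ averages these vectors. The zero set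
of the average is, near J, the graph of a diffeomorphism whose differential along J is a convex
combination of the given ones (`exists_local_graph`, `exists_openPartialHomeomorph_of_local`). No
exponential map or tubular neighbourhood is needed.

The gluing is applied twice: to the convex sets of admissible maps, giving ψ, and then to the
singletons consisting of the corrected differentials of ψ. -/

noncomputable section

namespace LagReg

/-! ### Linear algebra of a regularization at a point -/

section LinearAlgebra

variable {X E E₁ E₂ : Type*} [NormedAddCommGroup X] [NormedSpace ℝ X]
  [NormedAddCommGroup E] [NormedSpace ℝ E]
  [NormedAddCommGroup E₁] [NormedSpace ℝ E₁] [NormedAddCommGroup E₂] [NormedSpace ℝ E₂]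

/-- The pointwise content of a coisotropic embedding `j : X → E` of `(X, ω₀, τ₀, S₀)` into the
cosymplectic vector space `(E, Ω, τ)` with compatible jet structure `S`, whose Reeb vector is
`j R`. -/
structure IsRegularizationAt (Ω : E →L[ℝ] E →L[ℝ] ℝ) (τ : E →L[ℝ] ℝ) (S : E →L[ℝ] E)
    (j : X →L[ℝ] E) (ω₀ : X → X → ℝ) (τ₀ : X → ℝ) (S₀ : X → X) (R : X) : Prop where
  skew : ∀ u v, Ω u v = -Ω v u
  nondegenerate : ∀ v, τ v = 0 → (∀ w, Ω v w = 0) → v = 0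
  lagrangian : ∀ u v, Ω (S u) v = -Ω u (S v)
  form_image : ∀ v, τ (S v) = 0
  sq_zero : ∀ v, S (S v) = 0
  ker_le : ∀ v, S v = 0 → τ v = 0 → ∃ u, S u = v
  reeb : ∀ w, Ω (j R) w = 0
  reeb_one : τ (j R) = 1
  injective : Function.Injective j
  map_tensor : ∀ u, S (j u) = j (S₀ u)
  pullback_two : ∀ u v, Ω (j u) (j v) = ω₀ u v
  pullback_one : ∀ u, τ (j u) = τ₀ u
  coisotropic : ∀ v, τ v = 0 → (∀ u, Ω v (j u) = 0) → ∃ u, j u = v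
  ker_le₀ : ∀ u, S₀ u = 0 → τ₀ u = 0 → ∃ v, S₀ v = u

/-- Linear maps between two regularizations that extend the identity of `X`, preserve `τ` and `S`,
and preserve the pairing of arbitrary vectors with vectors of `X`. -/
structure IsAdmissible (ω₁ : E₁ →L[ℝ] E₁ →L[ℝ] ℝ) (τ₁ : E₁ →L[ℝ] ℝ) (S₁ : E₁ →L[ℝ] E₁)
    (j₁ : X →L[ℝ] E₁) (ω₂ : E₂ →L[ℝ] E₂ →L[ℝ] ℝ) (τ₂ : E₂ →L[ℝ] ℝ) (S₂ : E₂ →L[ℝ] E₂)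
    (j₂ : X →L[ℝ] E₂) (Φ : E₁ →L[ℝ] E₂) : Prop where
  extends_id : ∀ u, Φ (j₁ u) = j₂ u
  map_one : ∀ v, τ₂ (Φ v) = τ₁ v
  map_tensor : ∀ v, S₂ (Φ v) = Φ (S₁ v)
  map_pairing : ∀ v u, ω₂ (Φ v) (j₂ u) = ω₁ v (j₁ u)

variable {Ω : E →L[ℝ] E →L[ℝ] ℝ} {τ : E →L[ℝ] ℝ} {S : E →L[ℝ] E} {j : X →L[ℝ] E}
  {ω₁ : E₁ →L[ℝ] E₁ →L[ℝ] ℝ} {τ₁ : E₁ →L[ℝ] ℝ} {S₁ : E₁ →L[ℝ] E₁} {j₁ : X →L[ℝ] E₁}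
  {ω₂ : E₂ →L[ℝ] E₂ →L[ℝ] ℝ} {τ₂ : E₂ →L[ℝ] ℝ} {S₂ : E₂ →L[ℝ] E₂} {j₂ : X →L[ℝ] E₂}
  {ω₀ : X → X → ℝ} {τ₀ : X → ℝ} {S₀ : X → X} {R : X}

/-- The isomorphism `v ↦ i_v Ω + τ(v) τ` attached to a cosymplectic structure. -/
def flat (Ω : E →L[ℝ] E →L[ℝ] ℝ) (τ : E →L[ℝ] ℝ) : E →L[ℝ] E →L[ℝ] ℝ := Ω + τ.smulRight τ

theorem flat_apply (v w : E) : flat Ω τ v w = Ω v w + τ v * τ w := by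
  simp [flat]

/-- Evaluation on the Reeb vector isolates τ(v), so the kernel lies in ker τ, where nondegeneracy
applies. Equality of dimensions does the rest. -/
theorem IsRegularizationAt.flat_isInvertible [FiniteDimensional ℝ E]
    (h : IsRegularizationAt Ω τ S j ω₀ τ₀ S₀ R) : (flat Ω τ).IsInvertible := by
  have hi : Function.Injective (flat Ω τ).toLinearMap := by
    rw [injective_iff_map_eq_zero]
    intro v hv
    have hv' : ∀ w, Ω v w + τ v * τ w = 0 := fun w => by
      rw [← flat_apply]; exact DFunLike.congr_fun hv w
    have h0 : τ v = 0 := by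
      have := hv' (j R)
      rw [h.skew, h.reeb, h.reeb_one] at this
      simpa using this
    exact h.nondegenerate v h0 fun w => by simpa [h0] using hv' w
  have hd : Module.finrank ℝ E = Module.finrank ℝ (E →L[ℝ] ℝ) := by
    rw [← LinearMap.toContinuousLinearMap.finrank_eq]
    exact (Subspace.dual_finrank_eq).symm
  refine ⟨(LinearEquiv.ofInjectiveOfFinrankEq _ hi hd).toContinuousLinearEquiv, ?_⟩
  ext v w
  rfl

/-- Transport of a regularization along linear isomorphisms. -/
theorem IsRegularizationAt.conj {X' E' : Type*} [NormedAddCommGroup X'] [NormedSpace ℝ X']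
    [NormedAddCommGroup E'] [NormedSpace ℝ E'] (h : IsRegularizationAt Ω τ S j ω₀ τ₀ S₀ R)
    {A : E →L[ℝ] E'} {A' : E' →L[ℝ] E} {B : X →L[ℝ] X'} {B' : X' →L[ℝ] X}
    (hA : ∀ v, A (A' v) = v) (hA' : ∀ v, A' (A v) = v)
    (hB : ∀ v, B (B' v) = v) (hB' : ∀ v, B' (B v) = v) {ω' : E' →L[ℝ] E' →L[ℝ] ℝ}
    (hω' : ∀ u v, ω' u v = Ω (A' u) (A' v)) :
    IsRegularizationAt ω' (τ.comp A') (A.comp (S.comp A')) (A.comp (j.comp B'))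
      (fun u v => ω₀ (B' u) (B' v)) (fun u => τ₀ (B' u)) (fun u => B (S₀ (B' u))) (B R) := by
  refine ⟨?_, ?_, ?_, ?_, ?_, ?_, ?_, ?_, ?_, ?_, ?_, ?_, ?_, ?_⟩
  · intro u v; rw [hω', hω', h.skew]
  · intro v h1 h2
    have := h.nondegenerate (A' v) h1 fun w => by
      have := h2 (A w)
      rwa [hω', hA'] at this
    rw [← hA v, this, map_zero]
  · intro u v; simp only [hω', ContinuousLinearMap.comp_apply, hA', h.lagrangian]
  · intro v; simp [hA', h.form_image]
  · intro v; simp [hA', h.sq_zero]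
  · intro v h1 h2
    obtain ⟨u, hu⟩ := h.ker_le (A' v) (by
      rw [← hA' (S (A' v))]
      exact (congrArg A' h1).trans (map_zero A')) h2
    exact ⟨A u, by simp [hA', hu, hA]⟩
  · intro w; simp [hω', hA', hB', h.reeb]
  · simp [hA', hB', h.reeb_one]
  · intro u v huv
    have := congrArg A' huv
    simp only [ContinuousLinearMap.comp_apply, hA'] at this
    rw [← hB u, h.injective this, hB]
  · intro u; simp [hA', h.map_tensor, hB']
  · intro u v; simp [hω', hA', h.pullback_two]
  · intro u; simp [hA', h.pullback_one]
  · intro v h1 h2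
    obtain ⟨u, hu⟩ := h.coisotropic (A' v) h1 fun u => by
      have := h2 (B u)
      simpa [hω', hA', hB'] using this
    exact ⟨B u, by simp [hB', hu, hA]⟩
  · intro u h1 h2
    obtain ⟨v, hv⟩ := h.ker_le₀ (B' u) (by
      rw [← hB' (S₀ (B' u)), h1, map_zero]) h2
    exact ⟨B v, by simp [hB', hv, hB]⟩

theorem IsRegularizationAt.tensor_reeb (h : IsRegularizationAt Ω τ S j ω₀ τ₀ S₀ R) :
    S (j R) = 0 :=
  h.nondegenerate _ (h.form_image _) fun w => by rw [h.lagrangian, h.reeb, neg_zero]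

/-- Subtracting τ(v) times the Reeb vector, which `S` kills, leaves a vector of ker S ∩ ker τ. -/
theorem IsRegularizationAt.ker_tensor (h : IsRegularizationAt Ω τ S j ω₀ τ₀ S₀ R) {v : E}
    (hv : S v = 0) : ∃ u, v = S u + j (τ v • R) := by
  obtain ⟨u, hu⟩ := h.ker_le (v - τ v • j R) (by simp [hv, h.tensor_reeb])
    (by simp [h.reeb_one])
  exact ⟨u, by rw [hu, map_smul]; abel⟩

/-- The map `(u, a, b) ↦ j u + a + S b`. -/
def frame (S : E →L[ℝ] E) (j : X →L[ℝ] E) (C : Submodule ℝ E) : X × C × C →L[ℝ] E :=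
  j.coprod (C.subtypeL.coprod (S.comp C.subtypeL))

theorem frame_apply (S : E →L[ℝ] E) (j : X →L[ℝ] E) (C : Submodule ℝ E) (p : X × C × C) :
    frame S j C p = j p.1 + (p.2.1 + S p.2.2) := by
  simp [frame]

/-- The decomposition E = X ⊕ C ⊕ SC. It rests on the exactness property ker S ∩ ker τ = im S, used
both on E and on X. -/
theorem IsRegularizationAt.frame_bijective (h : IsRegularizationAt Ω τ S j ω₀ τ₀ S₀ R)
    {C : Submodule ℝ E}
    (hC : IsCompl (LinearMap.range j.toLinearMap ⊔ LinearMap.range S.toLinearMap) C) :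
    Function.Bijective (frame S j C) := by
  have hdis : ∀ u v, ∀ a ∈ C, j u + S v + a = 0 → a = 0 := by
    intro u v a ha h0
    refine Submodule.disjoint_def.1 hC.disjoint a ?_ ha
    rw [← neg_neg a, ← eq_neg_of_add_eq_zero_left h0]
    exact neg_mem (add_mem (Submodule.mem_sup_left ⟨u, rfl⟩) (Submodule.mem_sup_right ⟨v, rfl⟩))
  constructor
  · rw [injective_iff_map_eq_zero]
    rintro ⟨u, a, b⟩ h0
    rw [frame_apply] at h0
    have ha : (a : E) = 0 := hdis u b a a.2 (by rw [← h0]; dsimp only; abel)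
    simp only [ha, zero_add] at h0
    have hτ : τ₀ u = 0 := by
      have := congrArg τ h0
      simpa [h.form_image, h.pullback_one] using this
    have hS : S₀ u = 0 := by
      apply h.injective
      have := congrArg S h0
      simpa [h.sq_zero, h.map_tensor] using this
    obtain ⟨u', hu'⟩ := h.ker_le₀ u hS hτ
    -- Once a = 0, the relation j u + S b = 0 forces u = S₀ u', so j u' + b lies in ker S = im S +
    -- ℝ·R. This puts b in C ∩ (X + im S).
    have h1 : S (j u' + b) = 0 := by rw [map_add, h.map_tensor, hu', h0]
    obtain ⟨v, hv⟩ := h.ker_tensor h1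
    have hb : (b : E) = 0 := by
      refine hdis (u' - τ (j u' + b) • R) (-v) b b.2 ?_
      rw [map_sub, map_neg, ← sub_eq_zero.2 hv]
      abel
    rw [hb, map_zero, add_zero] at h0
    have hu : u = 0 := h.injective (by rw [h0, map_zero])
    exact Prod.ext hu (Prod.ext (Subtype.ext ha) (Subtype.ext hb))
  · have hspan : ∀ v, ∃ u v', ∃ a : C, v = j u + S v' + a := by
      intro v
      have hv : v ∈ (LinearMap.range j.toLinearMap ⊔ LinearMap.range S.toLinearMap) ⊔ C := by
        rw [hC.sup_eq_top]; trivial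
      obtain ⟨y, hy, a, ha, rfl⟩ := Submodule.mem_sup.1 hv
      obtain ⟨_, ⟨u, rfl⟩, _, ⟨v', rfl⟩, rfl⟩ := Submodule.mem_sup.1 hy
      exact ⟨u, v', ⟨a, ha⟩, rfl⟩
    intro v
    -- Decomposing v, and then the argument of `S`, is enough: the leftover S(S v'') vanishes.
    obtain ⟨u, v', a, hv⟩ := hspan v
    obtain ⟨u', v'', b, hv'⟩ := hspan v'
    refine ⟨(u + S₀ u', a, b), ?_⟩
    rw [frame_apply, hv, hv']
    simp only [map_add, h.map_tensor, h.sq_zero]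
    abel

/-- The values of an admissible map on a complement of `X` generate all of it. -/
theorem isAdmissible_of_frame (h₁ : IsRegularizationAt ω₁ τ₁ S₁ j₁ ω₀ τ₀ S₀ R)
    (h₂ : IsRegularizationAt ω₂ τ₂ S₂ j₂ ω₀ τ₀ S₀ R) {C : Submodule ℝ E₁}
    (hsurj : Function.Surjective (frame S₁ j₁ C)) {D : C → E₂}
    (hD : ∀ (a : C) u, ω₂ (D a) (j₂ u) = ω₁ a (j₁ u)) (hDτ : ∀ a : C, τ₂ (D a) = τ₁ a)
    {Φ : E₁ →L[ℝ] E₂}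
    (hΦ : ∀ p : X × C × C, Φ (frame S₁ j₁ C p) = j₂ p.1 + (D p.2.1 + S₂ (D p.2.2)))
    (hD0 : D 0 = 0) :
    IsAdmissible ω₁ τ₁ S₁ j₁ ω₂ τ₂ S₂ j₂ Φ := by
  refine ⟨?_, ?_, ?_, ?_⟩
  · intro u
    simpa [frame_apply, hD0] using hΦ (u, 0, 0)
  · intro v
    obtain ⟨p, rfl⟩ := hsurj v
    rw [hΦ, frame_apply]
    simp [h₁.form_image, h₂.form_image, h₁.pullback_one, h₂.pullback_one, hDτ]
  · intro v
    obtain ⟨p, rfl⟩ := hsurj v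
    -- In frame coordinates the tensor acts as the shift (u, a, b) ↦ (S₀ u, 0, a), whatever the
    -- regularization.
    have h1 : S₁ (frame S₁ j₁ C p) = frame S₁ j₁ C (S₀ p.1, 0, p.2.1) := by
      simp [frame_apply, h₁.map_tensor, h₁.sq_zero]
    rw [h1, hΦ, hΦ]
    simp [h₂.map_tensor, h₂.sq_zero, hD0]
  · intro v u
    obtain ⟨p, rfl⟩ := hsurj v
    rw [hΦ, frame_apply]
    -- Pairings of S b with X need no separate hypothesis: ω(S b, j u) = -ω(b, j(S₀ u)) reduces them
    -- to pairings of b.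
    simp only [map_add, add_apply, h₁.pullback_two, h₂.pullback_two, hD,
      h₁.lagrangian, h₂.lagrangian, h₁.map_tensor, h₂.map_tensor]

/-- Every condition is affine in Φ because only pairings with the fixed subspace X are prescribed.
Preservation of the full two-form would be quadratic and would destroy convexity. -/
theorem convex_setOf_isAdmissible :
    Convex ℝ {Φ : E₁ →L[ℝ] E₂ | IsAdmissible ω₁ τ₁ S₁ j₁ ω₂ τ₂ S₂ j₂ Φ} := by
  intro Φ h Ψ h' a b _ _ hab
  refine ⟨?_, ?_, ?_, ?_⟩
  · intro u
    simp [h.extends_id, h'.extends_id, ← add_smul, hab]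
  · intro v
    simp [h.map_one, h'.map_one, ← add_mul, hab]
  · intro v
    simp [h.map_tensor, h'.map_tensor]
  · intro v u
    simp [h.map_pairing, h'.map_pairing, ← add_mul, hab]

/-- The failure of `Φ` to preserve the two-forms, as an endomorphism. -/
def defect (ω₁ : E₁ →L[ℝ] E₁ →L[ℝ] ℝ) (τ₁ : E₁ →L[ℝ] ℝ) (ω₂ : E₂ →L[ℝ] E₂ →L[ℝ] ℝ)
    (Φ : E₁ →L[ℝ] E₂) : E₁ →L[ℝ] E₁ :=
  (flat ω₁ τ₁).inverse.comp (ω₂.bilinearComp Φ Φ - ω₁)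

/-- The correction of `Φ` to first order in its defect. -/
def corrected (ω₁ : E₁ →L[ℝ] E₁ →L[ℝ] ℝ) (τ₁ : E₁ →L[ℝ] ℝ) (ω₂ : E₂ →L[ℝ] E₂ →L[ℝ] ℝ)
    (Φ : E₁ →L[ℝ] E₂) : E₁ →L[ℝ] E₂ :=
  Φ - (2⁻¹ : ℝ) • Φ.comp (defect ω₁ τ₁ ω₂ Φ)

theorem corrected_apply (Φ : E₁ →L[ℝ] E₂) (v : E₁) : corrected ω₁ τ₁ ω₂ Φ v
    = Φ (v - (2⁻¹ : ℝ) • defect ω₁ τ₁ ω₂ Φ v) := by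
  simp [corrected]

/-- The τ-term of `flat` drops out, since both two-forms vanish on the Reeb vector and Φ respects
it. The two conclusions determine the defect. -/
theorem IsAdmissible.defect_spec [FiniteDimensional ℝ E₁] {Φ : E₁ →L[ℝ] E₂}
    (h₁ : IsRegularizationAt ω₁ τ₁ S₁ j₁ ω₀ τ₀ S₀ R)
    (h₂ : IsRegularizationAt ω₂ τ₂ S₂ j₂ ω₀ τ₀ S₀ R)
    (h : IsAdmissible ω₁ τ₁ S₁ j₁ ω₂ τ₂ S₂ j₂ Φ) (u : E₁) :
    τ₁ (defect ω₁ τ₁ ω₂ Φ u) = 0 ∧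
      ∀ v, ω₁ (defect ω₁ τ₁ ω₂ Φ u) v = ω₂ (Φ u) (Φ v) - ω₁ u v := by
  have h0 : ∀ v, ω₁ (defect ω₁ τ₁ ω₂ Φ u) v + τ₁ (defect ω₁ τ₁ ω₂ Φ u) * τ₁ v
      = ω₂ (Φ u) (Φ v) - ω₁ u v := by
    intro v
    rw [← flat_apply]
    obtain ⟨e, he⟩ := h₁.flat_isInvertible
    simp [defect, ← he, ContinuousLinearMap.inverse_equiv]
  have h1 : τ₁ (defect ω₁ τ₁ ω₂ Φ u) = 0 := by
    have := h0 (j₁ R)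
    rw [h.extends_id, h₁.skew, h₂.skew, h₁.skew u, h₁.reeb, h₁.reeb, h₂.reeb, h₁.reeb_one] at this
    simpa using this
  exact ⟨h1, fun v => by simpa [h1] using h0 v⟩

theorem IsRegularizationAt.ext_of_pairing (h : IsRegularizationAt Ω τ S j ω₀ τ₀ S₀ R) {u v : E}
    (h1 : τ u = τ v) (h2 : ∀ w, Ω u w = Ω v w) : u = v :=
  sub_eq_zero.1 (h.nondegenerate _ (by simp [h1]) fun w => by simp [h2])

/-- An admissible map becomes an isomorphism of all the structures after correction. -/
theorem IsAdmissible.corrected_spec [FiniteDimensional ℝ E₁] {Φ : E₁ →L[ℝ] E₂}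
    (h₁ : IsRegularizationAt ω₁ τ₁ S₁ j₁ ω₀ τ₀ S₀ R)
    (h₂ : IsRegularizationAt ω₂ τ₂ S₂ j₂ ω₀ τ₀ S₀ R)
    (h : IsAdmissible ω₁ τ₁ S₁ j₁ ω₂ τ₂ S₂ j₂ Φ) :
    (∀ u v, ω₂ (corrected ω₁ τ₁ ω₂ Φ u) (corrected ω₁ τ₁ ω₂ Φ v) = ω₁ u v) ∧
    IsAdmissible ω₁ τ₁ S₁ j₁ ω₂ τ₂ S₂ j₂ (corrected ω₁ τ₁ ω₂ Φ) := by
  set N := defect ω₁ τ₁ ω₂ Φ with hN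
  have hτ : ∀ u, τ₁ (N u) = 0 := fun u => (h.defect_spec h₁ h₂ u).1
  have hω : ∀ u v, ω₁ (N u) v = ω₂ (Φ u) (Φ v) - ω₁ u v := fun u => (h.defect_spec h₁ h₂ u).2
  -- N is symmetric with respect to ω₁, being the quotient of two skew forms.
  have hω' : ∀ u v, ω₁ u (N v) = ω₂ (Φ u) (Φ v) - ω₁ u v := fun u v => by
    rw [h₁.skew, hω, h₂.skew, h₁.skew v]; ring
  -- N kills X because Φ preserves all pairings with X. By the same pairings and coisotropy its
  -- image lies in X, whence N² = 0.
  have hj : ∀ u, N (j₁ u) = 0 := fun u => h₁.nondegenerate _ (hτ _) fun w => by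
    rw [hω, h.extends_id, h₂.skew, h.map_pairing, h₁.skew w]; ring
  have hNj : ∀ u, ∃ w, j₁ w = N u := fun u => h₁.coisotropic _ (hτ _) fun w => by
    rw [hω, h.extends_id, h.map_pairing, sub_self]
  have hNN : ∀ u, N (N u) = 0 := fun u => by
    obtain ⟨w, hw⟩ := hNj u
    rw [← hw, hj]
  -- Both ω₁ and the pullback of ω₂ are compatible with S₁, so N commutes with S₁.
  have hS : ∀ u, N (S₁ u) = S₁ (N u) := fun u =>
    h₁.ext_of_pairing (by rw [hτ, h₁.form_image]) fun w => by
      rw [hω, h₁.lagrangian, h₁.lagrangian, hω, ← h.map_tensor, h₂.lagrangian, h.map_tensor]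
      ring
  have hc : ∀ u, corrected ω₁ τ₁ ω₂ Φ u = Φ (u - (2⁻¹ : ℝ) • N u) := corrected_apply Φ
  -- The pullback of ω₂ is ω₁((1 + N)·, ·). As N is symmetric with square zero, 1 - N/2 is an exact
  -- inverse square root of 1 + N; this is the origin of the factor 1/2.
  have key : ∀ u v, ω₂ (corrected ω₁ τ₁ ω₂ Φ u) (corrected ω₁ τ₁ ω₂ Φ v) = ω₁ u v := by
    intro u v
    have h0 : ∀ u v, ω₂ (Φ u) (Φ v) = ω₁ (N u) v + ω₁ u v := fun u v => by rw [hω]; ring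
    have h3 : ω₁ (N u) (N v) = 0 := by
      have := hω (N u) v
      rw [hω', h0, hNN, map_zero]; simp
    rw [hc, hc, h0]
    simp only [map_sub, map_smul, hNN, smul_zero, sub_zero, sub_apply,
      smul_apply, smul_eq_mul, h3]
    rw [hω, hω']
    ring
  refine ⟨key, ?_, ?_, ?_, ?_⟩
  · intro u; rw [hc, hj, smul_zero, sub_zero, h.extends_id]
  · intro u; rw [hc, h.map_one]; simp [hτ]
  · intro u; rw [hc, hc, h.map_tensor, hS]; simp
  · intro v u
    have h4 : corrected ω₁ τ₁ ω₂ Φ (j₁ u) = j₂ u := by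
      rw [hc, hj, smul_zero, sub_zero, h.extends_id]
    rw [← h4, key]

/-- Admissible maps are injective. -/
theorem IsAdmissible.injective {Φ : E₁ →L[ℝ] E₂}
    (h₁ : IsRegularizationAt ω₁ τ₁ S₁ j₁ ω₀ τ₀ S₀ R)
    (h₂ : IsRegularizationAt ω₂ τ₂ S₂ j₂ ω₀ τ₀ S₀ R)
    (h : IsAdmissible ω₁ τ₁ S₁ j₁ ω₂ τ₂ S₂ j₂ Φ) : Function.Injective Φ := by
  rw [injective_iff_map_eq_zero]
  intro v hv
  -- A kernel vector has τ = 0 and pairs trivially with X, so it lies in X, where Φ is the identity.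
  obtain ⟨u, rfl⟩ := h₁.coisotropic v (by rw [← h.map_one, hv, map_zero]) fun u => by
    rw [← h.map_pairing, hv]; simp
  rw [h.extends_id] at hv
  rw [h₂.injective (hv.trans (map_zero j₂).symm), map_zero]

end LinearAlgebra

/-! ### Smooth families of regularizations and local extensions -/

section Calculus

variable {P X E F G : Type*} [NormedAddCommGroup P] [NormedSpace ℝ P]
  [NormedAddCommGroup X] [NormedSpace ℝ X]
  [NormedAddCommGroup E] [NormedSpace ℝ E] [NormedAddCommGroup F] [NormedSpace ℝ F]
  [NormedAddCommGroup G] [NormedSpace ℝ G]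

theorem contDiffAt_clm_coprod {f : P → E →L[ℝ] G} {g : P → F →L[ℝ] G} {x : P}
    (hf : ContDiffAt ℝ ∞ f x) (hg : ContDiffAt ℝ ∞ g x) :
    ContDiffAt ℝ ∞ (fun y => (f y).coprod (g y)) x := by
  have h : (fun y => (f y).coprod (g y)) = fun y =>
      (f y).comp (ContinuousLinearMap.fst ℝ E F) + (g y).comp (ContinuousLinearMap.snd ℝ E F) := by
    funext y
    ext <;> simp
  rw [h]
  exact (hf.clm_comp contDiffAt_const).add (hg.clm_comp contDiffAt_const)

theorem contDiffAt_clm_bilinearComp {b : P → F →L[ℝ] G →L[ℝ] ℝ} {f : P → X →L[ℝ] F}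
    {g : P → E →L[ℝ] G} {x : P} (hb : ContDiffAt ℝ ∞ b x) (hf : ContDiffAt ℝ ∞ f x)
    (hg : ContDiffAt ℝ ∞ g x) : ContDiffAt ℝ ∞ (fun y => (b y).bilinearComp (f y) (g y)) x := by
  have h : (fun y => (b y).bilinearComp (f y) (g y)) = fun y =>
      ((ContinuousLinearMap.compL ℝ E G ℝ).flip (g y)).comp ((b y).comp (f y)) := by
    funext y
    ext u v
    simp
  rw [h]
  exact (contDiffAt_const.clm_apply hg).clm_comp (hb.clm_comp hf)

theorem contDiffAt_clm_inverse [CompleteSpace E] {f : P → E →L[ℝ] F} {x : P}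
    (hf : ContDiffAt ℝ ∞ f x) (hx : (f x).IsInvertible) :
    ContDiffAt ℝ ∞ (fun y => (f y).inverse) x :=
  (hx.contDiffAt_map_inverse (n := ∞)).comp x hf

theorem eventually_isInvertible {P : Type*} [TopologicalSpace P] [CompleteSpace E] {f : P → E →L[ℝ] F} {x : P}
    (hf : ContinuousAt f x) (hx : (f x).IsInvertible) : ∀ᶠ y in 𝓝 x, (f y).IsInvertible := by
  obtain ⟨e, he⟩ := hx
  have := ContinuousLinearEquiv.nhds e
  rw [he] at this
  exact hf this

theorem isInvertible_of_bijective [CompleteSpace E] [CompleteSpace F] {f : E →L[ℝ] F}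
    (hf : Function.Bijective f) : f.IsInvertible :=
  ⟨ContinuousLinearEquiv.ofBijective f (LinearMap.ker_eq_bot.2 hf.1) (LinearMap.range_eq_top.2 hf.2),
    rfl⟩

theorem contDiffAt_flat {Ω : P → E →L[ℝ] E →L[ℝ] ℝ} {τ : P → E →L[ℝ] ℝ} {x : P}
    (hΩ : ContDiffAt ℝ ∞ Ω x) (hτ : ContDiffAt ℝ ∞ τ x) :
    ContDiffAt ℝ ∞ (fun y => flat (Ω y) (τ y)) x :=
  hΩ.add (hτ.smulRight hτ)

variable {E₁ E₂ : Type*}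
  [NormedAddCommGroup E₁] [NormedSpace ℝ E₁] [FiniteDimensional ℝ E₁]
  [NormedAddCommGroup E₂] [NormedSpace ℝ E₂]
  {Ω₁ : P → E₁ →L[ℝ] E₁ →L[ℝ] ℝ} {τ₁ : P → E₁ →L[ℝ] ℝ} {S₁ : P → E₁ →L[ℝ] E₁}
  {j₁ : P → X →L[ℝ] E₁}
  {Ω₂ : P → E₂ →L[ℝ] E₂ →L[ℝ] ℝ} {τ₂ : P → E₂ →L[ℝ] ℝ} {S₂ : P → E₂ →L[ℝ] E₂}
  {j₂ : P → X →L[ℝ] E₂}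
  {Ω₀ : P → X → X → ℝ} {τ₀ : P → X → ℝ} {S₀ : P → X → X} {R : P → X} {x₀ : P}

theorem contDiffAt_corrected {Φ : P → E₁ →L[ℝ] E₂} (hΩ₁ : ContDiffAt ℝ ∞ Ω₁ x₀)
    (hτ₁ : ContDiffAt ℝ ∞ τ₁ x₀) (hΩ₂ : ContDiffAt ℝ ∞ Ω₂ x₀) (hΦ : ContDiffAt ℝ ∞ Φ x₀)
    (h : IsRegularizationAt (Ω₁ x₀) (τ₁ x₀) (S₁ x₀) (j₁ x₀) (Ω₀ x₀) (τ₀ x₀) (S₀ x₀) (R x₀)) :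
    ContDiffAt ℝ ∞ (fun x => corrected (Ω₁ x) (τ₁ x) (Ω₂ x) (Φ x)) x₀ := by
  have : CompleteSpace E₁ := FiniteDimensional.complete ℝ E₁
  refine hΦ.sub (ContDiffAt.const_smul _ (hΦ.clm_comp ?_))
  exact (contDiffAt_clm_inverse (contDiffAt_flat hΩ₁ hτ₁) h.flat_isInvertible).clm_comp
    ((contDiffAt_clm_bilinearComp hΩ₂ hΦ hΦ).sub hΩ₁)

/-- Smooth families of regularizations of the same object are related by a smooth family of
admissible maps. -/
theorem exists_contDiffAt_isAdmissible [FiniteDimensional ℝ X] [FiniteDimensional ℝ E₂]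
    (hΩ₁ : ∀ᶠ x in 𝓝 x₀, ContDiffAt ℝ ∞ Ω₁ x) (hτ₁ : ∀ᶠ x in 𝓝 x₀, ContDiffAt ℝ ∞ τ₁ x)
    (hS₁ : ∀ᶠ x in 𝓝 x₀, ContDiffAt ℝ ∞ S₁ x) (hj₁ : ∀ᶠ x in 𝓝 x₀, ContDiffAt ℝ ∞ j₁ x)
    (hΩ₂ : ∀ᶠ x in 𝓝 x₀, ContDiffAt ℝ ∞ Ω₂ x) (hτ₂ : ∀ᶠ x in 𝓝 x₀, ContDiffAt ℝ ∞ τ₂ x)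
    (hS₂ : ∀ᶠ x in 𝓝 x₀, ContDiffAt ℝ ∞ S₂ x) (hj₂ : ∀ᶠ x in 𝓝 x₀, ContDiffAt ℝ ∞ j₂ x)
    (h₁ : ∀ᶠ x in 𝓝 x₀,
      IsRegularizationAt (Ω₁ x) (τ₁ x) (S₁ x) (j₁ x) (Ω₀ x) (τ₀ x) (S₀ x) (R x))
    (h₂ : ∀ᶠ x in 𝓝 x₀,
      IsRegularizationAt (Ω₂ x) (τ₂ x) (S₂ x) (j₂ x) (Ω₀ x) (τ₀ x) (S₀ x) (R x)) :
    ∃ Φ : P → E₁ →L[ℝ] E₂, ∀ᶠ x in 𝓝 x₀, ContDiffAt ℝ ∞ Φ x ∧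
      IsAdmissible (Ω₁ x) (τ₁ x) (S₁ x) (j₁ x) (Ω₂ x) (τ₂ x) (S₂ x) (j₂ x) (Φ x) := by
  have : CompleteSpace X := FiniteDimensional.complete ℝ X
  have : CompleteSpace E₁ := FiniteDimensional.complete ℝ E₁
  have : CompleteSpace E₂ := FiniteDimensional.complete ℝ E₂
  -- The complement is fixed at x₀. It still yields a frame at nearby points because invertibility
  -- is an open condition.
  obtain ⟨C, hC⟩ := Submodule.exists_isCompl
    (LinearMap.range (j₁ x₀).toLinearMap ⊔ LinearMap.range (S₁ x₀).toLinearMap)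
  have : CompleteSpace C := FiniteDimensional.complete ℝ C
  obtain ⟨p₀, hp₀⟩ := (j₂ x₀).toLinearMap.exists_leftInverse_of_injective
    (LinearMap.ker_eq_bot.2 h₂.self_of_nhds.injective)
  let p : E₂ →L[ℝ] X := LinearMap.toContinuousLinearMap p₀
  have hp : ((p.comp (j₂ x₀))).IsInvertible := by
    refine ⟨ContinuousLinearEquiv.refl ℝ X, ?_⟩
    ext u
    exact (DFunLike.congr_fun hp₀ u).symm
  have hpc : ∀ x, ContDiffAt ℝ ∞ j₂ x → ContDiffAt ℝ ∞ (fun x => p.comp (j₂ x)) x :=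
    fun x hx => contDiffAt_const.clm_comp hx
  -- Normalizing a fixed left inverse of j₂(x₀) gives a left inverse of j₂(x) that varies smoothly
  -- with x near x₀.
  let q : P → E₂ →L[ℝ] X := fun x => (p.comp (j₂ x)).inverse.comp p
  let T : P → X × C × C →L[ℝ] E₁ := fun x => frame (S₁ x) (j₁ x) C
  have hT : ∀ x, ContDiffAt ℝ ∞ j₁ x → ContDiffAt ℝ ∞ S₁ x → ContDiffAt ℝ ∞ T x :=
    fun x hj hS => contDiffAt_clm_coprod hj
      (contDiffAt_clm_coprod contDiffAt_const (hS.clm_comp contDiffAt_const))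
  have hTi : (T x₀).IsInvertible :=
    isInvertible_of_bijective (h₁.self_of_nhds.frame_bijective hC)
  -- D(a) solves Ω₂(D a, w) + τ₂(D a) τ₂(w) = Ω₁(a, j₁ q w) + τ₁(a) τ₂(w). Taking w in X prescribes
  -- the pairings; taking w to be the Reeb vector gives τ₂(D a) = τ₁(a).
  let D : P → C →L[ℝ] E₂ := fun x => (flat (Ω₂ x) (τ₂ x)).inverse.comp
    (((Ω₁ x).bilinearComp (ContinuousLinearMap.id ℝ E₁) ((j₁ x).comp (q x))
      + (τ₁ x).smulRight (τ₂ x)).comp C.subtypeL)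
  let T' : P → X × C × C →L[ℝ] E₂ := fun x =>
    (j₂ x).coprod ((D x).coprod ((S₂ x).comp (D x)))
  refine ⟨fun x => (T' x).comp (T x).inverse, ?_⟩
  filter_upwards [h₁, h₂,
    eventually_isInvertible (hT x₀ hj₁.self_of_nhds hS₁.self_of_nhds).continuousAt hTi,
    eventually_isInvertible (hpc x₀ hj₂.self_of_nhds).continuousAt hp,
    hΩ₁, hτ₁, hS₁, hj₁, hΩ₂, hτ₂, hS₂, hj₂]
    with x h₁ h₂ hTx hpx hΩ₁ hτ₁ hS₁ hj₁ hΩ₂ hτ₂ hS₂ hj₂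
  constructor
  · have hq : ContDiffAt ℝ ∞ q x :=
      (contDiffAt_clm_inverse (hpc x hj₂) hpx).clm_comp contDiffAt_const
    have hD : ContDiffAt ℝ ∞ D x :=
      (contDiffAt_clm_inverse (contDiffAt_flat hΩ₂ hτ₂) h₂.flat_isInvertible).clm_comp
        (((contDiffAt_clm_bilinearComp hΩ₁ contDiffAt_const (hj₁.clm_comp hq)).add
          (hτ₁.smulRight hτ₂)).clm_comp contDiffAt_const)
    exact (contDiffAt_clm_coprod hj₂ (contDiffAt_clm_coprod hD (hS₂.clm_comp hD))).clm_comp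
      (contDiffAt_clm_inverse (hT x hj₁ hS₁) hTx)
  have hqj : ∀ u, q x (j₂ x u) = u := by
    intro u
    obtain ⟨e, he⟩ := hpx
    have : p (j₂ x u) = e u := (DFunLike.congr_fun he u).symm
    simp only [q, ← he, ContinuousLinearMap.inverse_equiv, ContinuousLinearMap.comp_apply, this]
    simp
  have hDx : ∀ (a : C) w, Ω₂ x (D x a) w + τ₂ x (D x a) * τ₂ x w
      = Ω₁ x a (j₁ x (q x w)) + τ₁ x a * τ₂ x w := by
    intro a w
    rw [← flat_apply]
    obtain ⟨e, he⟩ := h₂.flat_isInvertible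
    simp [D, ← he, ContinuousLinearMap.inverse_equiv]
  have hDτ : ∀ a : C, τ₂ x (D x a) = τ₁ x a := by
    intro a
    have := hDx a (j₂ x (R x))
    rw [hqj, h₁.skew, h₂.skew, h₁.reeb, h₂.reeb, h₂.reeb_one] at this
    simpa using this
  refine isAdmissible_of_frame h₁ h₂ (C := C) (D := D x) ?_ ?_ hDτ ?_ (map_zero _)
  · obtain ⟨e, he⟩ := hTx
    change Function.Surjective (T x)
    rw [← he]
    exact e.surjective
  · intro a u
    have := hDx a (j₂ x u)
    rw [hDτ, hqj] at this
    linarith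
  · intro y
    obtain ⟨e, he⟩ := hTx
    change T' x ((T x).inverse (T x y)) = _
    rw [← he, ContinuousLinearMap.inverse_equiv]
    simp [T']

/-- The inverse function theorem for a map that is smooth near a point. -/
theorem exists_openPartialHomeomorph_of_isInvertible [CompleteSpace E] {f : E → F} {a : E}
    (hf : ∀ᶠ x in 𝓝 a, ContDiffAt ℝ ∞ f x) (hi : (fderiv ℝ f a).IsInvertible) :
    ∃ e : OpenPartialHomeomorph E F, a ∈ e.source ∧ (∀ x, e x = f x) ∧
      ContDiffOn ℝ ∞ e e.source ∧ ContDiffOn ℝ ∞ e.symm e.target := by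
  have hn : (∞ : ℕ∞ω) ≠ 0 := by simp
  have hfa := hf.self_of_nhds
  obtain ⟨L, hL⟩ := hi
  have hd : HasFDerivAt f (L : E →L[ℝ] F) a := by
    rw [hL]; exact (hfa.differentiableAt hn).hasFDerivAt
  have h2 := eventually_isInvertible (hfa.fderiv_right (m := ∞) (by simp)).continuousAt ⟨L, hL⟩
  -- Restriction to points where f is smooth with invertible derivative makes the inverse smooth on
  -- the entire target, not only at f(a).
  obtain ⟨U, hU, hUo, haU⟩ := eventually_nhds_iff.1 (hf.and h2)
  let e₀ := hfa.toOpenPartialHomeomorph f hd hn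
  let e := e₀.restrOpen U hUo
  have hs : ∀ x ∈ e.source, x ∈ U := fun x hx => hx.2
  refine ⟨e, ⟨hfa.mem_toOpenPartialHomeomorph_source hd hn, haU⟩, fun x => rfl,
    fun x hx => (hU x (hs x hx)).1.contDiffWithinAt, ?_⟩
  intro y hy
  have hx := hs _ (e.map_target hy)
  obtain ⟨L', hL'⟩ := (hU _ hx).2
  refine (e.contDiffAt_symm hy (f₀' := L') ?_ (hU _ hx).1).contDiffWithinAt
  rw [hL']
  exact ((hU _ hx).1.differentiableAt hn).hasFDerivAt

/-- A map with prescribed values and differentials along an immersed submanifold. -/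
theorem exists_contDiffAt_hasFDerivAt_along [FiniteDimensional ℝ X] {f₁ : X → E₁} {f₂ : X → E₂}
    {Φ : X → E₁ →L[ℝ] E₂} {x₀ : X} (hf₁ : ∀ᶠ x in 𝓝 x₀, ContDiffAt ℝ ∞ f₁ x)
    (hf₂ : ∀ᶠ x in 𝓝 x₀, ContDiffAt ℝ ∞ f₂ x) (hΦ : ∀ᶠ x in 𝓝 x₀, ContDiffAt ℝ ∞ Φ x)
    (hinj : Function.Injective (fderiv ℝ f₁ x₀))
    (hcomp : ∀ᶠ x in 𝓝 x₀, (Φ x).comp (fderiv ℝ f₁ x) = fderiv ℝ f₂ x) :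
    ∃ g : E₁ → E₂, (∀ᶠ y in 𝓝 (f₁ x₀), ContDiffAt ℝ ∞ g y) ∧
      ∀ᶠ x in 𝓝 x₀, g (f₁ x) = f₂ x ∧ HasFDerivAt g (Φ x) (f₁ x) := by
  have : CompleteSpace X := FiniteDimensional.complete ℝ X
  have : CompleteSpace E₁ := FiniteDimensional.complete ℝ E₁
  obtain ⟨C, hC⟩ := Submodule.exists_isCompl (LinearMap.range (fderiv ℝ f₁ x₀).toLinearMap)
  have : CompleteSpace C := FiniteDimensional.complete ℝ C
  -- G gives coordinates around the image of f₁, and H is the wanted map in these coordinates,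
  -- affine in the transverse variable. The extension is H ∘ G⁻¹.
  let G : X × C → E₁ := fun p => f₁ p.1 + p.2
  let H : X × C → E₂ := fun p => f₂ p.1 + Φ p.1 p.2
  let T : X → X × C →L[ℝ] E₁ := fun x => (fderiv ℝ f₁ x).coprod C.subtypeL
  have hT : ContDiffAt ℝ ∞ T x₀ :=
    contDiffAt_clm_coprod (hf₁.self_of_nhds.fderiv_right (m := ∞) (by simp)) contDiffAt_const
  have hTi : (T x₀).IsInvertible := by
    apply isInvertible_of_bijective
    constructor
    · rw [injective_iff_map_eq_zero]
      rintro ⟨u, a⟩ h0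
      have h1 : fderiv ℝ f₁ x₀ u + a = 0 := by simpa [T] using h0
      have h2 : (a : E₁) = 0 := by
        refine Submodule.disjoint_def.1 hC.disjoint a ?_ a.2
        rw [← neg_neg (a : E₁), ← eq_neg_of_add_eq_zero_left h1]
        exact neg_mem ⟨u, rfl⟩
      rw [h2, add_zero] at h1
      exact Prod.ext (hinj (h1.trans (map_zero _).symm)) (Subtype.ext h2)
    · intro v
      have hv : v ∈ LinearMap.range (fderiv ℝ f₁ x₀).toLinearMap ⊔ C := by
        rw [hC.sup_eq_top]; trivial
      obtain ⟨_, ⟨u, rfl⟩, a, ha, rfl⟩ := Submodule.mem_sup.1 hv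
      exact ⟨(u, ⟨a, ha⟩), by simp [T]⟩
  have hG : ∀ p : X × C, ContDiffAt ℝ ∞ f₁ p.1 → ContDiffAt ℝ ∞ G p := fun p hp =>
    (ContDiffAt.comp p (g := f₁) hp contDiffAt_fst).add
      (C.subtypeL.contDiff.contDiffAt.comp _ contDiffAt_snd)
  have hH : ∀ p : X × C, ContDiffAt ℝ ∞ f₂ p.1 → ContDiffAt ℝ ∞ Φ p.1 → ContDiffAt ℝ ∞ H p :=
    fun p hp hp' => (ContDiffAt.comp p (g := f₂) hp contDiffAt_fst).add
      ((ContDiffAt.comp p (g := Φ) hp' contDiffAt_fst).clm_apply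
        (C.subtypeL.contDiff.contDiffAt.comp _ contDiffAt_snd))
  have hG' : ∀ x, ContDiffAt ℝ ∞ f₁ x → HasFDerivAt G (T x) (x, 0) := by
    intro x hx
    have h1 : HasFDerivAt (fun p : X × C => f₁ p.1)
        ((fderiv ℝ f₁ x).comp (ContinuousLinearMap.fst ℝ X C)) (x, 0) :=
      HasFDerivAt.comp (x, (0 : C)) (g := f₁) (hx.differentiableAt (by simp)).hasFDerivAt
        hasFDerivAt_fst
    have h2 : HasFDerivAt (fun p : X × C => (p.2 : E₁))
        (C.subtypeL.comp (ContinuousLinearMap.snd ℝ X C)) (x, 0) :=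
      C.subtypeL.hasFDerivAt.comp _ hasFDerivAt_snd
    refine (h1.add h2).congr_fderiv ?_
    ext <;> simp [T]
  have hH' : ∀ x, ContDiffAt ℝ ∞ f₂ x → ContDiffAt ℝ ∞ Φ x →
      (Φ x).comp (fderiv ℝ f₁ x) = fderiv ℝ f₂ x → HasFDerivAt H ((Φ x).comp (T x)) (x, 0) := by
    intro x hx hΦx hc
    have h1 : HasFDerivAt (fun p : X × C => f₂ p.1)
        ((fderiv ℝ f₂ x).comp (ContinuousLinearMap.fst ℝ X C)) (x, 0) :=
      HasFDerivAt.comp (x, (0 : C)) (g := f₂) (hx.differentiableAt (by simp)).hasFDerivAt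
        hasFDerivAt_fst
    have h2 : HasFDerivAt (fun p : X × C => (p.2 : E₁))
        (C.subtypeL.comp (ContinuousLinearMap.snd ℝ X C)) (x, 0) :=
      C.subtypeL.hasFDerivAt.comp _ hasFDerivAt_snd
    have h3 : HasFDerivAt (fun p : X × C => Φ p.1)
        ((fderiv ℝ Φ x).comp (ContinuousLinearMap.fst ℝ X C)) (x, 0) :=
      HasFDerivAt.comp (x, (0 : C)) (g := Φ) (hΦx.differentiableAt (by simp)).hasFDerivAt
        hasFDerivAt_fst
    -- The derivative of Φ does not contribute, as it is applied to the transverse variable, which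
    -- is 0 here.
    refine (h1.add (h3.clm_apply h2)).congr_fderiv ?_
    rw [← hc]
    ext <;> simp [T]
  have hι : ContinuousAt (fun x : X => (x, (0 : C))) x₀ := by fun_prop
  have hGev : ∀ᶠ p in 𝓝 (x₀, (0 : C)), ContDiffAt ℝ ∞ G p :=
    (continuousAt_fst.eventually hf₁).mono hG
  have hHev : ∀ᶠ p in 𝓝 (x₀, (0 : C)), ContDiffAt ℝ ∞ H p :=
    ((continuousAt_fst.eventually hf₂).and (continuousAt_fst.eventually hΦ)).mono
      fun p hp => hH p hp.1 hp.2
  obtain ⟨e, hes, heG, -, hei⟩ := exists_openPartialHomeomorph_of_isInvertible hGev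
    (by rw [(hG' x₀ hf₁.self_of_nhds).fderiv]; exact hTi)
  have hG0 : ∀ x, e (x, 0) = f₁ x := fun x => by rw [heG]; simp [G]
  have hg : ∀ᶠ y in 𝓝 (f₁ x₀), ContDiffAt ℝ ∞ (H ∘ e.symm) y := by
    rw [← hG0]
    have h1 := (e.continuousAt_symm (e.map_source hes)).eventually
      (by rw [e.left_inv hes]; exact hHev)
    filter_upwards [h1, e.open_target.mem_nhds (e.map_source hes)] with y hy hy'
    exact ContDiffAt.comp y hy (hei.contDiffAt (e.open_target.mem_nhds hy'))
  refine ⟨H ∘ e.symm, hg, ?_⟩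
  filter_upwards [hf₁, hf₂, hΦ, hcomp, eventually_isInvertible hT.continuousAt hTi,
    hι.eventually (e.open_source.mem_nhds hes),
    hf₁.self_of_nhds.continuousAt.eventually hg] with x h1 h2 h3 h4 h5 h6 h7
  have h8 : (H ∘ e.symm) (f₁ x) = f₂ x := by
    rw [← hG0, Function.comp_apply, e.left_inv h6]
    simp [H]
  refine ⟨h8, ?_⟩
  have h9 := (h7.differentiableAt (by simp)).hasFDerivAt
  have h10 : HasFDerivAt (H ∘ e.symm) (fderiv ℝ (H ∘ e.symm) (f₁ x)) (G (x, 0)) := by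
    rw [← heG, hG0]; exact h9
  have h11 := h10.comp (x, (0 : C)) (hG' x h1)
  have h12 : (H ∘ e.symm) ∘ G =ᶠ[𝓝 (x, (0 : C))] H := by
    filter_upwards [e.open_source.mem_nhds h6] with p hp
    simp [← heG, e.left_inv hp]
  -- The chain rule for (H ∘ G⁻¹) ∘ G = H reads D(H ∘ G⁻¹) ∘ T = Φ ∘ T; the invertible T cancels.
  have h13 := (h11.congr_of_eventuallyEq h12.symm).unique (hH' x h2 h3 h4)
  obtain ⟨L, hL⟩ := h5
  have h14 : fderiv ℝ (H ∘ e.symm) (f₁ x) = Φ x := by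
    ext v
    have := DFunLike.congr_fun h13 (L.symm v)
    simpa [← hL] using this
  rwa [h14] at h9

/-- The zero set of a function with differential `(u, w) ↦ w - A u` is near the base point the
graph of a local diffeomorphism with differential `A`. -/
theorem exists_openPartialHomeomorph_graph [FiniteDimensional ℝ E₂] {H : E₁ × E₂ → E₂} {z₀ : E₁ × E₂} {A : E₁ →L[ℝ] E₂}
    (hH : ∀ᶠ z in 𝓝 z₀, ContDiffAt ℝ ∞ H z) (h0 : H z₀ = 0) (hA : Function.Bijective A)
    (hd : HasFDerivAt H (ContinuousLinearMap.snd ℝ E₁ E₂ - A.comp (ContinuousLinearMap.fst ℝ E₁ E₂))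
      z₀) :
    ∃ h : OpenPartialHomeomorph E₁ E₂, z₀.1 ∈ h.source ∧ h z₀.1 = z₀.2 ∧
      ContDiffOn ℝ ∞ h h.source ∧ ContDiffOn ℝ ∞ h.symm h.target ∧ HasFDerivAt h A z₀.1 ∧
      ∀ᶠ z in 𝓝 z₀, H z = 0 ↔ h z.1 = z.2 := by
  have : CompleteSpace E₁ := FiniteDimensional.complete ℝ E₁
  have : CompleteSpace E₂ := FiniteDimensional.complete ℝ E₂
  -- K straightens the zero set of H to E₁ × {0}; the second component of K⁻¹(x, 0) parametrizes it
  -- as a graph.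
  let K : E₁ × E₂ → E₁ × E₂ := fun z => (z.1, H z)
  have hK : ∀ᶠ z in 𝓝 z₀, ContDiffAt ℝ ∞ K z := hH.mono fun z hz => contDiffAt_fst.prodMk hz
  have hKd : HasFDerivAt K ((ContinuousLinearMap.fst ℝ E₁ E₂).prod (ContinuousLinearMap.snd ℝ E₁ E₂
      - A.comp (ContinuousLinearMap.fst ℝ E₁ E₂))) z₀ := hasFDerivAt_fst.prodMk hd
  obtain ⟨e, hes, heK, -, hei⟩ := exists_openPartialHomeomorph_of_isInvertible hK (by
    rw [hKd.fderiv]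
    apply isInvertible_of_bijective
    constructor
    · rw [injective_iff_map_eq_zero]
      rintro ⟨u, w⟩ h
      simp only [ContinuousLinearMap.prod_apply, ContinuousLinearMap.coe_fst', sub_apply,
        ContinuousLinearMap.coe_snd', ContinuousLinearMap.comp_apply, Prod.mk_eq_zero] at h
      obtain ⟨rfl, h2⟩ := h
      rw [map_zero, sub_zero] at h2
      rw [h2]; rfl
    · rintro ⟨u, w⟩
      exact ⟨(u, w + A u), by simp⟩)
  have he0 : e z₀ = (z₀.1, 0) := by rw [heK]; simp [K, h0]
  let g : E₁ → E₂ := fun x => (e.symm (x, 0)).2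
  have hι : Continuous (fun x : E₁ => (x, (0 : E₂))) := by fun_prop
  have ht : ∀ᶠ x in 𝓝 z₀.1, (x, (0 : E₂)) ∈ e.target :=
    hι.continuousAt.eventually (e.open_target.mem_nhds (by
      change (z₀.1, (0 : E₂)) ∈ e.target
      rw [← he0]; exact e.map_source hes))
  have hg : ∀ᶠ x in 𝓝 z₀.1, ContDiffAt ℝ ∞ g x := by
    filter_upwards [ht] with x hx
    exact contDiffAt_snd.comp x (ContDiffAt.comp x (hei.contDiffAt (e.open_target.mem_nhds hx))
      (contDiffAt_id.prodMk contDiffAt_const))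
  have hgz : ∀ᶠ z in 𝓝 z₀, H z = 0 ↔ g z.1 = z.2 := by
    filter_upwards [e.open_source.mem_nhds hes, continuousAt_fst.eventually ht] with z hz hz'
    constructor
    · intro h
      have : e z = (z.1, 0) := by rw [heK]; simp [K, h]
      simp only [g, ← this, e.left_inv hz]
    · intro h
      have h1 : K (e.symm (z.1, 0)) = (z.1, 0) := by rw [← heK]; exact e.right_inv hz'
      have h2 : e.symm (z.1, 0) = z := by
        have h3 : (K (e.symm (z.1, 0))).1 = z.1 := (Prod.ext_iff.1 h1).1
        exact Prod.ext h3 h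
      rw [h2] at h1
      exact congrArg Prod.snd h1
  have hg0 : g z₀.1 = z₀.2 := hgz.self_of_nhds.1 h0
  -- Differentiating H(x, g(x)) = 0 at the base point.
  have hgd : HasFDerivAt g A z₀.1 := by
    have h1 := (hg.self_of_nhds.differentiableAt (by simp)).hasFDerivAt
    have h2 : HasFDerivAt (fun x => (x, g x)) ((ContinuousLinearMap.id ℝ E₁).prod
      (fderiv ℝ g z₀.1)) z₀.1 := (hasFDerivAt_id _).prodMk h1
    have h3 := HasFDerivAt.comp z₀.1 (g := H) (f := fun x => (x, g x))
      (by rw [hg0]; exact hd) h2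
    have h4 : H ∘ (fun x => (x, g x)) =ᶠ[𝓝 z₀.1] fun _ => 0 := by
      have h5 : ContinuousAt (fun x => (x, g x)) z₀.1 := h2.continuousAt
      have h6 := h5.eventually (p := fun z => H z = 0 ↔ g z.1 = z.2)
        (by change ∀ᶠ z in 𝓝 (z₀.1, g z₀.1), _
            rw [hg0]; exact hgz)
      filter_upwards [h6] with x hx
      exact hx.2 rfl
    have h7 := (h3.congr_of_eventuallyEq h4.symm).unique (hasFDerivAt_const 0 _)
    have h8 : fderiv ℝ g z₀.1 = A := by
      ext v
      have := DFunLike.congr_fun h7 v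
      simpa [sub_eq_zero] using this
    rwa [h8] at h1
  obtain ⟨h, hs, hcoe, h1, h2⟩ := exists_openPartialHomeomorph_of_isInvertible hg
    (by rw [hgd.fderiv]; exact isInvertible_of_bijective hA)
  have hcoe' : (h : E₁ → E₂) = g := funext hcoe
  rw [← hcoe'] at hg0 hgd hgz
  exact ⟨h, hs, hg0, h1, h2, hgd, hgz⟩

end Calculus

/-! ### Gluing maps along a submanifold -/

section Topological

/-- A map that is locally injective along a subset, on which it is inducing, is injective near that
subset. -/
theorem exists_isOpen_injOn {Z X J : Type*} [MetricSpace Z] [MetricSpace X] [TopologicalSpace J]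
    {a : J → Z} {p : Z → X} (hp : Continuous p) (ha : Continuous a)
    (hpa : Topology.IsInducing (p ∘ a)) {D : Set Z} (hloc : ∀ i, ∃ U ∈ 𝓝 (a i), InjOn p (D ∩ U)) :
    ∃ N : Set Z, IsOpen N ∧ range a ⊆ N ∧ InjOn p (D ∩ N) := by
  -- Injectivity is known on a ball of radius 2r. Since p ∘ a is inducing, δ is chosen so that
  -- points of J with images within 2δ in X are within r in Z; this excludes distant parts of J with
  -- nearby projections.
  have h1 : ∀ i, ∃ r > 0, InjOn p (D ∩ Metric.ball (a i) (2 * r)) ∧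
      ∃ δ > 0, ∀ k, dist (p (a k)) (p (a i)) < 2 * δ → dist (a k) (a i) < r := by
    intro i
    obtain ⟨U, hU, hi⟩ := hloc i
    obtain ⟨r, hr, hrU⟩ := Metric.mem_nhds_iff.1 hU
    refine ⟨r / 2, half_pos hr, ?_, ?_⟩
    · rw [mul_div_cancel₀ _ two_ne_zero]
      exact hi.mono (inter_subset_inter_right D hrU)
    · have h2 : a ⁻¹' Metric.ball (a i) (r / 2) ∈ 𝓝 i :=
        ha.continuousAt.preimage_mem_nhds (Metric.ball_mem_nhds _ (half_pos hr))
      rw [hpa.nhds_eq_comap, Filter.mem_comap] at h2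
      obtain ⟨V, hV, hVU⟩ := h2
      obtain ⟨δ, hδ, hδV⟩ := Metric.mem_nhds_iff.1 hV
      exact ⟨δ / 2, half_pos hδ, fun k hk => hVU (hδV (by
        rwa [mul_div_cancel₀ _ two_ne_zero] at hk))⟩
  choose r hr hinj δ hδ hclose using h1
  refine ⟨⋃ i, Metric.ball (a i) (r i) ∩ p ⁻¹' Metric.ball (p (a i)) (δ i), ?_, ?_, ?_⟩
  · exact isOpen_iUnion fun i => Metric.isOpen_ball.inter (Metric.isOpen_ball.preimage hp)
  · rintro _ ⟨i, rfl⟩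
    exact mem_iUnion.2 ⟨i, Metric.mem_ball_self (hr i), Metric.mem_ball_self (hδ i)⟩
  -- If z and w have the same projection, the two centres project within δ k + δ i, at most twice
  -- the larger δ. With r i the larger radius, both points then fall in the ball of radius 2 r i
  -- around a i.
  · have key : ∀ i k z w, z ∈ D → w ∈ D → dist z (a i) < r i → dist (p z) (p (a i)) < δ i →
        dist w (a k) < r k → dist (p w) (p (a k)) < δ k → p z = p w → r k ≤ r i → z = w := by
      intro i k z w hz hw hzi hpi hwk hpk hzw hki
      have h2 : dist (p (a k)) (p (a i)) < δ k + δ i := by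
        have h3 := dist_triangle_left (p (a k)) (p (a i)) (p w)
        have h4 : dist (p w) (p (a i)) < δ i := by rwa [← hzw]
        linarith
      have h5 : dist (a k) (a i) < r i := by
        rcases le_total (δ k) (δ i) with h | h
        · exact hclose i k (by linarith)
        · rw [dist_comm]
          exact (hclose k i (by rw [dist_comm]; linarith)).trans_le hki
      refine hinj i ⟨hz, ?_⟩ ⟨hw, ?_⟩ hzw
      · rw [Metric.mem_ball]; linarith [hr i]
      · rw [Metric.mem_ball]
        have := dist_triangle w (a k) (a i)
        linarith
    rintro z ⟨hz, hz'⟩ w ⟨hw, hw'⟩ hzw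
    obtain ⟨i, hi1, hi2⟩ := mem_iUnion.1 hz'
    obtain ⟨k, hk1, hk2⟩ := mem_iUnion.1 hw'
    rcases le_total (r k) (r i) with h | h
    · exact key i k z w hz hw hi1 hi2 hk1 hk2 hzw h
    · exact (key k i w z hw hz hk1 hk2 hi1 hi2 hzw.symm h).symm

end Topological

/-! ### Partitions of unity on an open union -/

section PartitionOfUnity

variable {E H M ι : Type*} [NormedAddCommGroup E] [NormedSpace ℝ E] [FiniteDimensional ℝ E]
  [TopologicalSpace H] {I : ModelWithCorners ℝ E H} [TopologicalSpace M] [ChartedSpace H M]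
  [IsManifold I ∞ M] [T2Space M] [SecondCountableTopology M]

/-- Smooth partitions of unity on a union of open sets. -/
theorem exists_partition_iUnion (W : ι → Set M) (hW : ∀ i, IsOpen (W i)) :
    ∃ ρ : ι → M → ℝ, ∀ x ∈ ⋃ i, W i, (∀ i, 0 ≤ ρ i x) ∧
      (∀ i, ContMDiffAt I 𝓘(ℝ, ℝ) ∞ (ρ i) x) ∧
      ∃ t : Finset ι, (∀ i ∈ t, x ∈ W i) ∧ ∀ᶠ y in 𝓝 x, (∀ i ∉ t, ρ i y = 0) ∧
        ∑ i ∈ t, ρ i y = 1 := by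
  classical
  let U : TopologicalSpace.Opens M := ⟨⋃ i, W i, isOpen_iUnion hW⟩
  have : LocallyCompactSpace H := I.locallyCompactSpace
  have : LocallyCompactSpace M := ChartedSpace.locallyCompactSpace H M
  have : LocallyCompactSpace U := U.isOpen.locallyCompactSpace
  obtain ⟨f, hf⟩ := SmoothPartitionOfUnity.exists_isSubordinate I (M := U) isClosed_univ
    (fun i => Subtype.val ⁻¹' W i) (fun i => (hW i).preimage continuous_subtype_val) (by
      rintro ⟨x, hx⟩ -
      obtain ⟨i, hi⟩ := mem_iUnion.1 hx
      exact mem_iUnion.2 ⟨i, hi⟩)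
  -- The partition lives on the open submanifold U. The value 0 outside U is a default; nothing is
  -- claimed there.
  let ρ : ι → M → ℝ := fun i x => if h : x ∈ U then f i ⟨x, h⟩ else 0
  have hρ : ∀ i (x : U), ρ i x = f i x := fun i x => dif_pos x.2
  refine ⟨ρ, fun x hx => ?_⟩
  let x' : U := ⟨x, hx⟩
  refine ⟨fun i => ?_, fun i => ?_, f.fintsupport x', ?_, ?_⟩
  · exact (f.nonneg i x').trans_eq (hρ i x').symm
  · refine (contMDiffAt_subtype_iff (x := x')).1 ?_
    simp only [hρ]
    exact (f i).contMDiff.contMDiffAt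
  · intro i hi
    exact hf i ((f.mem_fintsupport_iff x' i).1 hi)
  · have h1 : ∀ᶠ y : U in 𝓝 x', (∀ i ∉ f.fintsupport x', ρ i y = 0) ∧
        ∑ i ∈ f.fintsupport x', ρ i y = 1 := by
      filter_upwards [f.eventually_finsupport_subset x'] with y hy
      constructor
      · intro i hi
        rw [hρ]
        by_contra h
        exact hi (hy ((f.mem_finsupport y).2 h))
      · simp only [hρ]
        exact f.sum_finsupport' y (mem_univ y) hy
    rw [nhds_subtype_eq_comap] at h1
    obtain ⟨V, hV, hVU⟩ := Filter.mem_comap.1 h1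
    filter_upwards [hV, U.isOpen.mem_nhds hx] with y hy hyU
    exact hVU (show (⟨y, hyU⟩ : U) ∈ Subtype.val ⁻¹' V from hy)

end PartitionOfUnity

/-! ### From local graphs to one diffeomorphism -/

section GraphGluing

variable {E₁ E₂ M₁ M₂ J : Type*} [NormedAddCommGroup E₁] [NormedSpace ℝ E₁]
  [NormedAddCommGroup E₂] [NormedSpace ℝ E₂]
  [TopologicalSpace M₁] [ChartedSpace E₁ M₁] [T2Space M₁] [SecondCountableTopology M₁]
  [TopologicalSpace M₂] [ChartedSpace E₂ M₂] [T2Space M₂] [SecondCountableTopology M₂]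
  [TopologicalSpace J]

theorem metrizableSpace_of_chartedSpace (E M : Type*) [NormedAddCommGroup E] [NormedSpace ℝ E]
    [FiniteDimensional ℝ E] [TopologicalSpace M] [ChartedSpace E M] [T2Space M]
    [SecondCountableTopology M] : TopologicalSpace.MetrizableSpace M := by
  have : LocallyCompactSpace E := by
    have := FiniteDimensional.proper_real E
    infer_instance
  have : LocallyCompactSpace M := ChartedSpace.locallyCompactSpace E M
  exact TopologicalSpace.metrizableSpace_of_t3_secondCountable M

/-- A subset of `M₁ × M₂` that is locally, along an embedded `J`, the graph of a local
diffeomorphism, is the graph of a diffeomorphism near `J`. -/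
theorem exists_openPartialHomeomorph_of_local_graph [FiniteDimensional ℝ E₁]
    [FiniteDimensional ℝ E₂] [Nonempty J] {i₁ : J → M₁} {i₂ : J → M₂}
    (hi₁ : Topology.IsInducing i₁) (hi₂ : Topology.IsInducing i₂) (D : Set (M₁ × M₂))
    (h : J → OpenPartialHomeomorph M₁ M₂) (hs : ∀ m, i₁ m ∈ (h m).source)
    (hm : ∀ m, h m (i₁ m) = i₂ m)
    (h1 : ∀ m, ContMDiffOn 𝓘(ℝ, E₁) 𝓘(ℝ, E₂) ∞ (h m) (h m).source)
    (h2 : ∀ m, ContMDiffOn 𝓘(ℝ, E₂) 𝓘(ℝ, E₁) ∞ (h m).symm (h m).target)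
    (hD : ∀ m, ∀ᶠ z in 𝓝 (i₁ m, i₂ m), z ∈ D ↔ h m z.1 = z.2) :
    ∃ ψ : OpenPartialHomeomorph M₁ M₂, range i₁ ⊆ ψ.source ∧ range i₂ ⊆ ψ.target ∧
      ContMDiffOn 𝓘(ℝ, E₁) 𝓘(ℝ, E₂) ∞ ψ ψ.source ∧
      ContMDiffOn 𝓘(ℝ, E₂) 𝓘(ℝ, E₁) ∞ ψ.symm ψ.target ∧ (∀ m, ψ (i₁ m) = i₂ m) ∧
      ∀ m, ψ =ᶠ[𝓝 (i₁ m)] h m := by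
  classical
  have := metrizableSpace_of_chartedSpace E₁ M₁
  have := metrizableSpace_of_chartedSpace E₂ M₂
  let := TopologicalSpace.metrizableSpaceMetric M₁
  let := TopologicalSpace.metrizableSpaceMetric M₂
  let a : J → M₁ × M₂ := fun m => (i₁ m, i₂ m)
  have ha : Continuous a := hi₁.continuous.prodMk hi₂.continuous
  have hG : ∀ m, ∃ G : Set (M₁ × M₂), IsOpen G ∧ a m ∈ G ∧ ∀ z ∈ G,
      z.1 ∈ (h m).source ∧ z.2 ∈ (h m).target ∧ (z ∈ D ↔ h m z.1 = z.2) := by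
    intro m
    have ht : i₂ m ∈ (h m).target := by rw [← hm]; exact (h m).map_source (hs m)
    obtain ⟨G, hG, hGo, haG⟩ := eventually_nhds_iff.1
      (((continuousAt_fst (p := a m)).eventually ((h m).open_source.mem_nhds (hs m))).and
      (((continuousAt_snd (p := a m)).eventually ((h m).open_target.mem_nhds ht)).and (hD m)))
    exact ⟨G, hGo, haG, hG⟩
  choose G hGo haG hG using hG
  -- On each G m both projections of D are injective, D being the graph of the injective h m.
  -- Injectivity then holds near all of J, separately for each factor.
  obtain ⟨N₁, hN₁, haN₁, hinj₁⟩ := exists_isOpen_injOn (D := D) (p := Prod.fst) continuous_fst ha hi₁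
    fun m => ⟨G m, (hGo m).mem_nhds (haG m), by
      rintro z ⟨hz, hzG⟩ w ⟨hw, hwG⟩ hzw
      refine Prod.ext hzw ?_
      rw [← (hG m z hzG).2.2.1 hz, ← (hG m w hwG).2.2.1 hw, hzw]⟩
  obtain ⟨N₂, hN₂, haN₂, hinj₂⟩ := exists_isOpen_injOn (D := D) (p := Prod.snd) continuous_snd ha hi₂
    fun m => ⟨G m, (hGo m).mem_nhds (haG m), by
      rintro z ⟨hz, hzG⟩ w ⟨hw, hwG⟩ hzw
      refine Prod.ext ((h m).injOn (hG m z hzG).1 (hG m w hwG).1 ?_) hzw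
      rw [(hG m z hzG).2.2.1 hz, (hG m w hwG).2.2.1 hw, hzw]⟩
  let N : Set (M₁ × M₂) := (N₁ ∩ N₂) ∩ ⋃ m, G m
  have hN : IsOpen N := (hN₁.inter hN₂).inter (isOpen_iUnion hGo)
  let Γ : Set (M₁ × M₂) := D ∩ N
  have haΓ : ∀ m, a m ∈ Γ := fun m => ⟨(hD m).self_of_nhds.2 (hm m),
    ⟨haN₁ ⟨m, rfl⟩, haN₂ ⟨m, rfl⟩⟩, mem_iUnion.2 ⟨m, haG m⟩⟩
  have hΓ₁ : InjOn Prod.fst Γ := hinj₁.mono (inter_subset_inter_right D fun z hz => hz.1.1)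
  have hΓ₂ : InjOn Prod.snd Γ := hinj₂.mono (inter_subset_inter_right D fun z hz => hz.1.2)
  obtain ⟨m₀⟩ := ‹Nonempty J›
  -- Off the projections of Γ the functions take arbitrary constant values, which requires J to be
  -- nonempty.
  let f : M₁ → M₂ := fun x => if hx : ∃ y, (x, y) ∈ Γ then hx.choose else i₂ m₀
  let g : M₂ → M₁ := fun y => if hy : ∃ x, (x, y) ∈ Γ then hy.choose else i₁ m₀
  have hf : ∀ x y, (x, y) ∈ Γ → f x = y := by
    intro x y hxy
    have hx : ∃ y, (x, y) ∈ Γ := ⟨y, hxy⟩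
    simp only [f, dif_pos hx]
    exact congrArg Prod.snd (hΓ₁ hx.choose_spec hxy rfl)
  have hg : ∀ x y, (x, y) ∈ Γ → g y = x := by
    intro x y hxy
    have hy : ∃ x, (x, y) ∈ Γ := ⟨x, hxy⟩
    simp only [g, dif_pos hy]
    exact congrArg Prod.fst (hΓ₂ hy.choose_spec hxy rfl)
  -- Near a point of Γ the whole graph of h m stays in Γ. This makes the projection open and lets f
  -- coincide locally with the smooth h m.
  have key₁ : ∀ m z, z ∈ Γ → z ∈ G m → ∀ᶠ x in 𝓝 z.1, (x, h m x) ∈ Γ := by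
    intro m z hz hzG
    have hz2 : h m z.1 = z.2 := (hG m z hzG).2.2.1 hz.1
    have hc : ContinuousAt (fun x => (x, h m x)) z.1 :=
      continuousAt_id.prodMk ((h m).continuousAt (hG m z hzG).1)
    have hmem : N ∩ G m ∈ 𝓝 (z.1, h m z.1) := by
      rw [hz2]; exact (hN.inter (hGo m)).mem_nhds ⟨hz.2, hzG⟩
    filter_upwards [hc.preimage_mem_nhds hmem] with x hx
    exact ⟨(hG m _ hx.2).2.2.2 rfl, hx.1⟩
  have key₂ : ∀ m z, z ∈ Γ → z ∈ G m → ∀ᶠ y in 𝓝 z.2, ((h m).symm y, y) ∈ Γ := by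
    intro m z hz hzG
    have hz2 : h m z.1 = z.2 := (hG m z hzG).2.2.1 hz.1
    have hz1 : (h m).symm z.2 = z.1 := by rw [← hz2, (h m).left_inv (hG m z hzG).1]
    have hc : ContinuousAt (fun y => ((h m).symm y, y)) z.2 :=
      ((h m).continuousAt_symm (hG m z hzG).2.1).prodMk continuousAt_id
    have hmem : N ∩ G m ∈ 𝓝 ((h m).symm z.2, z.2) := by
      rw [hz1]; exact (hN.inter (hGo m)).mem_nhds ⟨hz.2, hzG⟩
    filter_upwards [hc.preimage_mem_nhds hmem] with y hy
    exact ⟨(hG m _ hy.2).2.2.2 ((h m).right_inv (hG m _ hy.2).2.1), hy.1⟩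
  have heq₁ : ∀ m z, z ∈ Γ → z ∈ G m → f =ᶠ[𝓝 z.1] h m := fun m z hz hzG =>
    (key₁ m z hz hzG).mono fun x hx => hf _ _ hx
  have heq₂ : ∀ m z, z ∈ Γ → z ∈ G m → g =ᶠ[𝓝 z.2] (h m).symm := fun m z hz hzG =>
    (key₂ m z hz hzG).mono fun y hy => hg _ _ hy
  have hsm₁ : ∀ x ∈ Prod.fst '' Γ, ContMDiffAt 𝓘(ℝ, E₁) 𝓘(ℝ, E₂) ∞ f x := by
    rintro _ ⟨z, hz, rfl⟩
    obtain ⟨m, hzG⟩ := mem_iUnion.1 hz.2.2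
    exact ((h1 m).contMDiffAt ((h m).open_source.mem_nhds (hG m z hzG).1)).congr_of_eventuallyEq
      (heq₁ m z hz hzG)
  have hsm₂ : ∀ y ∈ Prod.snd '' Γ, ContMDiffAt 𝓘(ℝ, E₂) 𝓘(ℝ, E₁) ∞ g y := by
    rintro _ ⟨z, hz, rfl⟩
    obtain ⟨m, hzG⟩ := mem_iUnion.1 hz.2.2
    exact ((h2 m).contMDiffAt ((h m).open_target.mem_nhds
      (hG m z hzG).2.1)).congr_of_eventuallyEq (heq₂ m z hz hzG)
  let ψ : OpenPartialHomeomorph M₁ M₂ :=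
    { toFun := f
      invFun := g
      source := Prod.fst '' Γ
      target := Prod.snd '' Γ
      map_source' := by
        rintro _ ⟨z, hz, rfl⟩
        exact ⟨z, hz, (hf z.1 z.2 hz).symm⟩
      map_target' := by
        rintro _ ⟨z, hz, rfl⟩
        exact ⟨z, hz, (hg z.1 z.2 hz).symm⟩
      left_inv' := by
        rintro _ ⟨z, hz, rfl⟩
        rw [hf z.1 z.2 hz, hg z.1 z.2 hz]
      right_inv' := by
        rintro _ ⟨z, hz, rfl⟩
        rw [hg z.1 z.2 hz, hf z.1 z.2 hz]
      open_source := by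
        rw [isOpen_iff_mem_nhds]
        rintro _ ⟨z, hz, rfl⟩
        obtain ⟨m, hzG⟩ := mem_iUnion.1 hz.2.2
        filter_upwards [key₁ m z hz hzG] with x hx
        exact ⟨_, hx, rfl⟩
      open_target := by
        rw [isOpen_iff_mem_nhds]
        rintro _ ⟨z, hz, rfl⟩
        obtain ⟨m, hzG⟩ := mem_iUnion.1 hz.2.2
        filter_upwards [key₂ m z hz hzG] with y hy
        exact ⟨_, hy, rfl⟩
      continuousOn_toFun := fun x hx => (hsm₁ x hx).continuousAt.continuousWithinAt
      continuousOn_invFun := fun y hy => (hsm₂ y hy).continuousAt.continuousWithinAt }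
  refine ⟨ψ, ?_, ?_, fun x hx => (hsm₁ x hx).contMDiffWithinAt,
    fun y hy => (hsm₂ y hy).contMDiffWithinAt, fun m => hf _ _ (haΓ m),
    fun m => heq₁ m (a m) (haΓ m) (haG m)⟩
  · rintro _ ⟨m, rfl⟩
    exact ⟨a m, haΓ m, rfl⟩
  · rintro _ ⟨m, rfl⟩
    exact ⟨a m, haΓ m, rfl⟩

end GraphGluing

/-! ### Calculus in charts -/

section Charts

variable {E M E' M' : Type*} [NormedAddCommGroup E] [NormedSpace ℝ E]
  [TopologicalSpace M] [ChartedSpace E M] [IsManifold 𝓘(ℝ, E) ∞ M]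
  [NormedAddCommGroup E'] [NormedSpace ℝ E']
  [TopologicalSpace M'] [ChartedSpace E' M'] [IsManifold 𝓘(ℝ, E') ∞ M']

/-- The differential of a map, as a linear map between the model spaces. -/
def dmap (f : M → M') (x : M) : E →L[ℝ] E' := mfderiv 𝓘(ℝ, E) 𝓘(ℝ, E') f x

/-- The differential of a chart. -/
def dchart (a x : M) : E →L[ℝ] E := mfderiv 𝓘(ℝ, E) 𝓘(ℝ, E) (chartAt E a) x

/-- The differential of the inverse of a chart, at the image of a point of the manifold. -/
def dchartSymm (a x : M) : E →L[ℝ] E :=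
  mfderiv 𝓘(ℝ, E) 𝓘(ℝ, E) (chartAt E a).symm (chartAt E a x)

theorem contMDiffAt_chartAt {a x : M} (hx : x ∈ (chartAt E a).source) :
    ContMDiffAt 𝓘(ℝ, E) 𝓘(ℝ, E) ∞ (chartAt E a) x :=
  (contMDiffOn_chart (I := 𝓘(ℝ, E)) (n := ∞) (x := a)).contMDiffAt
    ((chartAt E a).open_source.mem_nhds hx)

theorem contMDiffAt_chartAt_symm {a : M} {y : E} (hy : y ∈ (chartAt E a).target) :
    ContMDiffAt 𝓘(ℝ, E) 𝓘(ℝ, E) ∞ (chartAt E a).symm y :=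
  (contMDiffOn_chart_symm (I := 𝓘(ℝ, E)) (n := ∞) (x := a)).contMDiffAt
    ((chartAt E a).open_target.mem_nhds hy)

theorem mdifferentiable_chartAt (a : M) :
    (chartAt E a).MDifferentiable 𝓘(ℝ, E) 𝓘(ℝ, E) :=
  ⟨(contMDiffOn_chart (n := ∞)).mdifferentiableOn (by simp),
    (contMDiffOn_chart_symm (n := ∞)).mdifferentiableOn (by simp)⟩

theorem dchartSymm_dchart {a x : M} (hx : x ∈ (chartAt E a).source) (v : E) :
    dchartSymm a x (dchart a x v) = v :=
  DFunLike.congr_fun ((mdifferentiable_chartAt a).symm_comp_deriv hx) v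

theorem dchart_dchartSymm {a x : M} (hx : x ∈ (chartAt E a).source) (v : E) :
    dchart a x (dchartSymm a x v) = v := by
  have h : dchart a ((chartAt E a).symm (chartAt E a x)) (dchartSymm a x v) = v :=
    DFunLike.congr_fun
      ((mdifferentiable_chartAt a).comp_symm_deriv ((chartAt E a).map_source hx)) v
  rwa [(chartAt E a).left_inv hx] at h

theorem contDiffAt_inCharts {f : M → M'} {a x : M} {b : M'} (hx : x ∈ (chartAt E a).source)
    (hfx : f x ∈ (chartAt E' b).source) (hf : ContMDiffAt 𝓘(ℝ, E) 𝓘(ℝ, E') ∞ f x) :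
    ContDiffAt ℝ ∞ (chartAt E' b ∘ f ∘ (chartAt E a).symm) (chartAt E a x) := by
  rw [← contMDiffAt_iff_contDiffAt]
  have hxx := (chartAt E a).left_inv hx
  refine ContMDiffAt.comp (I' := 𝓘(ℝ, E')) _ (contMDiffAt_chartAt ?_)
    (ContMDiffAt.comp (I' := 𝓘(ℝ, E)) _ ?_
      (contMDiffAt_chartAt_symm ((chartAt E a).map_source hx)))
  · rwa [Function.comp_apply, hxx]
  · rwa [hxx]

theorem hasFDerivAt_inCharts {f : M → M'} {a x : M} {b : M'} (hx : x ∈ (chartAt E a).source)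
    (hfx : f x ∈ (chartAt E' b).source) (hf : MDifferentiableAt 𝓘(ℝ, E) 𝓘(ℝ, E') f x) :
    HasFDerivAt (chartAt E' b ∘ f ∘ (chartAt E a).symm)
      ((dchart b (f x)).comp ((dmap f x).comp (dchartSymm a x))) (chartAt E a x) := by
  have hxx := (chartAt E a).left_inv hx
  have h1 := (mdifferentiable_chartAt (E := E) a).mdifferentiableAt_symm
    ((chartAt E a).map_source hx)
  have h2 : MDifferentiableAt 𝓘(ℝ, E) 𝓘(ℝ, E') f ((chartAt E a).symm (chartAt E a x)) := by
    rwa [hxx]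
  have h3 : MDifferentiableAt 𝓘(ℝ, E') 𝓘(ℝ, E') (chartAt E' b)
      ((f ∘ (chartAt E a).symm) (chartAt E a x)) := by
    rw [Function.comp_apply, hxx]
    exact (mdifferentiable_chartAt b).mdifferentiableAt hfx
  have h4 := h3.hasMFDerivAt.comp _ (h2.hasMFDerivAt.comp _ h1.hasMFDerivAt)
  have h5 := h4.hasFDerivAt
  have h6 : dmap (E := E) (E' := E') f ((chartAt E a).symm (chartAt E a x)) = dmap f x := by rw [hxx]
  have h7 : dchart (E := E') b (f ((chartAt E a).symm (chartAt E a x))) = dchart b (f x) := by rw [hxx]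
  rw [← h6, ← h7]
  exact h5

end Charts

/-! ### Averaging maps into a manifold -/

section Averaging

variable {E₁ E₂ : Type*} [NormedAddCommGroup E₁] [NormedSpace ℝ E₁]
  [NormedAddCommGroup E₂] [NormedSpace ℝ E₂]

/-- This is one summand of the averaged displacement in a reference chart: g passes to another
chart, k is the local map read in that chart, and the derivative of g' carries the difference back.
-/
theorem contDiffAt_gluingTerm {ρ : E₁ × E₂ → ℝ} {g g' : E₂ → E₂} {k : E₁ → E₂} {z : E₁ × E₂}
    (hρ : ContDiffAt ℝ ∞ ρ z) (hg : ContDiffAt ℝ ∞ g z.2) (hg' : ContDiffAt ℝ ∞ g' (g z.2))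
    (hk : ContDiffAt ℝ ∞ k z.1) :
    ContDiffAt ℝ ∞ (fun z => ρ z • fderiv ℝ g' (g z.2) (g z.2 - k z.1)) z := by
  have h1 : ContDiffAt ℝ ∞ (fun z : E₁ × E₂ => g z.2) z :=
    ContDiffAt.comp z (g := g) hg contDiffAt_snd
  have h2 : ContDiffAt ℝ ∞ (fun z : E₁ × E₂ => k z.1) z :=
    ContDiffAt.comp z (g := k) hk contDiffAt_fst
  have h3 : ContDiffAt ℝ ∞ (fun z : E₁ × E₂ => fderiv ℝ g' (g z.2)) z :=
    ContDiffAt.comp z (g := fderiv ℝ g') (hg'.fderiv_right (m := ∞) (by simp)) h1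
  exact hρ.smul (h3.clm_apply (h1.sub h2))

/-- On the graph of the local map the difference g(z.2) - k(z.1) vanishes, so derivatives of ρ and
of Dg' do not contribute. Since Dg' ∘ Dg = 1, the second variable enters as the identity. -/
theorem hasFDerivAt_gluingTerm {ρ : E₁ × E₂ → ℝ} {g g' : E₂ → E₂} {k : E₁ → E₂} {z : E₁ × E₂}
    (hρ : ContDiffAt ℝ ∞ ρ z) (hg : ContDiffAt ℝ ∞ g z.2) (hg' : ContDiffAt ℝ ∞ g' (g z.2))
    (hk : ContDiffAt ℝ ∞ k z.1) (hgg : g' ∘ g =ᶠ[𝓝 z.2] id) (hkg : k z.1 = g z.2) :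
    HasFDerivAt (fun z => ρ z • fderiv ℝ g' (g z.2) (g z.2 - k z.1))
      (ρ z • (ContinuousLinearMap.snd ℝ E₁ E₂
        - (fderiv ℝ (g' ∘ k) z.1).comp (ContinuousLinearMap.fst ℝ E₁ E₂))) z := by
  have h1 : HasFDerivAt (fun z : E₁ × E₂ => g z.2)
      ((fderiv ℝ g z.2).comp (ContinuousLinearMap.snd ℝ E₁ E₂)) z :=
    HasFDerivAt.comp z (g := g) (hg.differentiableAt (by simp)).hasFDerivAt hasFDerivAt_snd
  have h2 : HasFDerivAt (fun z : E₁ × E₂ => k z.1)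
      ((fderiv ℝ k z.1).comp (ContinuousLinearMap.fst ℝ E₁ E₂)) z :=
    HasFDerivAt.comp z (g := k) (hk.differentiableAt (by simp)).hasFDerivAt hasFDerivAt_fst
  have h3 : DifferentiableAt ℝ (fun z : E₁ × E₂ => fderiv ℝ g' (g z.2)) z :=
    DifferentiableAt.comp z (g := fderiv ℝ g')
      ((hg'.fderiv_right (m := ∞) (by simp)).differentiableAt (by simp)) h1.differentiableAt
  have h4 := (hρ.differentiableAt (by simp)).hasFDerivAt.smul
    (h3.hasFDerivAt.clm_apply (h1.sub h2))
  have h5 : (fderiv ℝ g' (g z.2)).comp (fderiv ℝ g z.2) = ContinuousLinearMap.id ℝ E₂ := by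
    rw [← fderiv_comp _ (hg'.differentiableAt (by simp)) (hg.differentiableAt (by simp)),
      hgg.fderiv_eq, fderiv_id]
  have h6 : fderiv ℝ (g' ∘ k) z.1 = (fderiv ℝ g' (g z.2)).comp (fderiv ℝ k z.1) := by
    rw [fderiv_comp _ (by rw [hkg]; exact hg'.differentiableAt (by simp))
      (hk.differentiableAt (by simp)), hkg]
  have h7 : ∀ w, fderiv ℝ g' (g z.2) (fderiv ℝ g z.2 w) = w := fun w => DFunLike.congr_fun h5 w
  refine h4.congr_fderiv ?_
  rw [h6]
  ext w <;> simp [hkg, h7]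

variable {M₁ M₂ J : Type*}
  [TopologicalSpace M₂] [ChartedSpace E₂ M₂] [IsManifold 𝓘(ℝ, E₂) ∞ M₂]

/-- The tangent vector at `z.2` that points away from `f z.1`, in the chart at `b`. -/
def displacement (b : M₂) (f : M₁ → M₂) (z : M₁ × M₂) : E₂ :=
  dchartSymm b z.2 (chartAt E₂ b z.2 - chartAt E₂ b (f z.1))

/-- A displacement is a tangent vector, so another chart sees it through the derivative of the
transition map. This allows displacements formed in different charts to be added. -/
theorem dchart_displacement {b c : M₂} (f : M₁ → M₂) {z : M₁ × M₂}
    (hb : z.2 ∈ (chartAt E₂ b).source) (hc : z.2 ∈ (chartAt E₂ c).source) :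
    dchart c z.2 (displacement b f z) = fderiv ℝ (chartAt E₂ c ∘ (chartAt E₂ b).symm)
      (chartAt E₂ b z.2) (chartAt E₂ b z.2 - chartAt E₂ b (f z.1)) := by
  have h := (hasFDerivAt_inCharts (f := (id : M₂ → M₂)) (a := b) (b := c) hb hc
    mdifferentiableAt_id).fderiv
  have h1 : dmap (E := E₂) (E' := E₂) (id : M₂ → M₂) z.2 = ContinuousLinearMap.id ℝ E₂ :=
    mfderiv_id
  rw [h1] at h
  exact (DFunLike.congr_fun h _).symm

variable [TopologicalSpace M₁] [ChartedSpace E₁ M₁] [IsManifold 𝓘(ℝ, E₁) ∞ M₁]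

/-- The zero set of the average of the displacements of local maps is locally the graph of a
local diffeomorphism. -/
theorem exists_local_graph [FiniteDimensional ℝ E₁] [FiniteDimensional ℝ E₂]
    {i₁ : J → M₁} {i₂ : J → M₂}
    {C : J → Set (E₁ →L[ℝ] E₂)} (hconv : ∀ m, Convex ℝ (C m))
    (hbij : ∀ m, ∀ Φ ∈ C m, Function.Bijective Φ)
    {f : J → M₁ → M₂} {U : J → Set M₁} (hU : ∀ m, IsOpen (U m))
    (hf : ∀ m, ContMDiffOn 𝓘(ℝ, E₁) 𝓘(ℝ, E₂) ∞ (f m) (U m))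
    (hfU : ∀ m, MapsTo (f m) (U m) (chartAt E₂ (i₂ m)).source)
    (hfi : ∀ m k, i₁ k ∈ U m → f m (i₁ k) = i₂ k ∧ dmap (f m) (i₁ k) ∈ C k)
    {ρ : J → M₁ × M₂ → ℝ}
    (hρ : ∀ z ∈ ⋃ m, U m ×ˢ (chartAt E₂ (i₂ m)).source, (∀ m, 0 ≤ ρ m z) ∧
      (∀ m, ContMDiffAt (𝓘(ℝ, E₁).prod 𝓘(ℝ, E₂)) 𝓘(ℝ, ℝ) ∞ (ρ m) z) ∧
      ∃ t : Finset J, (∀ m ∈ t, z ∈ U m ×ˢ (chartAt E₂ (i₂ m)).source) ∧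
        ∀ᶠ y in 𝓝 z, (∀ m ∉ t, ρ m y = 0) ∧ ∑ m ∈ t, ρ m y = 1)
    (m : J) (hm : i₁ m ∈ U m) :
    ∃ h : OpenPartialHomeomorph M₁ M₂, i₁ m ∈ h.source ∧ h (i₁ m) = i₂ m ∧
      ContMDiffOn 𝓘(ℝ, E₁) 𝓘(ℝ, E₂) ∞ h h.source ∧
      ContMDiffOn 𝓘(ℝ, E₂) 𝓘(ℝ, E₁) ∞ h.symm h.target ∧ dmap h (i₁ m) ∈ C m ∧
      ∀ᶠ z in 𝓝 (i₁ m, i₂ m),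
        ∑ᶠ k, ρ k z • displacement (E₂ := E₂) (i₂ k) (f k) z = 0 ↔ h z.1 = z.2 := by
  set x₀ := i₁ m with hx₀
  set y₀ := i₂ m with hy₀
  set a := chartAt E₁ x₀ with ha
  set c := chartAt E₂ y₀ with hc
  have hxa : x₀ ∈ a.source := mem_chart_source E₁ x₀
  have hyc : y₀ ∈ c.source := mem_chart_source E₂ y₀
  have hO : IsOpen (⋃ m, U m ×ˢ (chartAt E₂ (i₂ m)).source) :=
    isOpen_iUnion fun k => (hU k).prod (chartAt E₂ (i₂ k)).open_source
  have hz₀ : (x₀, y₀) ∈ ⋃ m, U m ×ˢ (chartAt E₂ (i₂ m)).source :=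
    mem_iUnion.2 ⟨m, hm, hyc⟩
  obtain ⟨hρ0, -, t, ht, hev⟩ := hρ _ hz₀
  -- the section in coordinates
  let r : J → E₁ × E₂ → ℝ := fun k w => ρ k (a.symm w.1, c.symm w.2)
  let g : J → E₂ → E₂ := fun k => chartAt E₂ (i₂ k) ∘ c.symm
  let g' : J → E₂ → E₂ := fun k => c ∘ (chartAt E₂ (i₂ k)).symm
  let κ : J → E₁ → E₂ := fun k => chartAt E₂ (i₂ k) ∘ f k ∘ a.symm
  let H : E₁ × E₂ → E₂ := fun w =>
    ∑ k ∈ t, r k w • fderiv ℝ (g' k) (g k w.2) (g k w.2 - κ k w.1)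
  have hr : ∀ k z, z ∈ (⋃ m, U m ×ˢ (chartAt E₂ (i₂ m)).source) → z.1 ∈ a.source →
      z.2 ∈ c.source → ContDiffAt ℝ ∞ (r k) (a z.1, c z.2) := by
    intro k z hz h1 h2
    rw [← contMDiffAt_iff_contDiffAt]
    have h3 : ContMDiffAt 𝓘(ℝ, E₁ × E₂) 𝓘(ℝ, E₁) ∞ (fun w : E₁ × E₂ => a.symm w.1)
        (a z.1, c z.2) :=
      ContMDiffAt.comp (I' := 𝓘(ℝ, E₁)) (g := a.symm) _
        (contMDiffAt_chartAt_symm (a.map_source h1)) contDiff_fst.contMDiff.contMDiffAt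
    have h4 : ContMDiffAt 𝓘(ℝ, E₁ × E₂) 𝓘(ℝ, E₂) ∞ (fun w : E₁ × E₂ => c.symm w.2)
        (a z.1, c z.2) :=
      ContMDiffAt.comp (I' := 𝓘(ℝ, E₂)) (g := c.symm) _
        (contMDiffAt_chartAt_symm (c.map_source h2)) contDiff_snd.contMDiff.contMDiffAt
    refine ContMDiffAt.comp (I' := 𝓘(ℝ, E₁).prod 𝓘(ℝ, E₂)) (g := ρ k) _ ?_ (h3.prodMk h4)
    rw [a.left_inv h1, c.left_inv h2]
    exact (hρ z hz).2.1 k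
  have hg : ∀ k y, y ∈ c.source → y ∈ (chartAt E₂ (i₂ k)).source →
      ContDiffAt ℝ ∞ (g k) (c y) := fun k y h1 h2 =>
    contDiffAt_inCharts (f := (id : M₂ → M₂)) h1 h2 contMDiffAt_id
  have hg' : ∀ k y, y ∈ c.source → y ∈ (chartAt E₂ (i₂ k)).source →
      ContDiffAt ℝ ∞ (g' k) (g k (c y)) := fun k y h1 h2 => by
    have := contDiffAt_inCharts (f := (id : M₂ → M₂)) (b := y₀) h2 h1 contMDiffAt_id
    simp only [g, Function.comp_apply, c.left_inv h1]
    exact this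
  have hκ : ∀ k x, x ∈ a.source → x ∈ U k → ContDiffAt ℝ ∞ (κ k) (a x) := fun k x h1 h2 =>
    contDiffAt_inCharts h1 (hfU k h2) ((hf k).contMDiffAt ((hU k).mem_nhds h2))
  -- good points
  have hgood : ∀ᶠ z in 𝓝 (x₀, y₀), z.1 ∈ a.source ∧ z.2 ∈ c.source ∧
      z ∈ (⋃ m, U m ×ˢ (chartAt E₂ (i₂ m)).source) ∧
      ∀ k ∈ t, z ∈ U k ×ˢ (chartAt E₂ (i₂ k)).source := by
    have h1 : ∀ᶠ z in 𝓝 (x₀, y₀), ∀ k ∈ t, z ∈ U k ×ˢ (chartAt E₂ (i₂ k)).source :=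
      (Filter.eventually_all_finset t).2 fun k hk =>
        ((hU k).prod (chartAt E₂ (i₂ k)).open_source).mem_nhds (ht k hk)
    filter_upwards [(continuousAt_fst (p := (x₀, y₀))).eventually (a.open_source.mem_nhds hxa),
      (continuousAt_snd (p := (x₀, y₀))).eventually (c.open_source.mem_nhds hyc),
      hO.mem_nhds hz₀, h1] with z h1 h2 h3 h4 using ⟨h1, h2, h3, h4⟩
  have hcoord : ContinuousAt (fun w : E₁ × E₂ => (a.symm w.1, c.symm w.2)) (a x₀, c y₀) :=
    (ContinuousAt.comp (f := Prod.fst) (x := (a x₀, c y₀))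
      (a.continuousAt_symm (a.map_source hxa)) continuousAt_fst).prodMk
      (ContinuousAt.comp (f := Prod.snd) (x := (a x₀, c y₀))
        (c.continuousAt_symm (c.map_source hyc)) continuousAt_snd)
  have hcoord₀ : (fun w : E₁ × E₂ => (a.symm w.1, c.symm w.2)) (a x₀, c y₀) = (x₀, y₀) :=
    Prod.ext (a.left_inv hxa) (c.left_inv hyc)
  have hHs : ∀ᶠ w in 𝓝 (a x₀, c y₀), ContDiffAt ℝ ∞ H w := by
    have h1 := hcoord.eventually (by rw [hcoord₀]; exact hgood)
    filter_upwards [h1, (continuousAt_fst (p := (a x₀, c y₀))).eventually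
      (a.open_target.mem_nhds (a.map_source hxa)),
      (continuousAt_snd (p := (a x₀, c y₀))).eventually
      (c.open_target.mem_nhds (c.map_source hyc))] with w hw hw1 hw2
    obtain ⟨h2, h3, h4, h5⟩ := hw
    have e1 := a.right_inv hw1
    have e2 := c.right_inv hw2
    refine ContDiffAt.sum fun k hk => contDiffAt_gluingTerm ?_ ?_ ?_ ?_
    · have := hr k _ h4 h2 h3
      rwa [e1, e2] at this
    · have := hg k _ h3 (h5 k hk).2
      rwa [e2] at this
    · have := hg' k _ h3 (h5 k hk).2
      rwa [e2] at this
    · have := hκ k _ h2 (h5 k hk).1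
      rwa [e1] at this
  -- H is the image of the averaged displacement under the differential of the chart at y₀, which is
  -- injective; the zero sets therefore correspond.
  have hHσ : ∀ᶠ z in 𝓝 (x₀, y₀), ∑ᶠ k, ρ k z • displacement (E₂ := E₂) (i₂ k) (f k) z = 0 ↔
      H (a z.1, c z.2) = 0 := by
    filter_upwards [hgood, hev] with z hz hz'
    obtain ⟨h1, h2, h3, h4⟩ := hz
    have h5 : ∑ᶠ k, ρ k z • displacement (E₂ := E₂) (i₂ k) (f k) z
        = ∑ k ∈ t, ρ k z • displacement (E₂ := E₂) (i₂ k) (f k) z := by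
      refine finsum_eq_sum_of_support_subset _ fun k hk => ?_
      by_contra h
      exact hk (by simp [hz'.1 k h])
    have h6 : H (a z.1, c z.2) = dchart y₀ z.2
        (∑ᶠ k, ρ k z • displacement (E₂ := E₂) (i₂ k) (f k) z) := by
      rw [h5, map_sum]
      refine Finset.sum_congr rfl fun k hk => ?_
      rw [map_smul, dchart_displacement _ (h4 k hk).2 h2]
      simp only [r, g, g', κ, Function.comp_apply, a.left_inv h1, c.left_inv h2]
      rfl
    rw [h6]
    constructor
    · intro h; rw [h, map_zero]
    · intro h
      rw [← dchartSymm_dchart h2 (∑ᶠ k, ρ k z • displacement (E₂ := E₂) (i₂ k) (f k) z), h, map_zero]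
  -- the differential of the section
  let Φ : E₁ →L[ℝ] E₂ := ∑ k ∈ t, ρ k (x₀, y₀) • dmap (f k) x₀
  -- The weights at the base point are nonnegative with sum 1, and all maps with an index in t have
  -- differential in the same convex set C m.
  have hΦ : Φ ∈ C m := (hconv m).sum_mem (fun k _ => hρ0 k) hev.self_of_nhds.2
    fun k hk => (hfi k m (ht k hk).1).2
  let A : E₁ →L[ℝ] E₂ := (dchart y₀ y₀).comp (Φ.comp (dchartSymm x₀ x₀))
  have hA : Function.Bijective A := by
    have h1 : Function.Bijective (dchart (E := E₂) y₀ y₀) :=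
      Function.bijective_iff_has_inverse.2
        ⟨dchartSymm y₀ y₀, dchartSymm_dchart hyc, dchart_dchartSymm hyc⟩
    have h2 : Function.Bijective (dchartSymm (E := E₁) x₀ x₀) :=
      Function.bijective_iff_has_inverse.2
        ⟨dchart x₀ x₀, dchart_dchartSymm hxa, dchartSymm_dchart hxa⟩
    exact h1.comp ((hbij m Φ hΦ).comp h2)
  have hr₀ : ∀ k, r k (a x₀, c y₀) = ρ k (x₀, y₀) := fun k => by
    simp only [r, a.left_inv hxa, c.left_inv hyc]
  have hfx : ∀ k ∈ t, f k x₀ = y₀ := fun k hk => (hfi k m (ht k hk).1).1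
  have hκg : ∀ k ∈ t, κ k (a x₀) = g k (c y₀) := fun k hk => by
    simp only [κ, g, Function.comp_apply, a.left_inv hxa, c.left_inv hyc, hfx k hk]
  have hgκ : ∀ k ∈ t, fderiv ℝ (g' k ∘ κ k) (a x₀)
      = (dchart y₀ y₀).comp ((dmap (f k) x₀).comp (dchartSymm x₀ x₀)) := by
    intro k hk
    have h1 : ContinuousAt a.symm (a x₀) := a.continuousAt_symm (a.map_source hxa)
    have h2 : g' k ∘ κ k =ᶠ[𝓝 (a x₀)] c ∘ f k ∘ a.symm := by
      have h3 := h1.eventually (p := fun x => x ∈ U k)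
        (by rw [a.left_inv hxa]; exact (hU k).mem_nhds (ht k hk).1)
      filter_upwards [h3] with w hw
      simp only [g', κ, Function.comp_apply, (chartAt E₂ (i₂ k)).left_inv (hfU k hw)]
    have h4 := (hasFDerivAt_inCharts (a := x₀) (b := y₀) (f := f k) hxa
      (by rw [hfx k hk]; exact hyc)
      (((hf k).contMDiffAt ((hU k).mem_nhds (ht k hk).1)).mdifferentiableAt (by simp))).fderiv
    rw [h2.fderiv_eq, h4, hfx k hk]
  have hH0 : H (a x₀, c y₀) = 0 := by
    refine Finset.sum_eq_zero fun k hk => ?_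
    simp only [hκg k hk, sub_self, map_zero, smul_zero]
  have hHd : HasFDerivAt H (ContinuousLinearMap.snd ℝ E₁ E₂
      - A.comp (ContinuousLinearMap.fst ℝ E₁ E₂)) (a x₀, c y₀) := by
    have h1 : HasFDerivAt H (∑ k ∈ t, r k (a x₀, c y₀) • (ContinuousLinearMap.snd ℝ E₁ E₂
        - (fderiv ℝ (g' k ∘ κ k) (a x₀)).comp (ContinuousLinearMap.fst ℝ E₁ E₂)))
        (a x₀, c y₀) := by
      refine HasFDerivAt.fun_sum fun k hk => ?_
      refine hasFDerivAt_gluingTerm (hr k _ hz₀ hxa hyc) (hg k _ hyc (ht k hk).2)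
        (hg' k _ hyc (ht k hk).2) (hκ k _ hxa (ht k hk).1) ?_ (hκg k hk)
      have h3 := (c.continuousAt_symm (c.map_source hyc)).eventually
        (p := fun y => y ∈ (chartAt E₂ (i₂ k)).source)
        (by rw [c.left_inv hyc]; exact (chartAt E₂ (i₂ k)).open_source.mem_nhds (ht k hk).2)
      filter_upwards [h3, c.open_target.mem_nhds (c.map_source hyc)] with w hw hw'
      simp only [g, g', Function.comp_apply, (chartAt E₂ (i₂ k)).left_inv hw, c.right_inv hw', id]
    refine h1.congr_fderiv ?_
    have h4 : ∀ v, A v = ∑ k ∈ t, r k (a x₀, c y₀) • fderiv ℝ (g' k ∘ κ k) (a x₀) v := by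
      intro v
      have h5 : ∀ k ∈ t, r k (a x₀, c y₀) • fderiv ℝ (g' k ∘ κ k) (a x₀) v
          = dchart y₀ y₀ (ρ k (x₀, y₀) • dmap (f k) x₀ (dchartSymm x₀ x₀ v)) := fun k hk => by
        rw [hgκ k hk, hr₀, map_smul]; rfl
      rw [Finset.sum_congr rfl h5, ← map_sum]
      simp [A, Φ]
    ext w
    · simp [h4]
    -- In the second variable every summand is a multiple of the identity, and the weights add up to
    -- 1.
    · have h6 : ∑ k ∈ t, r k (a x₀, c y₀) = 1 := by
        simp only [hr₀]; exact hev.self_of_nhds.2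
      simp [← Finset.sum_smul, h6]
  obtain ⟨h, hs, h0, h1, h2, hd, hz⟩ := exists_openPartialHomeomorph_graph hHs hH0 hA hHd
  dsimp only at hs h0 hd
  have hcy : c y₀ ∈ h.target := by rw [← h0]; exact h.map_source hs
  have hval : (a.trans (h.trans c.symm)) x₀ = y₀ := by
    simp only [OpenPartialHomeomorph.coe_trans, Function.comp_apply, h0, c.left_inv hyc]
  have hsrc : x₀ ∈ (a.trans (h.trans c.symm)).source := by
    refine ⟨hxa, hs, ?_⟩
    change h (a x₀) ∈ c.target
    rw [h0]
    exact c.map_source hyc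
  have hsm : ContMDiffOn 𝓘(ℝ, E₁) 𝓘(ℝ, E₂) ∞ (a.trans (h.trans c.symm))
      (a.trans (h.trans c.symm)).source := by
    have h3 : ContMDiffOn 𝓘(ℝ, E₁) 𝓘(ℝ, E₂) ∞ (c.symm ∘ h) (h.source ∩ h ⁻¹' c.target) :=
      ContMDiffOn.comp (I' := 𝓘(ℝ, E₂)) (contMDiffOn_chart_symm (n := ∞))
        (h1.contMDiffOn.mono inter_subset_left) (fun x hx => hx.2)
    have h4 : ContMDiffOn 𝓘(ℝ, E₁) 𝓘(ℝ, E₁) ∞ a a.source := contMDiffOn_chart (n := ∞)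
    exact h3.comp (h4.mono fun x hx => hx.1) (fun x hx => hx.2)
  refine ⟨a.trans (h.trans c.symm), hsrc, hval, hsm, ?_, ?_, ?_⟩
  · refine ContMDiffOn.comp (I' := 𝓘(ℝ, E₁)) (t := a.target) (contMDiffOn_chart_symm (n := ∞)) ?_
      (fun x hx => hx.2)
    exact ContMDiffOn.comp (I' := 𝓘(ℝ, E₂)) (t := h.target) h2.contMDiffOn
      ((contMDiffOn_chart (n := ∞)).mono fun x hx => hx.1.1) (fun x hx => hx.1.2)
  · have h3 := hasFDerivAt_inCharts (a := x₀) (b := y₀) (f := a.trans (h.trans c.symm)) hxa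
      (by rw [hval]; exact hyc)
      ((hsm.contMDiffAt ((a.trans (h.trans c.symm)).open_source.mem_nhds hsrc)).mdifferentiableAt
        (by simp))
    have h4 : c ∘ (a.trans (h.trans c.symm)) ∘ a.symm =ᶠ[𝓝 (a x₀)] h := by
      filter_upwards [a.open_target.mem_nhds (a.map_source hxa),
        (h.continuousAt hs).preimage_mem_nhds
          (by rw [h0]; exact c.open_target.mem_nhds (c.map_source hyc))] with w hw hw'
      simp only [OpenPartialHomeomorph.coe_trans, Function.comp_apply, a.right_inv hw]
      exact c.right_inv hw'
    have h5 := (h3.congr_of_eventuallyEq h4.symm).unique hd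
    rw [hval] at h5
    have h6 : dmap (a.trans (h.trans c.symm)) x₀ = Φ := by
      ext v
      have h7 := DFunLike.congr_fun h5 (dchart x₀ x₀ v)
      simp only [A, ContinuousLinearMap.comp_apply, dchartSymm_dchart hxa] at h7
      have h8 := congrArg (dchartSymm y₀ y₀) h7
      rwa [dchartSymm_dchart hyc, dchartSymm_dchart hyc] at h8
    rw [h6]
    exact hΦ
  · have h3 : ContinuousAt (fun z : M₁ × M₂ => (a z.1, c z.2)) (x₀, y₀) :=
      (ContinuousAt.comp (f := Prod.fst) (x := (x₀, y₀)) (a.continuousAt hxa) continuousAt_fst).prodMk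
        (ContinuousAt.comp (f := Prod.snd) (x := (x₀, y₀)) (c.continuousAt hyc) continuousAt_snd)
    filter_upwards [hHσ, h3.eventually hz, hgood,
      (continuousAt_fst (p := (x₀, y₀))).eventually
        ((a.trans (h.trans c.symm)).open_source.mem_nhds hsrc)] with z hz1 hz2 hz3 hz4
    rw [hz1, hz2]
    constructor
    · intro h5
      simp only [OpenPartialHomeomorph.coe_trans, Function.comp_apply, h5, c.left_inv hz3.2.1]
    · intro h5
      rw [← h5]
      exact (c.right_inv hz4.2.2).symm

/-- Local maps which agree on an embedded `J`, and whose differentials there lie in given convex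
sets, can be replaced by one diffeomorphism between neighbourhoods of `J`. -/
theorem exists_openPartialHomeomorph_of_local [FiniteDimensional ℝ E₁] [FiniteDimensional ℝ E₂]
    [T2Space M₁] [SecondCountableTopology M₁] [T2Space M₂] [SecondCountableTopology M₂]
    [TopologicalSpace J] [Nonempty J] {i₁ : J → M₁} {i₂ : J → M₂}
    (hi₁ : Topology.IsInducing i₁) (hi₂ : Topology.IsInducing i₂)
    {C : J → Set (E₁ →L[ℝ] E₂)} (hconv : ∀ m, Convex ℝ (C m))
    (hbij : ∀ m, ∀ Φ ∈ C m, Function.Bijective Φ)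
    (hloc : ∀ m, ∃ (f : M₁ → M₂) (U : Set M₁), IsOpen U ∧ i₁ m ∈ U ∧
      ContMDiffOn 𝓘(ℝ, E₁) 𝓘(ℝ, E₂) ∞ f U ∧
      ∀ k, i₁ k ∈ U → f (i₁ k) = i₂ k ∧ dmap f (i₁ k) ∈ C k) :
    ∃ ψ : OpenPartialHomeomorph M₁ M₂, range i₁ ⊆ ψ.source ∧ range i₂ ⊆ ψ.target ∧
      ContMDiffOn 𝓘(ℝ, E₁) 𝓘(ℝ, E₂) ∞ ψ ψ.source ∧
      ContMDiffOn 𝓘(ℝ, E₂) 𝓘(ℝ, E₁) ∞ ψ.symm ψ.target ∧ (∀ m, ψ (i₁ m) = i₂ m) ∧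
      ∀ m, dmap ψ (i₁ m) ∈ C m := by
  choose f U hUo hiU hf hfi using hloc
  -- The domains shrink so that the chart of M₂ at i₂ m can be applied to the values of f m.
  let V : J → Set M₁ := fun m => U m ∩ f m ⁻¹' (chartAt E₂ (i₂ m)).source
  have hV : ∀ m, IsOpen (V m) := fun m =>
    (hf m).continuousOn.isOpen_inter_preimage (hUo m) (chartAt E₂ (i₂ m)).open_source
  have hiV : ∀ m, i₁ m ∈ V m := fun m => ⟨hiU m, by
    change f m (i₁ m) ∈ (chartAt E₂ (i₂ m)).source
    rw [(hfi m m (hiU m)).1]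
    exact mem_chart_source E₂ (i₂ m)⟩
  -- The partition is taken on the product M₁ × M₂ because a displacement depends on a pair of
  -- points.
  obtain ⟨ρ, hρ⟩ := exists_partition_iUnion (I := 𝓘(ℝ, E₁).prod 𝓘(ℝ, E₂))
    (fun m => V m ×ˢ (chartAt E₂ (i₂ m)).source)
    (fun m => (hV m).prod (chartAt E₂ (i₂ m)).open_source)
  choose h hs hm h1 h2 hd hD using fun m => exists_local_graph (E₂ := E₂) (i₁ := i₁) (i₂ := i₂) hconv hbij hV
    (fun m => (hf m).mono inter_subset_left) (fun m x hx => hx.2)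
    (fun m k hk => hfi m k hk.1) hρ m (hiV m)
  obtain ⟨ψ, hψ₁, hψ₂, hψ₃, hψ₄, hψ₅, hψ₆⟩ := exists_openPartialHomeomorph_of_local_graph hi₁ hi₂
    {z | ∑ᶠ k, ρ k z • displacement (E₂ := E₂) (i₂ k) (f k) z = 0} h hs hm h1 h2 hD
  refine ⟨ψ, hψ₁, hψ₂, hψ₃, hψ₄, hψ₅, fun m => ?_⟩
  have h3 : dmap (E := E₁) (E' := E₂) ψ (i₁ m) = dmap (h m) (i₁ m) := (hψ₆ m).mfderiv_eq
  rw [h3]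
  exact hd m

end Averaging

/-! ### From the structures on a manifold to linear algebra -/

section Bilinear

variable {E : Type*} [NormedAddCommGroup E] [NormedSpace ℝ E]

/-- Alternating `1`-forms as linear functionals. -/
def toLinear : (E [⋀^Fin 1]→L[ℝ] ℝ) →L[ℝ] E →L[ℝ] ℝ :=
  ((ContinuousAlternatingMap.ofSubsingletonLIE (𝕜 := ℝ) (E := E) (F := ℝ)
    (0 : Fin 1)).symm.toContinuousLinearEquiv : (E [⋀^Fin 1]→L[ℝ] ℝ) →L[ℝ] E →L[ℝ] ℝ)

/-- Alternating `2`-forms as bilinear forms. -/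
def toBilin : (E [⋀^Fin 2]→L[ℝ] ℝ) →L[ℝ] E →L[ℝ] E →L[ℝ] ℝ :=
  (ContinuousLinearMap.compL ℝ E (E [⋀^Fin 1]→L[ℝ] ℝ) (E →L[ℝ] ℝ) toLinear).comp
    (ContinuousAlternatingMap.curryLeftLI (𝕜 := ℝ) (E := E) (F := ℝ)
      (n := 1)).toContinuousLinearMap

theorem toBilin_apply (α : E [⋀^Fin 2]→L[ℝ] ℝ) (u v : E) : toBilin α u v = α ![u, v] := by
  change α (Matrix.vecCons u fun _ => v) = _
  congr 1
  funext i
  fin_cases i <;> rfl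

theorem toBilin_skew (α : E [⋀^Fin 2]→L[ℝ] ℝ) (u v : E) : toBilin α u v = -toBilin α v u := by
  rw [toBilin_apply, toBilin_apply]
  have h := α.toAlternatingMap.map_swap ![v, u] (i := 0) (j := 1) (by simp)
  have h1 : (![v, u] ∘ Equiv.swap (0 : Fin 2) 1 : Fin 2 → E) = ![u, v] := by
    funext i
    fin_cases i <;> rfl
  rw [h1] at h
  exact h

/-- The summand of `wedgeTop` for the identity permutation. -/
def wedgeProd (n : ℕ) (τ : E →L[ℝ] ℝ) (Ω : E →L[ℝ] E →L[ℝ] ℝ) (v : Fin (2 * n + 1) → E) : ℝ :=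
  τ (v 0) * ∏ i : Fin n, Ω (v ⟨2 * (i : ℕ) + 1, by omega⟩) (v ⟨2 * (i : ℕ) + 2, by omega⟩)

/-- Each slot occurs in exactly one factor: slot 0 in τ, slots 2i + 1 and 2i + 2 in the i-th copy of
Ω. The product is therefore linear in each slot, and a vector annihilated by τ and Ω makes it
vanish. -/
theorem wedgeProd_update (n : ℕ) (τ : E →L[ℝ] ℝ) (Ω : E →L[ℝ] E →L[ℝ] ℝ)
    (v : Fin (2 * n + 1) → E) (j : Fin (2 * n + 1)) :
    ∃ l : E →ₗ[ℝ] ℝ, (∀ x, wedgeProd n τ Ω (Function.update v j x) = l x) ∧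
      ∀ u, τ u = 0 → (∀ w, Ω u w = 0) → (∀ w, Ω w u = 0) → l u = 0 := by
  by_cases hj : j = 0
  · refine ⟨(∏ i : Fin n, Ω (v ⟨2 * (i : ℕ) + 1, by omega⟩) (v ⟨2 * (i : ℕ) + 2, by omega⟩)) •
      τ.toLinearMap, fun x => ?_, fun u hu _ _ => by simp [hu]⟩
    subst hj
    simp only [wedgeProd, Function.update_self, LinearMap.smul_apply, smul_eq_mul,
      ContinuousLinearMap.coe_coe]
    rw [mul_comm]
    congr 1
  · have hj' : (j : ℕ) ≠ 0 := fun h => hj (Fin.ext h)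
    let i₀ : Fin n := ⟨((j : ℕ) - 1) / 2, by omega⟩
    let c : ℝ := τ (v 0) * ∏ i ∈ Finset.univ.erase i₀,
      Ω (v ⟨2 * (i : ℕ) + 1, by omega⟩) (v ⟨2 * (i : ℕ) + 2, by omega⟩)
    have hc : ∀ x, wedgeProd n τ Ω (Function.update v j x)
        = c * Ω (Function.update v j x ⟨2 * (i₀ : ℕ) + 1, by omega⟩)
          (Function.update v j x ⟨2 * (i₀ : ℕ) + 2, by omega⟩) := by
      intro x
      have h1 : ∏ i ∈ Finset.univ.erase i₀, Ω (Function.update v j x ⟨2 * (i : ℕ) + 1, by omega⟩)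
          (Function.update v j x ⟨2 * (i : ℕ) + 2, by omega⟩) = ∏ i ∈ Finset.univ.erase i₀,
          Ω (v ⟨2 * (i : ℕ) + 1, by omega⟩) (v ⟨2 * (i : ℕ) + 2, by omega⟩) := by
        refine Finset.prod_congr rfl fun i hi => ?_
        have h2 : (i : ℕ) ≠ ((j : ℕ) - 1) / 2 := fun h =>
          (Finset.mem_erase.1 hi).1 (Fin.ext h)
        rw [Function.update_of_ne (by simp only [ne_eq, Fin.ext_iff]; omega),
          Function.update_of_ne (by simp only [ne_eq, Fin.ext_iff]; omega)]
      simp only [wedgeProd]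
      rw [← Finset.mul_prod_erase _ _ (Finset.mem_univ i₀), h1, Function.update_of_ne (Ne.symm hj)]
      ring
    rcases Nat.even_or_odd' ((j : ℕ) - 1) with ⟨k, hk | hk⟩
    · have e1 : (⟨2 * (i₀ : ℕ) + 1, by omega⟩ : Fin (2 * n + 1)) = j := by
        simp only [Fin.ext_iff, i₀]; omega
      have e2 : (⟨2 * (i₀ : ℕ) + 2, by omega⟩ : Fin (2 * n + 1)) ≠ j := by
        simp only [ne_eq, Fin.ext_iff, i₀]; omega
      refine ⟨c • (Ω.flip (v ⟨2 * (i₀ : ℕ) + 2, by omega⟩)).toLinearMap, fun x => ?_,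
        fun u _ hu _ => by simp [hu]⟩
      rw [hc, e1, Function.update_self, Function.update_of_ne e2]
      simp
    · have e1 : (⟨2 * (i₀ : ℕ) + 1, by omega⟩ : Fin (2 * n + 1)) ≠ j := by
        simp only [ne_eq, Fin.ext_iff, i₀]; omega
      have e2 : (⟨2 * (i₀ : ℕ) + 2, by omega⟩ : Fin (2 * n + 1)) = j := by
        simp only [Fin.ext_iff, i₀]; omega
      refine ⟨c • (Ω (v ⟨2 * (i₀ : ℕ) + 1, by omega⟩)).toLinearMap, fun x => ?_,
        fun u _ _ hu => by simp [hu]⟩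
      rw [hc, e2, Function.update_self, Function.update_of_ne e1]
      simp

/-- `wedgeProd` as a multilinear map. -/
def wedgeProdMultilinear (n : ℕ) (τ : E →L[ℝ] ℝ) (Ω : E →L[ℝ] E →L[ℝ] ℝ) :
    MultilinearMap ℝ (fun _ : Fin (2 * n + 1) => E) ℝ where
  toFun := wedgeProd n τ Ω
  map_update_add' {inst} v j x y := by
    obtain rfl : inst = instDecidableEqFin _ := Subsingleton.elim _ _
    obtain ⟨l, hl, -⟩ := wedgeProd_update n τ Ω v j
    rw [hl, hl, hl, map_add]
  map_update_smul' {inst} v j c x := by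
    obtain rfl : inst = instDecidableEqFin _ := Subsingleton.elim _ _
    obtain ⟨l, hl, -⟩ := wedgeProd_update n τ Ω v j
    rw [hl, hl, map_smul]

/-- If `τ ∧ Ω^n` does not vanish, then no nonzero vector is annihilated by `τ` and `Ω`. -/
theorem eq_zero_of_wedge_ne_zero [FiniteDimensional ℝ E] {n : ℕ}
    (hE : Module.finrank ℝ E = 2 * n + 1) (τ : E →L[ℝ] ℝ) (Ω : E →L[ℝ] E →L[ℝ] ℝ)
    (hΩ : ∀ u v, Ω u v = -Ω v u)
    (h : ∃ v : Fin (2 * n + 1) → E, ∑ σ : Equiv.Perm (Fin (2 * n + 1)),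
      ((Equiv.Perm.sign σ : ℤ) : ℝ) * wedgeProd n τ Ω (fun i => v (σ i)) ≠ 0)
    {u : E} (h1 : τ u = 0) (h2 : ∀ w, Ω u w = 0) : u = 0 := by
  classical
  by_contra hu
  let Λ : E [⋀^Fin (2 * n + 1)]→ₗ[ℝ] ℝ :=
    MultilinearMap.alternatization (wedgeProdMultilinear n τ Ω)
  have hΛ : ∀ v, Λ v = ∑ σ : Equiv.Perm (Fin (2 * n + 1)),
      ((Equiv.Perm.sign σ : ℤ) : ℝ) * wedgeProd n τ Ω (fun i => v (σ i)) := by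
    intro v
    simp only [Λ, MultilinearMap.alternatization_apply]
    refine Finset.sum_congr rfl fun σ _ => ?_
    rw [Units.smul_def, zsmul_eq_mul]
    rfl
  obtain ⟨v, hv⟩ := h
  have hΛ0 : Λ ≠ 0 := by
    intro h0
    rw [← hΛ, h0] at hv
    exact hv rfl
  -- A nonzero form of top degree is nonzero on every basis, in particular on one that contains u.
  have hli : LinearIndepOn ℝ id ({u} : Set E) := by
    simpa using hu
  let b := Module.Basis.extend hli
  have : Fintype (hli.extend (subset_univ _)) := FiniteDimensional.fintypeBasisIndex b
  let e := b.reindex (Fintype.equivFinOfCardEq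
    ((Module.finrank_eq_card_basis b).symm.trans hE))
  refine (Λ.map_basis_ne_zero_iff e).2 hΛ0 ?_
  obtain ⟨k, hk⟩ : ∃ k, e k = u := by
    have hmem : u ∈ hli.extend (subset_univ _) := hli.subset_extend _ rfl
    refine ⟨Fintype.equivFinOfCardEq ((Module.finrank_eq_card_basis b).symm.trans hE) ⟨u, hmem⟩, ?_⟩
    simp [e, b]
  rw [hΛ]
  -- In the term of σ the vector u = e k sits in slot σ⁻¹ k, so every summand vanishes.
  refine Finset.sum_eq_zero fun σ _ => ?_
  obtain ⟨l, hl, hl0⟩ := wedgeProd_update n τ Ω (fun i => e (σ i)) (σ.symm k)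
  have h3 : wedgeProd n τ Ω (fun i => e (σ i)) = 0 := by
    rw [← hl0 u h1 h2 fun w => by rw [hΩ, h2, neg_zero], ← hl]
    congr 1
    funext i
    by_cases hi : i = σ.symm k
    · subst hi; simp [hk]
    · rw [Function.update_of_ne hi]
  rw [h3, mul_zero]

end Bilinear

/-! ### From the tensor fields to the pointwise axioms -/

section Regularization

/-- The differential of an immersion is injective. -/
theorem injective_dmap_of_isImmersionAt {E E' M M' : Type*} [NormedAddCommGroup E]
    [NormedSpace ℝ E] [TopologicalSpace M] [ChartedSpace E M] [IsManifold 𝓘(ℝ, E) ∞ M]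
    [NormedAddCommGroup E'] [NormedSpace ℝ E'] [TopologicalSpace M'] [ChartedSpace E' M']
    [IsManifold 𝓘(ℝ, E') ∞ M'] {f : M → M'} {x : M}
    (h : Manifold.IsImmersionAt 𝓘(ℝ, E) 𝓘(ℝ, E') ∞ f x) :
    Function.Injective (dmap (E := E) (E' := E') f x) := by
  have hφ : MDifferentiableAt 𝓘(ℝ, E) 𝓘(ℝ, E) h.domChart x :=
    ((contMDiffOn_of_mem_maximalAtlas h.domChart_mem_maximalAtlas).contMDiffAt
      (h.domChart.open_source.mem_nhds h.mem_domChart_source)).mdifferentiableAt (by simp)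
  have hφs : h.domChart.MDifferentiable 𝓘(ℝ, E) 𝓘(ℝ, E) :=
    ⟨(contMDiffOn_of_mem_maximalAtlas h.domChart_mem_maximalAtlas).mdifferentiableOn (by simp),
      (contMDiffOn_symm_of_mem_maximalAtlas h.domChart_mem_maximalAtlas).mdifferentiableOn
        (by simp)⟩
  have hψ : MDifferentiableAt 𝓘(ℝ, E') 𝓘(ℝ, E') h.codChart (f x) :=
    ((contMDiffOn_of_mem_maximalAtlas h.codChart_mem_maximalAtlas).contMDiffAt
      (h.codChart.open_source.mem_nhds h.mem_codChart_source)).mdifferentiableAt (by simp)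
  have hf : MDifferentiableAt 𝓘(ℝ, E) 𝓘(ℝ, E') f x := h.contMDiffAt.mdifferentiableAt (by simp)
  -- In charts adapted to the immersion, f is this injective linear map u ↦ (u, 0).
  let l : E →L[ℝ] E' := (h.equiv : (E × h.complement) →L[ℝ] E').comp
    (ContinuousLinearMap.inl ℝ E h.complement)
  have heq : h.codChart ∘ f =ᶠ[𝓝 x] l ∘ h.domChart := by
    filter_upwards [h.domChart.open_source.mem_nhds h.mem_domChart_source] with y hy
    have h1 := h.writtenInCharts (show h.domChart y ∈ (h.domChart.extend 𝓘(ℝ, E)).target by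
      simpa using h.domChart.map_source hy)
    simpa [h.domChart.left_inv hy, l] using h1
  have h2 := (hψ.hasMFDerivAt.comp x hf.hasMFDerivAt).congr_of_eventuallyEq heq.symm
  have h3 := (l.hasMFDerivAt (x := h.domChart x)).comp x hφ.hasMFDerivAt
  have h4 := hasMFDerivAt_unique h2 h3
  intro u v huv
  have h5 : l (mfderiv 𝓘(ℝ, E) 𝓘(ℝ, E) h.domChart x u)
      = l (mfderiv 𝓘(ℝ, E) 𝓘(ℝ, E) h.domChart x v) := by
    have h6 := DFunLike.congr_fun h4 u
    have h7 := DFunLike.congr_fun h4 v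
    refine h6.symm.trans (Eq.trans ?_ h7)
    exact congrArg (mfderiv 𝓘(ℝ, E') 𝓘(ℝ, E') h.codChart (f x)) huv
  have h8 : mfderiv 𝓘(ℝ, E) 𝓘(ℝ, E) h.domChart x u
      = mfderiv 𝓘(ℝ, E) 𝓘(ℝ, E) h.domChart x v :=
    (Prod.ext_iff.1 (h.equiv.injective h5)).1
  exact hφs.mfderiv_injective h.mem_domChart_source h8

open JetBundle in
/-- The kernel of the vertical endomorphism in the vertical directions is its image. -/
theorem exists_vertEnd_eq {EQ : Type*} [NormedAddCommGroup EQ] [NormedSpace ℝ EQ]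
    {Q : Type*} [TopologicalSpace Q] [ChartedSpace EQ Q] [IsManifold 𝓘(ℝ, EQ) ∞ Q]
    {F : Type*} [NormedAddCommGroup F] [NormedSpace ℝ F]
    {N : Type*} [TopologicalSpace N] [ChartedSpace F N] [IsManifold 𝓘(ℝ, F) ∞ N]
    {π : ConfigBundle EQ Q F N} (m : JetBundle π) (u : TangentSpace 𝓘(ℝ, ℝ × F × F) m)
    (h1 : vertEnd π m u = 0) (h2 : dt π m u = 0) : ∃ v, vertEnd π m v = u := by
  obtain ⟨A, hA⟩ := exists_fibredChart π m.toQ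
  have hat := jetChart_mem_maximalAtlas A m
  have hmd : (jetChart A m).MDifferentiable 𝓘(ℝ, ℝ × F × F) 𝓘(ℝ, ℝ × F × F) :=
    ⟨(contMDiffOn_of_mem_maximalAtlas hat).mdifferentiableOn (by simp),
      (contMDiffOn_symm_of_mem_maximalAtlas hat).mdifferentiableOn (by simp)⟩
  have hb : Function.Bijective (dcoord A m) := hmd.mfderiv_bijective (x := m) hA
  have h3 : (dcoord A m u).1 = 0 := by
    rw [← h2, ← dproj_dtoQ, ← A.dchart_fst hA, dchart_dtoQ A hA]
  have h4 := dcoord_vertEnd A hA u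
  rw [h1, map_zero, h3, zero_smul, sub_zero] at h4
  have h5 : (dcoord A m u).2.1 = 0 := ((Prod.ext_iff.1 (Prod.ext_iff.1 h4).2).2).symm
  -- In natural coordinates u is (0, 0, w), and `vertEnd` sends (0, w, 0) to it.
  obtain ⟨v, hv⟩ := hb.2 (0, (dcoord A m u).2.2, 0)
  refine ⟨v, hb.1 ?_⟩
  rw [dcoord_vertEnd A hA, hv]
  refine Prod.ext h3.symm (Prod.ext h5.symm ?_)
  simp

section Pointwise

variable {E M' : Type*} [NormedAddCommGroup E] [NormedSpace ℝ E] [TopologicalSpace M']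
  [ChartedSpace E M']

/-- The linear functional given by a one-form at a point. -/
def oneAt (τ : OneForm E M') (p : M') : E →L[ℝ] ℝ := τ p

/-- The bilinear form given by a two-form at a point. -/
def twoAt (Ω : DiffForm E M' 2) (p : M') : E →L[ℝ] E →L[ℝ] ℝ :=
  toBilin (Ω p : E [⋀^Fin 2]→L[ℝ] ℝ)

/-- The linear endomorphism given by a `(1,1)`-tensor field at a point. -/
def endAt (S : EndField E M') (p : M') : E →L[ℝ] E := S p

theorem twoAt_apply (Ω : DiffForm E M' 2) (p : M') (u v : E) :
    twoAt Ω p u v = (Ω p : E [⋀^Fin 2]→L[ℝ] ℝ) ![u, v] := toBilin_apply _ u v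

theorem IsCosymplectic.eq_zero [FiniteDimensional ℝ E] {Ω : DiffForm E M' 2} {τ : OneForm E M'}
    (h : IsCosymplectic Ω τ) (p : M') {u : E} (h1 : oneAt τ p u = 0)
    (h2 : ∀ w, twoAt Ω p u w = 0) : u = 0 := by
  obtain ⟨n, hn, hw⟩ := h.nondegenerate
  obtain ⟨v, hv⟩ := hw p
  have hsum : wedgeTop n τ Ω p v = ((2 : ℝ) ^ n)⁻¹ * ∑ σ : Equiv.Perm (Fin (2 * n + 1)),
      ((Equiv.Perm.sign σ : ℤ) : ℝ) * wedgeProd n (oneAt τ p) (twoAt Ω p) (fun i => v (σ i)) := by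
    refine congrArg (fun x => ((2 : ℝ) ^ n)⁻¹ * x) (Finset.sum_congr rfl fun σ _ => ?_)
    refine congrArg (fun x => ((Equiv.Perm.sign σ : ℤ) : ℝ) * x) ?_
    refine congrArg (fun x => τ p (v (σ 0)) * x) (Finset.prod_congr rfl fun i _ => ?_)
    exact (twoAt_apply Ω p _ _).symm
  refine eq_zero_of_wedge_ne_zero hn (oneAt τ p) (twoAt Ω p) (toBilin_skew _) ⟨v, fun h0 => hv ?_⟩
    h1 h2
  exact hsum.trans ((congrArg (fun x => ((2 : ℝ) ^ n)⁻¹ * x) h0).trans (mul_zero _))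

end Pointwise

variable {X M E M' : Type*} [NormedAddCommGroup X] [NormedSpace ℝ X]
  [TopologicalSpace M] [ChartedSpace X M] [IsManifold 𝓘(ℝ, X) ∞ M]
  [NormedAddCommGroup E] [NormedSpace ℝ E] [FiniteDimensional ℝ E]
  [TopologicalSpace M'] [ChartedSpace E M'] [IsManifold 𝓘(ℝ, E) ∞ M']

/-- The substantial axiom is ker S ∩ ker τ ⊆ im S, a dimension count: rank S = d in dimension 2d + 1
gives dim ker S = d + 1, and the Reeb vector lies in ker S but not in ker τ. The intersection thus
has dimension at most d, and it contains im S. -/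
theorem isRegularizationAt_of_isCosymplecticRegularization {ω₀ : DiffForm X M 2} {τ₀ : OneForm X M}
    {S₀ : EndField X M} {Ω : DiffForm E M' 2} {τ : OneForm E M'} {i : M → M'} {S : EndField E M'}
    (h : IsCosymplecticRegularization ω₀ τ₀ Ω τ i) (hS : IsJetStructure S τ)
    (hΩ : IsLagrangianFor S Ω) (hi : PreservesTensor S₀ S i)
    (hS₀ : ∀ m u, S₀ m u = 0 → τ₀ m u = 0 → ∃ v, S₀ m v = u) (m : M)
    {R : TangentSpace 𝓘(ℝ, X) m}
    (hR : IsReebVector Ω τ (i m) (mfderiv 𝓘(ℝ, X) 𝓘(ℝ, E) i m R)) :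
    IsRegularizationAt (twoAt Ω (i m)) (oneAt τ (i m)) (endAt S (i m)) (dmap (E := X) (E' := E) i m)
      (fun u v => twoAt ω₀ m u v) (fun u => oneAt τ₀ m u) (fun u => endAt S₀ m u) R := by
  have hskew : ∀ u v : E, twoAt Ω (i m) u v = -twoAt Ω (i m) v u := toBilin_skew (E := E) _
  have hlag : ∀ u v, twoAt Ω (i m) (endAt S (i m) u) v = -twoAt Ω (i m) u (endAt S (i m) v) := by
    intro u v
    rw [twoAt_apply, twoAt_apply]
    exact eq_neg_of_add_eq_zero_left (hΩ (i m) u v)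
  have hreeb : ∀ w, twoAt Ω (i m) (dmap (E := X) (E' := E) i m R) w = 0 := fun w => by
    rw [twoAt_apply]; exact hR.1 w
  have hker : ∀ v, endAt S (i m) v = 0 → oneAt τ (i m) v = 0 → ∃ u, endAt S (i m) u = v := by
    obtain ⟨d, hd, hrank, -⟩ := hS.rank_integrable
    let s : E →ₗ[ℝ] E := (endAt S (i m)).toLinearMap
    let t : E →ₗ[ℝ] ℝ := (oneAt τ (i m)).toLinearMap
    have hr : Module.finrank ℝ (LinearMap.range s) = d := hrank (i m)
    have hk := s.finrank_range_add_finrank_ker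
    have hle : LinearMap.range s ≤ LinearMap.ker s ⊓ LinearMap.ker t := by
      rintro _ ⟨v, rfl⟩
      exact ⟨hS.sq_zero (i m) v, hS.form_image (i m) v⟩
    have hRs : s (dmap (E := X) (E' := E) i m R) = 0 :=
      h.cosymplectic.eq_zero (i m) (hS.form_image (i m) _) fun w => by
        change twoAt Ω (i m) (endAt S (i m) _) w = 0
        rw [hlag, hreeb, neg_zero]
    have hlt : LinearMap.ker s ⊓ LinearMap.ker t < LinearMap.ker s := by
      refine lt_of_le_of_ne inf_le_left fun heq => ?_
      have h1 : dmap (E := X) (E' := E) i m R ∈ LinearMap.ker s ⊓ LinearMap.ker t := by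
        rw [heq]; exact hRs
      have h2 : t (dmap (E := X) (E' := E) i m R) = 1 := hR.2
      rw [LinearMap.mem_ker.1 h1.2] at h2
      exact zero_ne_one h2
    have hlt' := Submodule.finrank_lt_finrank_of_lt hlt
    have heq := Submodule.eq_of_le_of_finrank_le hle (by omega)
    intro v h1 h2
    have : v ∈ LinearMap.range s := by rw [heq]; exact ⟨h1, h2⟩
    exact this
  refine ⟨hskew, fun v => h.cosymplectic.eq_zero (i m), hlag, hS.form_image (i m),
    hS.sq_zero (i m), hker, hreeb, hR.2,
    injective_dmap_of_isImmersionAt (h.embedding.isImmersion.isImmersionAt m), hi m, ?_,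
    h.pullback_one m, ?_, hS₀ m⟩
  · intro u v
    rw [twoAt_apply, twoAt_apply]
    exact h.pullback_two m u v
  · intro v h1 h2
    refine h.coisotropic m v h1 fun u => ?_
    rw [← h2 u, twoAt_apply]
    rfl

end Regularization

/-! ### Regularizations in charts -/

section Intertwining

variable {X X' E E' E₁ E₂ E₁' E₂' : Type*} [NormedAddCommGroup X] [NormedSpace ℝ X]
  [NormedAddCommGroup X'] [NormedSpace ℝ X']
  [NormedAddCommGroup E] [NormedSpace ℝ E] [NormedAddCommGroup E'] [NormedSpace ℝ E']
  [NormedAddCommGroup E₁] [NormedSpace ℝ E₁] [NormedAddCommGroup E₂] [NormedSpace ℝ E₂]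
  [NormedAddCommGroup E₁'] [NormedSpace ℝ E₁'] [NormedAddCommGroup E₂'] [NormedSpace ℝ E₂']

/-- The linear maps `A : E → E'` and `B : X → X'` intertwine the structures on `E` and `E'`. -/
structure Intertwines (Ω : E →L[ℝ] E →L[ℝ] ℝ) (τ : E →L[ℝ] ℝ) (S : E →L[ℝ] E) (j : X →L[ℝ] E)
    (ω' : E' →L[ℝ] E' →L[ℝ] ℝ) (τ' : E' →L[ℝ] ℝ) (S' : E' →L[ℝ] E') (j' : X' →L[ℝ] E')
    (A : E →L[ℝ] E') (B : X →L[ℝ] X') : Prop where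
  map_two : ∀ u v, ω' (A u) (A v) = Ω u v
  map_one : ∀ v, τ' (A v) = τ v
  map_tensor : ∀ v, S' (A v) = A (S v)
  map_incl : ∀ u, A (j u) = j' (B u)

variable {ω₁ : E₁ →L[ℝ] E₁ →L[ℝ] ℝ} {τ₁ : E₁ →L[ℝ] ℝ} {S₁ : E₁ →L[ℝ] E₁} {j₁ : X →L[ℝ] E₁}
  {ω₂ : E₂ →L[ℝ] E₂ →L[ℝ] ℝ} {τ₂ : E₂ →L[ℝ] ℝ} {S₂ : E₂ →L[ℝ] E₂} {j₂ : X →L[ℝ] E₂}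
  {ω₁' : E₁' →L[ℝ] E₁' →L[ℝ] ℝ} {τ₁' : E₁' →L[ℝ] ℝ} {S₁' : E₁' →L[ℝ] E₁'} {j₁' : X' →L[ℝ] E₁'}
  {ω₂' : E₂' →L[ℝ] E₂' →L[ℝ] ℝ} {τ₂' : E₂' →L[ℝ] ℝ} {S₂' : E₂' →L[ℝ] E₂'} {j₂' : X' →L[ℝ] E₂'}
  {Φ : E₁ →L[ℝ] E₂} {A₁ : E₁ →L[ℝ] E₁'} {A₁' : E₁' →L[ℝ] E₁} {A₂ : E₂ →L[ℝ] E₂'}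
  {B : X →L[ℝ] X'} {B' : X' →L[ℝ] X}

/-- Transport of admissible maps. -/
theorem IsAdmissible.conj (h : IsAdmissible ω₁ τ₁ S₁ j₁ ω₂ τ₂ S₂ j₂ Φ)
    (h₁ : Intertwines ω₁' τ₁' S₁' j₁' ω₁ τ₁ S₁ j₁ A₁' B')
    (h₂ : Intertwines ω₂ τ₂ S₂ j₂ ω₂' τ₂' S₂' j₂' A₂ B) (hB : ∀ v, B (B' v) = v) :
    IsAdmissible ω₁' τ₁' S₁' j₁' ω₂' τ₂' S₂' j₂' (A₂.comp (Φ.comp A₁')) := by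
  refine ⟨fun u => ?_, fun v => ?_, fun v => ?_, fun v u => ?_⟩
  · simp [h₁.map_incl, h.extends_id, h₂.map_incl, hB]
  · simp [h₂.map_one, h.map_one, h₁.map_one]
  · simp [h₂.map_tensor, h.map_tensor, h₁.map_tensor]
  · have h3 : j₂' u = A₂ (j₂ (B' u)) := by rw [h₂.map_incl, hB]
    simp [h3, h₂.map_two, h.map_pairing, ← h₁.map_two, h₁.map_incl]

variable {ω₀ : X → X → ℝ} {τ₀ : X → ℝ} {S₀ : X → X} {R : X}
  {ω₀' : X' → X' → ℝ} {τ₀' : X' → ℝ} {S₀' : X' → X'} {R' : X'}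

/-- The correction of admissible maps commutes with transport. -/
theorem IsAdmissible.corrected_conj [FiniteDimensional ℝ E₁] [FiniteDimensional ℝ E₁']
    (h : IsAdmissible ω₁ τ₁ S₁ j₁ ω₂ τ₂ S₂ j₂ Φ)
    (hr₁ : IsRegularizationAt ω₁ τ₁ S₁ j₁ ω₀ τ₀ S₀ R)
    (hr₂ : IsRegularizationAt ω₂ τ₂ S₂ j₂ ω₀ τ₀ S₀ R)
    (hr₁' : IsRegularizationAt ω₁' τ₁' S₁' j₁' ω₀' τ₀' S₀' R')
    (hr₂' : IsRegularizationAt ω₂' τ₂' S₂' j₂' ω₀' τ₀' S₀' R')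
    (h₁ : Intertwines ω₁' τ₁' S₁' j₁' ω₁ τ₁ S₁ j₁ A₁' B')
    (h₁' : Intertwines ω₁ τ₁ S₁ j₁ ω₁' τ₁' S₁' j₁' A₁ B)
    (h₂ : Intertwines ω₂ τ₂ S₂ j₂ ω₂' τ₂' S₂' j₂' A₂ B) (hB : ∀ v, B (B' v) = v)
    (hA : ∀ v, A₁ (A₁' v) = v) (hA' : ∀ v, A₁' (A₁ v) = v) :
    corrected ω₁' τ₁' ω₂' (A₂.comp (Φ.comp A₁')) = A₂.comp ((corrected ω₁ τ₁ ω₂ Φ).comp A₁') := by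
  have h' := h.conj h₁ h₂ hB
  have hd : ∀ u, defect ω₁' τ₁' ω₂' (A₂.comp (Φ.comp A₁')) u
      = A₁ (defect ω₁ τ₁ ω₂ Φ (A₁' u)) := by
    intro u
    obtain ⟨h3, h4⟩ := h.defect_spec hr₁ hr₂ (A₁' u)
    obtain ⟨h5, h6⟩ := h'.defect_spec hr₁' hr₂' u
    -- Naturality follows from the characterization of the defect by pairings, without transporting
    -- the inverse of `flat`.
    refine hr₁'.ext_of_pairing ?_ fun w => ?_
    · rw [h5, h₁'.map_one, h3]
    · rw [h6, ← hA w, h₁'.map_two, h4, hA]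
      simp [h₂.map_two, h₁.map_two]
  ext u
  simp [corrected_apply, hd, hA']

end Intertwining

/-! ### Coordinate representatives along the embedding -/

section Representatives

variable {X J E M : Type*} [NormedAddCommGroup X] [NormedSpace ℝ X]
  [TopologicalSpace J] [ChartedSpace X J]
  [NormedAddCommGroup E] [NormedSpace ℝ E] [TopologicalSpace M] [ChartedSpace E M]

/-- A map in the charts at `m₀` and `i m₀`. -/
def mapRepr (X E : Type*) [NormedAddCommGroup X] [NormedSpace ℝ X] [ChartedSpace X J]
    [NormedAddCommGroup E] [NormedSpace ℝ E] [ChartedSpace E M] (i : J → M) (m₀ : J) : X → E :=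
  chartAt E (i m₀) ∘ i ∘ (chartAt X m₀).symm

/-- A two-form along the map `i`, in the charts at `m₀` and `i m₀`. -/
def twoRepr (X : Type*) [NormedAddCommGroup X] [NormedSpace ℝ X] [ChartedSpace X J]
    (Ω : DiffForm E M 2) (i : J → M) (m₀ : J) (x : X) : E →L[ℝ] E →L[ℝ] ℝ :=
  toBilin (Ω.inChart (i m₀) (mapRepr X E i m₀ x))

/-- A one-form along the map `i`, in the charts at `m₀` and `i m₀`. -/
def oneRepr (X : Type*) [NormedAddCommGroup X] [NormedSpace ℝ X] [ChartedSpace X J]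
    (τ : OneForm E M) (i : J → M) (m₀ : J) (x : X) : E →L[ℝ] ℝ :=
  toLinear (τ.toForm.inChart (i m₀) (mapRepr X E i m₀ x))

/-- A `(1,1)`-tensor field along the map `i`, in the charts at `m₀` and `i m₀`. -/
def endRepr (X : Type*) [NormedAddCommGroup X] [NormedSpace ℝ X] [ChartedSpace X J]
    (S : EndField E M) (i : J → M) (m₀ : J) (x : X) : E →L[ℝ] E :=
  S.inChart (i m₀) (mapRepr X E i m₀ x)

/-- Pointwise facts are established at points of J; this turns them into facts about nearby
coordinates, where smooth families are parametrized. -/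
theorem eventually_chartAt {X J : Type*} [TopologicalSpace X] [TopologicalSpace J]
    [ChartedSpace X J] {P : X → Prop} {m₀ : J} (h : ∀ᶠ k in 𝓝 m₀, P (chartAt X m₀ k)) :
    ∀ᶠ x in 𝓝 (chartAt X m₀ m₀), P x := by
  rw [← (chartAt X m₀).map_nhds_eq (mem_chart_source X m₀)]
  exact h

theorem contDiff_toBilin : ContDiff ℝ ∞ (fun α : E [⋀^Fin 2]→L[ℝ] ℝ => toBilin α) := by
  fun_prop

theorem contDiff_toLinear : ContDiff ℝ ∞ (fun α : E [⋀^Fin 1]→L[ℝ] ℝ => toLinear α) := by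
  fun_prop

theorem toBilin_inChart (Ω : DiffForm E M 2) {p q : M} (hq : q ∈ (chartAt E p).source) (u v : E) :
    toBilin (Ω.inChart p (chartAt E p q)) u v
      = twoAt Ω q (dchartSymm p q u) (dchartSymm p q v) := by
  -- The base point equals q only propositionally. `twoAt` takes values in a space that does not
  -- depend on the point, so rewriting is possible.
  have h : twoAt Ω ((chartAt E p).symm (chartAt E p q)) = twoAt Ω q := by
    rw [(chartAt E p).left_inv hq]
  rw [← h, toBilin_apply]
  refine Eq.trans ?_ (twoAt_apply Ω ((chartAt E p).symm (chartAt E p q)) _ _).symm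
  change (Ω ((chartAt E p).symm (chartAt E p q)) : E [⋀^Fin 2]→L[ℝ] ℝ)
    (dchartSymm (E := E) p q ∘ ![u, v]) = _
  refine congrArg (Ω ((chartAt E p).symm (chartAt E p q)) : E [⋀^Fin 2]→L[ℝ] ℝ) ?_
  funext i
  fin_cases i <;> rfl

theorem toLinear_inChart (τ : OneForm E M) {p q : M} (hq : q ∈ (chartAt E p).source) :
    toLinear (τ.toForm.inChart p (chartAt E p q)) = (oneAt τ q).comp (dchartSymm p q) := by
  have h : oneAt τ ((chartAt E p).symm (chartAt E p q)) = oneAt τ q := by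
    rw [(chartAt E p).left_inv hq]
  rw [← h]
  rfl

theorem endField_inChart (S : EndField E M) {p q : M} (hq : q ∈ (chartAt E p).source) :
    S.inChart p (chartAt E p q) = (dchart p q).comp ((endAt S q).comp (dchartSymm p q)) := by
  have h : endAt S ((chartAt E p).symm (chartAt E p q)) = endAt S q := by
    rw [(chartAt E p).left_inv hq]
  have h' : dchart (E := E) p ((chartAt E p).symm (chartAt E p q)) = dchart p q := by
    rw [(chartAt E p).left_inv hq]
  rw [← h, ← h']
  rfl

variable {Ω : DiffForm E M 2} {τ : OneForm E M} {S : EndField E M} {i : J → M} {m₀ k : J}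
  {ω₀ : J → X → X → ℝ} {τ₀ : J → X → ℝ} {S₀ : J → X → X} {R : J → X}

theorem mapRepr_chartAt (hk : k ∈ (chartAt X m₀).source) :
    mapRepr X E i m₀ (chartAt X m₀ k) = chartAt E (i m₀) (i k) := by
  simp [mapRepr, (chartAt X m₀).left_inv hk]

theorem twoRepr_chartAt (hk : k ∈ (chartAt X m₀).source) (hik : i k ∈ (chartAt E (i m₀)).source)
    (u v : E) : twoRepr X Ω i m₀ (chartAt X m₀ k) u v
      = twoAt Ω (i k) (dchartSymm (i m₀) (i k) u) (dchartSymm (i m₀) (i k) v) := by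
  rw [twoRepr, mapRepr_chartAt hk, toBilin_inChart Ω hik]

theorem oneRepr_chartAt (hk : k ∈ (chartAt X m₀).source) (hik : i k ∈ (chartAt E (i m₀)).source) :
    oneRepr X τ i m₀ (chartAt X m₀ k) = (oneAt τ (i k)).comp (dchartSymm (i m₀) (i k)) := by
  rw [oneRepr, mapRepr_chartAt hk, toLinear_inChart τ hik]

theorem endRepr_chartAt (hk : k ∈ (chartAt X m₀).source) (hik : i k ∈ (chartAt E (i m₀)).source) :
    endRepr X S i m₀ (chartAt X m₀ k)
      = (dchart (i m₀) (i k)).comp ((endAt S (i k)).comp (dchartSymm (i m₀) (i k))) := by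
  rw [endRepr, mapRepr_chartAt hk, endField_inChart S hik]

/-- Smooth structures on `M`, along a smooth map `i : J → M`, which make `i` a regularization. -/
structure IsSmoothRegularization (Ω : DiffForm E M 2) (τ : OneForm E M) (S : EndField E M)
    (i : J → M) (ω₀ : J → X → X → ℝ) (τ₀ : J → X → ℝ) (S₀ : J → X → X) (R : J → X) : Prop where
  smooth_two : Ω.Smooth
  smooth_one : τ.toForm.Smooth
  smooth_tensor : S.Smooth
  smooth_map : ContMDiff 𝓘(ℝ, X) 𝓘(ℝ, E) ∞ i
  isRegularizationAt : ∀ m, IsRegularizationAt (twoAt Ω (i m)) (oneAt τ (i m)) (endAt S (i m))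
    (dmap (E := X) (E' := E) i m) (ω₀ m) (τ₀ m) (S₀ m) (R m)

theorem IsSmoothRegularization.eventually_mem (h : IsSmoothRegularization Ω τ S i ω₀ τ₀ S₀ R) (m₀ : J) :
    ∀ᶠ k in 𝓝 m₀, k ∈ (chartAt X m₀).source ∧ i k ∈ (chartAt E (i m₀)).source :=
  ((chartAt X m₀).open_source.eventually_mem (mem_chart_source X m₀)).and
    (h.smooth_map.continuous.continuousAt.eventually
      ((chartAt E (i m₀)).open_source.mem_nhds (mem_chart_source E (i m₀))))

variable [IsManifold 𝓘(ℝ, X) ∞ J] [IsManifold 𝓘(ℝ, E) ∞ M]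

theorem fderiv_mapRepr_chartAt (hk : k ∈ (chartAt X m₀).source)
    (hik : i k ∈ (chartAt E (i m₀)).source) (hi : ContMDiff 𝓘(ℝ, X) 𝓘(ℝ, E) ∞ i) :
    fderiv ℝ (mapRepr X E i m₀) (chartAt X m₀ k)
      = (dchart (i m₀) (i k)).comp ((dmap (E := X) (E' := E) i k).comp (dchartSymm m₀ k)) :=
  (hasFDerivAt_inCharts hk hik (hi.mdifferentiableAt (by simp))).fderiv

namespace IsSmoothRegularization

theorem contDiffAt_mapRepr (h : IsSmoothRegularization Ω τ S i ω₀ τ₀ S₀ R) (m₀ : J) :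
    ∀ᶠ x in 𝓝 (chartAt X m₀ m₀), ContDiffAt ℝ ∞ (mapRepr X E i m₀) x :=
  eventually_chartAt <| (h.eventually_mem m₀).mono fun _ hk =>
    contDiffAt_inCharts hk.1 hk.2 h.smooth_map.contMDiffAt

theorem contDiffAt_fderiv_mapRepr (h : IsSmoothRegularization Ω τ S i ω₀ τ₀ S₀ R) (m₀ : J) :
    ∀ᶠ x in 𝓝 (chartAt X m₀ m₀), ContDiffAt ℝ ∞ (fderiv ℝ (mapRepr X E i m₀)) x :=
  (h.contDiffAt_mapRepr m₀).mono fun _ hx => hx.fderiv_right (m := ∞) (by simp)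

theorem contDiffAt_comp_mapRepr (h : IsSmoothRegularization Ω τ S i ω₀ τ₀ S₀ R) (m₀ : J)
    {G : Type*} [NormedAddCommGroup G] [NormedSpace ℝ G] {g : E → G}
    (hg : ContDiffOn ℝ ∞ g (chartAt E (i m₀)).target) :
    ∀ᶠ x in 𝓝 (chartAt X m₀ m₀), ContDiffAt ℝ ∞ (fun x => g (mapRepr X E i m₀ x)) x := by
  refine eventually_chartAt ((h.eventually_mem m₀).mono fun k hk => ?_)
  refine ContDiffAt.comp (g := g) _ (hg.contDiffAt ?_)
    (contDiffAt_inCharts hk.1 hk.2 h.smooth_map.contMDiffAt)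
  rw [mapRepr_chartAt hk.1]
  exact (chartAt E (i m₀)).open_target.mem_nhds ((chartAt E (i m₀)).map_source hk.2)

theorem contDiffAt_twoRepr (h : IsSmoothRegularization Ω τ S i ω₀ τ₀ S₀ R) (m₀ : J) :
    ∀ᶠ x in 𝓝 (chartAt X m₀ m₀), ContDiffAt ℝ ∞ (twoRepr X Ω i m₀) x :=
  h.contDiffAt_comp_mapRepr m₀ (contDiff_toBilin.comp_contDiffOn (h.smooth_two (i m₀)))

theorem contDiffAt_oneRepr (h : IsSmoothRegularization Ω τ S i ω₀ τ₀ S₀ R) (m₀ : J) :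
    ∀ᶠ x in 𝓝 (chartAt X m₀ m₀), ContDiffAt ℝ ∞ (oneRepr X τ i m₀) x :=
  h.contDiffAt_comp_mapRepr m₀ (contDiff_toLinear.comp_contDiffOn (h.smooth_one (i m₀)))

theorem contDiffAt_endRepr (h : IsSmoothRegularization Ω τ S i ω₀ τ₀ S₀ R) (m₀ : J) :
    ∀ᶠ x in 𝓝 (chartAt X m₀ m₀), ContDiffAt ℝ ∞ (endRepr X S i m₀) x :=
  h.contDiffAt_comp_mapRepr m₀ (h.smooth_tensor (i m₀))

theorem isRegularizationAt_repr (h : IsSmoothRegularization Ω τ S i ω₀ τ₀ S₀ R)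
    (hk : k ∈ (chartAt X m₀).source) (hik : i k ∈ (chartAt E (i m₀)).source) :
    IsRegularizationAt (twoRepr X Ω i m₀ (chartAt X m₀ k)) (oneRepr X τ i m₀ (chartAt X m₀ k))
      (endRepr X S i m₀ (chartAt X m₀ k)) (fderiv ℝ (mapRepr X E i m₀) (chartAt X m₀ k))
      (fun u v => ω₀ k (dchartSymm m₀ k u) (dchartSymm m₀ k v))
      (fun u => τ₀ k (dchartSymm m₀ k u))
      (fun u => dchart m₀ k (S₀ k (dchartSymm m₀ k u))) (dchart m₀ k (R k)) := by
  rw [oneRepr_chartAt hk hik, endRepr_chartAt hk hik, fderiv_mapRepr_chartAt hk hik h.smooth_map]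
  exact (h.isRegularizationAt k).conj (dchart_dchartSymm hik) (dchartSymm_dchart hik)
    (dchart_dchartSymm hk) (dchartSymm_dchart hk) (twoRepr_chartAt hk hik)

theorem intertwines_dchartSymm (h : IsSmoothRegularization Ω τ S i ω₀ τ₀ S₀ R)
    (hk : k ∈ (chartAt X m₀).source) (hik : i k ∈ (chartAt E (i m₀)).source) :
    Intertwines (twoRepr X Ω i m₀ (chartAt X m₀ k)) (oneRepr X τ i m₀ (chartAt X m₀ k))
      (endRepr X S i m₀ (chartAt X m₀ k)) (fderiv ℝ (mapRepr X E i m₀) (chartAt X m₀ k))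
      (twoAt Ω (i k)) (oneAt τ (i k)) (endAt S (i k)) (dmap (E := X) (E' := E) i k)
      (dchartSymm (i m₀) (i k)) (dchartSymm m₀ k) := by
  rw [oneRepr_chartAt hk hik, endRepr_chartAt hk hik, fderiv_mapRepr_chartAt hk hik h.smooth_map]
  refine ⟨fun u v => (twoRepr_chartAt hk hik u v).symm, fun v => rfl, fun v => ?_, fun u => ?_⟩ <;>
  simp [dchartSymm_dchart hik]

theorem intertwines_dchart (h : IsSmoothRegularization Ω τ S i ω₀ τ₀ S₀ R)
    (hk : k ∈ (chartAt X m₀).source) (hik : i k ∈ (chartAt E (i m₀)).source) :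
    Intertwines (twoAt Ω (i k)) (oneAt τ (i k)) (endAt S (i k)) (dmap (E := X) (E' := E) i k)
      (twoRepr X Ω i m₀ (chartAt X m₀ k)) (oneRepr X τ i m₀ (chartAt X m₀ k))
      (endRepr X S i m₀ (chartAt X m₀ k)) (fderiv ℝ (mapRepr X E i m₀) (chartAt X m₀ k))
      (dchart (i m₀) (i k)) (dchart m₀ k) := by
  rw [oneRepr_chartAt hk hik, endRepr_chartAt hk hik, fderiv_mapRepr_chartAt hk hik h.smooth_map]
  refine ⟨fun u v => ?_, fun v => ?_, fun v => ?_, fun u => ?_⟩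
  · rw [twoRepr_chartAt hk hik, dchartSymm_dchart hik, dchartSymm_dchart hik]
  all_goals simp [dchartSymm_dchart hik, dchartSymm_dchart hk]

theorem injective_fderiv_mapRepr
    (h : IsSmoothRegularization Ω τ S i ω₀ τ₀ S₀ R) (m₀ : J) :
    Function.Injective (fderiv ℝ (mapRepr X E i m₀) (chartAt X m₀ m₀)) :=
  (h.isRegularizationAt_repr (mem_chart_source X m₀) (mem_chart_source E (i m₀))).injective

end IsSmoothRegularization

end Representatives

/-! ### Construction of the diffeomorphism -/

section Construction

variable {X J E₁ M₁ E₂ M₂ : Type*} [NormedAddCommGroup X] [NormedSpace ℝ X] [FiniteDimensional ℝ X]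
  [TopologicalSpace J] [ChartedSpace X J]
  [NormedAddCommGroup E₁] [NormedSpace ℝ E₁] [FiniteDimensional ℝ E₁]
  [TopologicalSpace M₁] [ChartedSpace E₁ M₁]
  [NormedAddCommGroup E₂] [NormedSpace ℝ E₂]
  [TopologicalSpace M₂] [ChartedSpace E₂ M₂]
  {Ω₁ : DiffForm E₁ M₁ 2} {τ₁ : OneForm E₁ M₁} {S₁ : EndField E₁ M₁} {i₁ : J → M₁}
  {Ω₂ : DiffForm E₂ M₂ 2} {τ₂ : OneForm E₂ M₂} {S₂ : EndField E₂ M₂} {i₂ : J → M₂}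
  {ω₀ : J → X → X → ℝ} {τ₀ : J → X → ℝ} {S₀ : J → X → X} {R : J → X}

/-- The admissible linear maps at a point of `J`. -/
def admissible (X : Type*) [NormedAddCommGroup X] [NormedSpace ℝ X] [ChartedSpace X J]
    (Ω₁ : DiffForm E₁ M₁ 2) (τ₁ : OneForm E₁ M₁) (S₁ : EndField E₁ M₁) (i₁ : J → M₁)
    (Ω₂ : DiffForm E₂ M₂ 2) (τ₂ : OneForm E₂ M₂) (S₂ : EndField E₂ M₂) (i₂ : J → M₂) (m : J) :
    Set (E₁ →L[ℝ] E₂) :=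
  {Φ | IsAdmissible (twoAt Ω₁ (i₁ m)) (oneAt τ₁ (i₁ m)) (endAt S₁ (i₁ m))
    (dmap (E := X) (E' := E₁) i₁ m) (twoAt Ω₂ (i₂ m)) (oneAt τ₂ (i₂ m)) (endAt S₂ (i₂ m))
    (dmap (E := X) (E' := E₂) i₂ m) Φ}

/-- Constant families over ℝ turn the smooth existence result into existence of one admissible map,
which is injective. Exchanging the two regularizations gives equal dimensions. -/
theorem finrank_le_of_isSmoothRegularization [FiniteDimensional ℝ E₂]
    (h₁ : IsSmoothRegularization Ω₁ τ₁ S₁ i₁ ω₀ τ₀ S₀ R)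
    (h₂ : IsSmoothRegularization Ω₂ τ₂ S₂ i₂ ω₀ τ₀ S₀ R) (m : J) :
    Module.finrank ℝ E₁ ≤ Module.finrank ℝ E₂ := by
  obtain ⟨Φ, hΦ⟩ := exists_contDiffAt_isAdmissible (x₀ := (0 : ℝ))
    (.of_forall fun _ => contDiffAt_const) (.of_forall fun _ => contDiffAt_const)
    (.of_forall fun _ => contDiffAt_const) (.of_forall fun _ => contDiffAt_const)
    (.of_forall fun _ => contDiffAt_const) (.of_forall fun _ => contDiffAt_const)
    (.of_forall fun _ => contDiffAt_const) (.of_forall fun _ => contDiffAt_const)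
    (.of_forall fun _ => h₁.isRegularizationAt m) (.of_forall fun _ => h₂.isRegularizationAt m)
  exact LinearMap.finrank_le_finrank_of_injective (f := (Φ 0).toLinearMap)
    (hΦ.self_of_nhds.2.injective (h₁.isRegularizationAt m) (h₂.isRegularizationAt m))

variable [IsManifold 𝓘(ℝ, X) ∞ J] [IsManifold 𝓘(ℝ, E₁) ∞ M₁] [IsManifold 𝓘(ℝ, E₂) ∞ M₂]

/-- A smooth family of linear maps in charts which are compatible with the differentials of `i₁` and
`i₂` is the differential along `J` of a local map extending the identity of `J`. -/
theorem exists_contMDiffOn_of_family {i₁ : J → M₁} {i₂ : J → M₂} (hi₁ : Topology.IsInducing i₁)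
    (hs₁ : ContMDiff 𝓘(ℝ, X) 𝓘(ℝ, E₁) ∞ i₁) (hs₂ : ContMDiff 𝓘(ℝ, X) 𝓘(ℝ, E₂) ∞ i₂) (m₀ : J)
    (hinj : Function.Injective (fderiv ℝ (mapRepr X E₁ i₁ m₀) (chartAt X m₀ m₀)))
    {Φ : X → E₁ →L[ℝ] E₂} (hΦ : ∀ᶠ k in 𝓝 m₀, ContDiffAt ℝ ∞ Φ (chartAt X m₀ k))
    (hcomp : ∀ᶠ k in 𝓝 m₀, (Φ (chartAt X m₀ k)).comp (fderiv ℝ (mapRepr X E₁ i₁ m₀) (chartAt X m₀ k))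
      = fderiv ℝ (mapRepr X E₂ i₂ m₀) (chartAt X m₀ k))
    {C : J → Set (E₁ →L[ℝ] E₂)} (hC : ∀ᶠ k in 𝓝 m₀, (dchartSymm (i₂ m₀) (i₂ k)).comp
      ((Φ (chartAt X m₀ k)).comp (dchart (i₁ m₀) (i₁ k))) ∈ C k) :
    ∃ (f : M₁ → M₂) (U : Set M₁), IsOpen U ∧ i₁ m₀ ∈ U ∧
      ContMDiffOn 𝓘(ℝ, E₁) 𝓘(ℝ, E₂) ∞ f U ∧
      ∀ k, i₁ k ∈ U → f (i₁ k) = i₂ k ∧ dmap f (i₁ k) ∈ C k := by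
  have hmem₁ : ∀ᶠ k in 𝓝 m₀, i₁ k ∈ (chartAt E₁ (i₁ m₀)).source :=
    hs₁.continuous.continuousAt.eventually
      ((chartAt E₁ (i₁ m₀)).open_source.mem_nhds (mem_chart_source E₁ (i₁ m₀)))
  have hmem₂ : ∀ᶠ k in 𝓝 m₀, i₂ k ∈ (chartAt E₂ (i₂ m₀)).source :=
    hs₂.continuous.continuousAt.eventually
      ((chartAt E₂ (i₂ m₀)).open_source.mem_nhds (mem_chart_source E₂ (i₂ m₀)))
  have hmem : ∀ᶠ k in 𝓝 m₀, k ∈ (chartAt X m₀).source :=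
    (chartAt X m₀).open_source.mem_nhds (mem_chart_source X m₀)
  obtain ⟨g, hg, hgf⟩ := exists_contDiffAt_hasFDerivAt_along
    (f₁ := mapRepr X E₁ i₁ m₀) (f₂ := mapRepr X E₂ i₂ m₀) (Φ := Φ) (x₀ := chartAt X m₀ m₀)
    (eventually_chartAt <| (hmem.and hmem₁).mono fun _ hk =>
      contDiffAt_inCharts hk.1 hk.2 hs₁.contMDiffAt)
    (eventually_chartAt <| (hmem.and hmem₂).mono fun _ hk =>
      contDiffAt_inCharts hk.1 hk.2 hs₂.contMDiffAt)
    (eventually_chartAt hΦ) hinj (eventually_chartAt hcomp)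
  rw [mapRepr_chartAt (mem_chart_source X m₀)] at hg
  set φ₁ := chartAt E₁ (i₁ m₀)
  set φ₂ := chartAt E₂ (i₂ m₀)
  have hgk : ∀ᶠ k in 𝓝 m₀, g (φ₁ (i₁ k)) = φ₂ (i₂ k) ∧
      HasFDerivAt g (Φ (chartAt X m₀ k)) (φ₁ (i₁ k)) := by
    filter_upwards [((chartAt X m₀).continuousAt (mem_chart_source X m₀)).eventually hgf, hmem]
      with k hk hk'
    rwa [mapRepr_chartAt hk', mapRepr_chartAt hk'] at hk
  have h0 : g (φ₁ (i₁ m₀)) = φ₂ (i₂ m₀) := hgk.self_of_nhds.1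
  have hq : ∀ᶠ q in 𝓝 (i₁ m₀), q ∈ φ₁.source ∧ ContDiffAt ℝ ∞ g (φ₁ q) ∧ g (φ₁ q) ∈ φ₂.target := by
    have h1 : ContinuousAt φ₁ (i₁ m₀) := φ₁.continuousAt (mem_chart_source E₁ (i₁ m₀))
    refine (φ₁.open_source.eventually_mem (mem_chart_source E₁ (i₁ m₀))).and
      ((h1.eventually hg).and ?_)
    refine h1.eventually (hg.self_of_nhds.continuousAt.eventually (φ₂.open_target.mem_nhds ?_))
    rw [h0]
    exact φ₂.map_source (mem_chart_source E₂ (i₂ m₀))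
  have hk := hgk.and (hC.and hmem₂)
  -- Since i₁ is inducing, a property of k near m₀ becomes one of all k with i₁ k near i₁ m₀, so no
  -- other part of J meets U.
  rw [hi₁.nhds_eq_comap, Filter.eventually_comap] at hk
  obtain ⟨U, hU, hUo, hmU⟩ := eventually_nhds_iff.1 (hq.and hk)
  refine ⟨φ₂.symm ∘ g ∘ φ₁, U, hUo, hmU, fun q hqU => ?_, fun k hkU => ?_⟩
  · obtain ⟨h1, h2, h3⟩ := (hU q hqU).1
    refine ContMDiffAt.contMDiffWithinAt ?_
    exact (contMDiffAt_chartAt_symm h3).comp q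
      (h2.contMDiffAt.comp q (contMDiffAt_chartAt h1))
  · obtain ⟨h1, h2, h3⟩ := (hU _ hkU).1
    obtain ⟨⟨h4, h5⟩, h6, h7⟩ := (hU _ hkU).2 k rfl
    refine ⟨by simp [h4, φ₂.left_inv h7], ?_⟩
    have h8 : HasMFDerivAt 𝓘(ℝ, E₁) 𝓘(ℝ, E₁) φ₁ (i₁ k) (dchart (E := E₁) (i₁ m₀) (i₁ k)) :=
      ((contMDiffAt_chartAt h1).mdifferentiableAt (by simp)).hasMFDerivAt
    have h9 : HasMFDerivAt 𝓘(ℝ, E₂) 𝓘(ℝ, E₂) φ₂.symm (g (φ₁ (i₁ k)))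
        (dchartSymm (E := E₂) (i₂ m₀) (i₂ k)) := by
      rw [h4]
      exact ((contMDiffAt_chartAt_symm (φ₂.map_source h7)).mdifferentiableAt (by simp)).hasMFDerivAt
    have h10 := h9.comp (i₁ k) (h5.hasMFDerivAt.comp (i₁ k) h8)
    have h11 : dmap (E := E₁) (E' := E₂) (φ₂.symm ∘ g ∘ φ₁) (i₁ k) = (dchartSymm (i₂ m₀) (i₂ k)).comp
      ((Φ (chartAt X m₀ k)).comp (dchart (i₁ m₀) (i₁ k))) := h10.mfderiv
    rw [h11]
    exact h6

theorem exists_contMDiffOn_admissible [FiniteDimensional ℝ E₂]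
    (h₁ : IsSmoothRegularization Ω₁ τ₁ S₁ i₁ ω₀ τ₀ S₀ R)
    (h₂ : IsSmoothRegularization Ω₂ τ₂ S₂ i₂ ω₀ τ₀ S₀ R) (hi₁ : Topology.IsInducing i₁) (m₀ : J) :
    ∃ (f : M₁ → M₂) (U : Set M₁), IsOpen U ∧ i₁ m₀ ∈ U ∧
      ContMDiffOn 𝓘(ℝ, E₁) 𝓘(ℝ, E₂) ∞ f U ∧
      ∀ k, i₁ k ∈ U → f (i₁ k) = i₂ k ∧
        dmap f (i₁ k) ∈ admissible X Ω₁ τ₁ S₁ i₁ Ω₂ τ₂ S₂ i₂ k := by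
  let χ := chartAt X m₀
  have hmem := (h₁.eventually_mem m₀).and (h₂.eventually_mem m₀)
  -- The data on J, read in the chart at m₀, only have to be common to both sides; no smoothness of
  -- them is required.
  obtain ⟨Φ, hΦ⟩ := exists_contDiffAt_isAdmissible (x₀ := χ m₀)
    (Ω₀ := fun x u v => ω₀ (χ.symm x) (dchartSymm m₀ (χ.symm x) u) (dchartSymm m₀ (χ.symm x) v))
    (τ₀ := fun x u => τ₀ (χ.symm x) (dchartSymm m₀ (χ.symm x) u))
    (S₀ := fun x u => dchart m₀ (χ.symm x) (S₀ (χ.symm x) (dchartSymm m₀ (χ.symm x) u)))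
    (R := fun x => dchart m₀ (χ.symm x) (R (χ.symm x)))
    (h₁.contDiffAt_twoRepr m₀) (h₁.contDiffAt_oneRepr m₀) (h₁.contDiffAt_endRepr m₀)
    (h₁.contDiffAt_fderiv_mapRepr m₀) (h₂.contDiffAt_twoRepr m₀) (h₂.contDiffAt_oneRepr m₀)
    (h₂.contDiffAt_endRepr m₀) (h₂.contDiffAt_fderiv_mapRepr m₀)
    (eventually_chartAt <| hmem.mono fun k hk => by
      simp only [χ, (chartAt X m₀).left_inv hk.1.1]
      exact h₁.isRegularizationAt_repr hk.1.1 hk.1.2)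
    (eventually_chartAt <| hmem.mono fun k hk => by
      simp only [χ, (chartAt X m₀).left_inv hk.1.1]
      exact h₂.isRegularizationAt_repr hk.2.1 hk.2.2)
  have hΦ' : ∀ᶠ k in 𝓝 m₀, _ := (χ.continuousAt (mem_chart_source X m₀)).eventually hΦ
  refine exists_contMDiffOn_of_family hi₁ h₁.smooth_map h₂.smooth_map m₀
    (h₁.injective_fderiv_mapRepr m₀) (hΦ'.mono fun k hk => hk.1)
    (hΦ'.mono fun k hk => ContinuousLinearMap.ext hk.2.extends_id) ?_
  filter_upwards [hΦ', hmem] with k hk hk'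
  exact hk.2.conj (h₁.intertwines_dchart hk'.1.1 hk'.1.2)
    (h₂.intertwines_dchartSymm hk'.2.1 hk'.2.2) (dchartSymm_dchart hk'.1.1)

/-- The target is a singleton, trivially convex, so gluing will reproduce the corrected differential
exactly. In charts the correction is smooth in its data, and `IsAdmissible.corrected_conj` shows
that it is the same map in every chart. -/
theorem exists_contMDiffOn_corrected (h₁ : IsSmoothRegularization Ω₁ τ₁ S₁ i₁ ω₀ τ₀ S₀ R)
    (h₂ : IsSmoothRegularization Ω₂ τ₂ S₂ i₂ ω₀ τ₀ S₀ R) (hi₁ : Topology.IsInducing i₁)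
    {ψ : M₁ → M₂} (hψ : ∀ m, ContMDiffAt 𝓘(ℝ, E₁) 𝓘(ℝ, E₂) ∞ ψ (i₁ m))
    (hψi : ∀ m, ψ (i₁ m) = i₂ m)
    (hψa : ∀ m, dmap ψ (i₁ m) ∈ admissible X Ω₁ τ₁ S₁ i₁ Ω₂ τ₂ S₂ i₂ m) (m₀ : J) :
    ∃ (f : M₁ → M₂) (U : Set M₁), IsOpen U ∧ i₁ m₀ ∈ U ∧
      ContMDiffOn 𝓘(ℝ, E₁) 𝓘(ℝ, E₂) ∞ f U ∧
      ∀ k, i₁ k ∈ U → f (i₁ k) = i₂ k ∧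
        dmap f (i₁ k) ∈ ({corrected (twoAt Ω₁ (i₁ k)) (oneAt τ₁ (i₁ k)) (twoAt Ω₂ (i₂ k))
          (dmap ψ (i₁ k))} : Set (E₁ →L[ℝ] E₂)) := by
  let χ := chartAt X m₀
  have hmem := (h₁.eventually_mem m₀).and (h₂.eventually_mem m₀)
  let P : X → E₁ →L[ℝ] E₂ := fun x =>
    fderiv ℝ (chartAt E₂ (i₂ m₀) ∘ ψ ∘ (chartAt E₁ (i₁ m₀)).symm) (mapRepr X E₁ i₁ m₀ x)
  have hPk : ∀ᶠ k in 𝓝 m₀, P (χ k) = (dchart (i₂ m₀) (i₂ k)).comp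
      ((dmap ψ (i₁ k)).comp (dchartSymm (i₁ m₀) (i₁ k))) := by
    filter_upwards [hmem] with k hk
    have h3 : ψ (i₁ k) ∈ (chartAt E₂ (i₂ m₀)).source := by rw [hψi]; exact hk.2.2
    have h4 := (hasFDerivAt_inCharts hk.1.2 h3 ((hψ k).mdifferentiableAt (by simp))).fderiv
    rw [hψi] at h4
    simp only [P, χ]
    rw [mapRepr_chartAt hk.1.1]
    exact h4
  have hPs : ∀ᶠ k in 𝓝 m₀, ContDiffAt ℝ ∞ P (χ k) := by
    filter_upwards [hmem] with k hk
    have h3 : ψ (i₁ k) ∈ (chartAt E₂ (i₂ m₀)).source := by rw [hψi]; exact hk.2.2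
    have h4 := contDiffAt_inCharts hk.1.2 h3 (hψ k)
    rw [← mapRepr_chartAt (X := X) hk.1.1] at h4
    exact (h4.fderiv_right (m := ∞) (by simp)).comp _
      (contDiffAt_inCharts hk.1.1 hk.1.2 h₁.smooth_map.contMDiffAt)
  have hadm : ∀ᶠ k in 𝓝 m₀, IsAdmissible (twoRepr X Ω₁ i₁ m₀ (χ k)) (oneRepr X τ₁ i₁ m₀ (χ k))
      (endRepr X S₁ i₁ m₀ (χ k)) (fderiv ℝ (mapRepr X E₁ i₁ m₀) (χ k))
      (twoRepr X Ω₂ i₂ m₀ (χ k)) (oneRepr X τ₂ i₂ m₀ (χ k))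
      (endRepr X S₂ i₂ m₀ (χ k)) (fderiv ℝ (mapRepr X E₂ i₂ m₀) (χ k)) (P (χ k)) := by
    filter_upwards [hmem, hPk] with k hk hk'
    rw [hk']
    exact (hψa k).conj (h₁.intertwines_dchartSymm hk.1.1 hk.1.2)
      (h₂.intertwines_dchart hk.2.1 hk.2.2) (dchart_dchartSymm hk.1.1)
  have hχ : ∀ {p : X → Prop}, (∀ᶠ x in 𝓝 (χ m₀), p x) → ∀ᶠ k in 𝓝 m₀, p (χ k) :=
    fun hp => (χ.continuousAt (mem_chart_source X m₀)).eventually hp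
  refine exists_contMDiffOn_of_family hi₁ h₁.smooth_map h₂.smooth_map m₀
    (h₁.injective_fderiv_mapRepr m₀)
    (Φ := fun x => corrected (twoRepr X Ω₁ i₁ m₀ x) (oneRepr X τ₁ i₁ m₀ x)
      (twoRepr X Ω₂ i₂ m₀ x) (P x)) ?_ ?_ ?_
  · filter_upwards [hmem, hPs, hχ (h₁.contDiffAt_twoRepr m₀), hχ (h₁.contDiffAt_oneRepr m₀),
      hχ (h₂.contDiffAt_twoRepr m₀)] with k hk hk1 hk2 hk3 hk4
    exact contDiffAt_corrected (S₁ := fun x => endRepr X S₁ i₁ m₀ x)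
      (j₁ := fun x => fderiv ℝ (mapRepr X E₁ i₁ m₀) x) (Ω₀ := fun _ => _) (τ₀ := fun _ => _)
      (S₀ := fun _ => _) (R := fun _ => _) hk2 hk3 hk4 hk1
      (h₁.isRegularizationAt_repr hk.1.1 hk.1.2)
  · filter_upwards [hmem, hadm] with k hk hk'
    exact ContinuousLinearMap.ext (hk'.corrected_spec
      (h₁.isRegularizationAt_repr hk.1.1 hk.1.2) (h₂.isRegularizationAt_repr hk.2.1 hk.2.2)).2.extends_id
  · filter_upwards [hmem, hPk] with k hk hk'
    have h3 := (hψa k).corrected_conj (h₁.isRegularizationAt k) (h₂.isRegularizationAt k)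
      (h₁.isRegularizationAt_repr hk.1.1 hk.1.2) (h₂.isRegularizationAt_repr hk.2.1 hk.2.2)
      (h₁.intertwines_dchartSymm hk.1.1 hk.1.2) (h₁.intertwines_dchart hk.1.1 hk.1.2)
      (h₂.intertwines_dchart hk.2.1 hk.2.2) (dchart_dchartSymm hk.1.1)
      (dchart_dchartSymm hk.1.2) (dchartSymm_dchart hk.1.2)
    change (dchartSymm (i₂ m₀) (i₂ k)).comp ((corrected _ _ _ (P (χ k))).comp
      (dchart (i₁ m₀) (i₁ k))) = _
    rw [hk', h3]
    ext v
    simp [dchartSymm_dchart hk.1.2, dchartSymm_dchart hk.2.2]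

/-- Two regularizations of the same structure are isomorphic to first order along `J`. -/
theorem exists_openPartialHomeomorph_of_isSmoothRegularization [Nonempty J] [FiniteDimensional ℝ E₂]
    [T2Space M₁] [SecondCountableTopology M₁] [T2Space M₂] [SecondCountableTopology M₂]
    (h₁ : IsSmoothRegularization Ω₁ τ₁ S₁ i₁ ω₀ τ₀ S₀ R)
    (h₂ : IsSmoothRegularization Ω₂ τ₂ S₂ i₂ ω₀ τ₀ S₀ R)
    (hi₁ : Topology.IsInducing i₁) (hi₂ : Topology.IsInducing i₂) :
    ∃ ψ : OpenPartialHomeomorph M₁ M₂, range i₁ ⊆ ψ.source ∧ range i₂ ⊆ ψ.target ∧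
      ContMDiffOn 𝓘(ℝ, E₁) 𝓘(ℝ, E₂) ∞ ψ ψ.source ∧
      ContMDiffOn 𝓘(ℝ, E₂) 𝓘(ℝ, E₁) ∞ ψ.symm ψ.target ∧ (∀ m, ψ (i₁ m) = i₂ m) ∧
      ∀ m, dmap ψ (i₁ m) ∈ admissible X Ω₁ τ₁ S₁ i₁ Ω₂ τ₂ S₂ i₂ m ∧
        ∀ u v, twoAt Ω₂ (i₂ m) (dmap ψ (i₁ m) u) (dmap ψ (i₁ m) v) = twoAt Ω₁ (i₁ m) u v := by
  have hdim : Module.finrank ℝ E₁ = Module.finrank ℝ E₂ :=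
    (finrank_le_of_isSmoothRegularization h₁ h₂ (Classical.arbitrary J)).antisymm
      (finrank_le_of_isSmoothRegularization h₂ h₁ (Classical.arbitrary J))
  have hbij : ∀ m, ∀ Φ ∈ admissible X Ω₁ τ₁ S₁ i₁ Ω₂ τ₂ S₂ i₂ m, Function.Bijective Φ := by
    intro m Φ hΦ
    have hinj : Function.Injective Φ :=
      IsAdmissible.injective (h₁.isRegularizationAt m) (h₂.isRegularizationAt m) hΦ
    exact ⟨hinj, (LinearMap.injective_iff_surjective_of_finrank_eq_finrank
      (f := Φ.toLinearMap) hdim).1 hinj⟩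
  -- First gluing: ψ has admissible differentials along J but need not preserve the two-forms.
  obtain ⟨ψ, hψ₁, hψ₂, hψ₃, -, hψi, hψa⟩ := exists_openPartialHomeomorph_of_local hi₁ hi₂
    (fun m => convex_setOf_isAdmissible) hbij (exists_contMDiffOn_admissible h₁ h₂ hi₁)
  have hspec := fun m => IsAdmissible.corrected_spec (h₁.isRegularizationAt m)
    (h₂.isRegularizationAt m) (hψa m)
  -- Second gluing: the differentials are now forced to be the corrections of those of ψ, which are
  -- admissible and hence bijective.
  obtain ⟨χ, hχ₁, hχ₂, hχ₃, hχ₄, hχi, hχa⟩ := exists_openPartialHomeomorph_of_local hi₁ hi₂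
    (fun m => convex_singleton _) (fun m Φ hΦ => by
      rw [mem_singleton_iff.1 hΦ]
      exact hbij m _ (hspec m).2)
    (exists_contMDiffOn_corrected h₁ h₂ hi₁ (fun m => hψ₃.contMDiffAt
      (ψ.open_source.mem_nhds (hψ₁ (mem_range_self m)))) hψi hψa)
  refine ⟨χ, hχ₁, hχ₂, hχ₃, hχ₄, hχi, fun m => ?_⟩
  rw [mem_singleton_iff.1 (hχa m)]
  exact ⟨(hspec m).2, (hspec m).1⟩

end Construction

/-! ### Existence of a jet -/

section Jets

open JetBundle

/-- A fibred chart supplies the jet with zero velocity coordinate. Nonemptiness serves the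
comparison of dimensions and the default values in the gluing. -/
theorem JetBundle.nonempty {EQ : Type*} [NormedAddCommGroup EQ] [NormedSpace ℝ EQ]
    {Q : Type*} [TopologicalSpace Q] [ChartedSpace EQ Q] [Nonempty Q]
    {F : Type*} [NormedAddCommGroup F] [NormedSpace ℝ F]
    {N : Type*} [TopologicalSpace N] [ChartedSpace F N] [IsManifold 𝓘(ℝ, F) ∞ N]
    (π : ConfigBundle EQ Q F N) : Nonempty (JetBundle π) := by
  obtain ⟨A, hA⟩ := exists_fibredChart π (Classical.arbitrary Q)
  exact ⟨⟨⟨_, _⟩, ofCoord_cond A (p := ((A.chart (Classical.arbitrary Q)).1,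
    (A.chart (Classical.arbitrary Q)).2, 0)) (A.chart.map_source hA)⟩⟩

end Jets

end LagReg

end

/-! ### The uniqueness theorem -/

open LagReg LagReg.JetBundle
theorem mainTheorem4
    -- the configuration bundle `π : Q → ℝ`, with standard fibre `N`
    {EQ : Type*} [NormedAddCommGroup EQ] [NormedSpace ℝ EQ] [FiniteDimensional ℝ EQ]
    {Q : Type*} [TopologicalSpace Q] [ChartedSpace EQ Q] [IsManifold 𝓘(ℝ, EQ) ∞ Q]
    [T2Space Q] [SecondCountableTopology Q] [Nonempty Q]
    {F : Type*} [NormedAddCommGroup F] [NormedSpace ℝ F] [FiniteDimensional ℝ F]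
    {N : Type*} [TopologicalSpace N] [ChartedSpace F N] [IsManifold 𝓘(ℝ, F) ∞ N]
    (π : ConfigBundle EQ Q F N)
    -- the Lagrangian
    (L : JetBundle π → ℝ) (hL : ContMDiff 𝓘(ℝ, ℝ × F × F) 𝓘(ℝ, ℝ) ∞ L)
    -- two cosymplectic regularizations
    {E₁ : Type*} [NormedAddCommGroup E₁] [NormedSpace ℝ E₁] [FiniteDimensional ℝ E₁]
    {M₁ : Type*} [TopologicalSpace M₁] [ChartedSpace E₁ M₁] [IsManifold 𝓘(ℝ, E₁) ∞ M₁]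
    [T2Space M₁] [SecondCountableTopology M₁]
    {E₂ : Type*} [NormedAddCommGroup E₂] [NormedSpace ℝ E₂] [FiniteDimensional ℝ E₂]
    {M₂ : Type*} [TopologicalSpace M₂] [ChartedSpace E₂ M₂] [IsManifold 𝓘(ℝ, E₂) ∞ M₂]
    [T2Space M₂] [SecondCountableTopology M₂]
    (Ω₁ : DiffForm E₁ M₁ 2) (τ₁ : OneForm E₁ M₁) (i₁ : JetBundle π → M₁)
    (Ω₂ : DiffForm E₂ M₂ 2) (τ₂ : OneForm E₂ M₂) (i₂ : JetBundle π → M₂)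
    (h₁ : IsCosymplecticRegularization (lagrangianForm L) (dt π) Ω₁ τ₁ i₁)
    (h₂ : IsCosymplecticRegularization (lagrangianForm L) (dt π) Ω₂ τ₂ i₂)
    -- jet structures making the two-forms Lagrangian and preserved by the embeddings
    (S₁ : EndField E₁ M₁) (S₂ : EndField E₂ M₂)
    (hS₁ : IsJetStructure S₁ τ₁) (hS₂ : IsJetStructure S₂ τ₂)
    (hΩ₁ : IsLagrangianFor S₁ Ω₁) (hΩ₂ : IsLagrangianFor S₂ Ω₂)
    (hi₁ : PreservesTensor (vertEnd π) S₁ i₁) (hi₂ : PreservesTensor (vertEnd π) S₂ i₂)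
    -- the Reeb vector fields are tangent to `J¹π` and induce the same vector field there
    (hR : ∀ m : JetBundle π, ∃ R : TangentSpace 𝓘(ℝ, ℝ × F × F) m,
      IsReebVector Ω₁ τ₁ (i₁ m) (mfderiv 𝓘(ℝ, ℝ × F × F) 𝓘(ℝ, E₁) i₁ m R) ∧
      IsReebVector Ω₂ τ₂ (i₂ m) (mfderiv 𝓘(ℝ, ℝ × F × F) 𝓘(ℝ, E₂) i₂ m R)) :
    -- a diffeomorphism between the open neighbourhoods `ψ.source` and `ψ.target` of `J¹π`
    ∃ ψ : OpenPartialHomeomorph M₁ M₂,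
      Set.range i₁ ⊆ ψ.source ∧ Set.range i₂ ⊆ ψ.target ∧
      ContMDiffOn 𝓘(ℝ, E₁) 𝓘(ℝ, E₂) ∞ ψ ψ.source ∧
      ContMDiffOn 𝓘(ℝ, E₂) 𝓘(ℝ, E₁) ∞ ψ.symm ψ.target ∧
      (∀ m, ψ (i₁ m) = i₂ m) ∧
      ∀ m : JetBundle π,
        (∀ u v : TangentSpace 𝓘(ℝ, E₁) (i₁ m),
          Ω₂ (ψ (i₁ m)) ![mfderiv 𝓘(ℝ, E₁) 𝓘(ℝ, E₂) ψ (i₁ m) u,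
            mfderiv 𝓘(ℝ, E₁) 𝓘(ℝ, E₂) ψ (i₁ m) v] = Ω₁ (i₁ m) ![u, v]) ∧
        (∀ u : TangentSpace 𝓘(ℝ, E₁) (i₁ m),
          τ₂ (ψ (i₁ m)) (mfderiv 𝓘(ℝ, E₁) 𝓘(ℝ, E₂) ψ (i₁ m) u) = τ₁ (i₁ m) u) ∧
        (∀ u : TangentSpace 𝓘(ℝ, E₁) (i₁ m),
          S₂ (ψ (i₁ m)) (mfderiv 𝓘(ℝ, E₁) 𝓘(ℝ, E₂) ψ (i₁ m) u)
            = mfderiv 𝓘(ℝ, E₁) 𝓘(ℝ, E₂) ψ (i₁ m) (S₁ (i₁ m) u)) := by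
  have hne : Nonempty (JetBundle π) := JetBundle.nonempty π
  -- A pointwise choice suffices: the linear algebra needs no regularity of R in m.
  choose R hR₁ hR₂ using hR
  have hr₁ : IsSmoothRegularization Ω₁ τ₁ S₁ i₁ (fun m u v => twoAt (lagrangianForm L) m u v)
      (fun m u => oneAt (dt π) m u) (fun m u => endAt (vertEnd π) m u) R :=
    ⟨h₁.cosymplectic.smooth_two, h₁.cosymplectic.smooth_one, hS₁.smooth_tensor,
      h₁.embedding.contMDiff, fun m => isRegularizationAt_of_isCosymplecticRegularization h₁ hS₁ hΩ₁
        hi₁ exists_vertEnd_eq m (hR₁ m)⟩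
  have hr₂ : IsSmoothRegularization Ω₂ τ₂ S₂ i₂ (fun m u v => twoAt (lagrangianForm L) m u v)
      (fun m u => oneAt (dt π) m u) (fun m u => endAt (vertEnd π) m u) R :=
    ⟨h₂.cosymplectic.smooth_two, h₂.cosymplectic.smooth_one, hS₂.smooth_tensor,
      h₂.embedding.contMDiff, fun m => isRegularizationAt_of_isCosymplecticRegularization h₂ hS₂ hΩ₂
        hi₂ exists_vertEnd_eq m (hR₂ m)⟩
  obtain ⟨ψ, hs, ht, hψ, hψ', hψi, hψa⟩ := exists_openPartialHomeomorph_of_isSmoothRegularization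
    hr₁ hr₂ h₁.embedding.isEmbedding.isInducing h₂.embedding.isEmbedding.isInducing
  refine ⟨ψ, hs, ht, hψ, hψ', hψi, fun m => ?_⟩
  obtain ⟨hadm, htwo⟩ := hψa m
  have h2 : twoAt Ω₂ (ψ (i₁ m)) = twoAt Ω₂ (i₂ m) := by rw [hψi]
  have h3 : oneAt τ₂ (ψ (i₁ m)) = oneAt τ₂ (i₂ m) := by rw [hψi]
  have h4 : endAt S₂ (ψ (i₁ m)) = endAt S₂ (i₂ m) := by rw [hψi]
  refine ⟨fun u v => ?_, fun u => ?_, fun u => ?_⟩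
  · have h5 := htwo u v
    rw [← h2] at h5
    exact ((twoAt_apply _ _ _ _).symm.trans h5).trans (twoAt_apply _ _ _ _)
  · have h5 := hadm.map_one u
    rw [← h3] at h5
    exact h5
  · have h5 := hadm.map_tensor u
    rw [← h4] at h5
    exact h5
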